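/- **Setting.** Let $\Gamma$ be a compact connected metric graph with finitely many vertices and edges (loops and multiple edges allowed); the edge $e$ is identified with $[0,\ell_e]$, $\ell_e>0$, and thereby oriented. The orientation is such that every vertex of degree two has one ingoing and one outgoing edge; interior points of edges count as points of degree two. Let $\ell_{\min}$ be the smallest edge length and $H^2(\Gamma)=\bigoplus_e H^2([0,\ell_e])$. Let $H_0=-\frac{d^2}{dx^2}$ be the Neumann–Kirchhoff Laplacian: at every vertex functions are continuous and the derivatives directed into the edges sum up to $0$. Let $\lambda_n$ be its $n$-th eigenvalue (in increasing order, with multiplicity, $n\ge 1$) with eigenfunction $f_n$, and assume that $(\lambda_n,f_n)$ is *generic*: $\lambda_n$ is simple, and at every vertex of degree larger than two neither $f_n$ nor its derivative along any edge vanishes. For $s\in\overline{\mathbb R}=\mathbb R\cup\{\infty\}$, the *$s$-points* of $f_n$ are the points $x$ of degree one or two with $f_n'(x)=s f_n(x)$ (derivative in the direction of the orientation), respectively $f_n(x)=0$ if $s=\infty$. Let $\nu_s(f_n)$ be the number of connected components of $\Gamma$ without the $s$-points ($s$-domains), let $\phi_\infty(f_n)$ be the number of $\infty$-points (nodal points),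 and let $B_s$ be the set of $s$-points of degree two (these are all $s$-points, except that for $s=0$ the vertices of degree one are left out). Let $s=\cot\alpha$ with $\alpha\in(0,\pi)$ for $s\in\mathbb R$, and $\alpha=0$ for $s=\infty$. Regard the points of $B_s$ as vertices, and for $v\in B_s$ let $u_1(v),u_1'(v)$ and $u_2(v),u_2'(v)$ be the one-sided values and derivatives (in the direction of the orientation) of $u$ on the edge entering $v$ and on the edge leaving $v$. Put $\gamma_i^s(u)=\cos\alpha\,u_i-\sin\alpha\,u_i'$ and $\gamma_i^{s\star}(u)=\sin\alpha\,u_i+\cos\alpha\,u_i'$. For $c\in\mathbb R$ such that for each $w\in\mathbb C^{B_s}$ the problem $$-u''=cu \text{ on the edges},\qquad \gamma_1^s(u)=\gamma_2^s(u)=w \text{ on } B_s,\qquad \text{Neumann–Kirchhoff conditions at all other vertices}$$ has exactly one solution $u$ in $H^2$ of the graph cut at $B_s$, the *Robin map* $\Lambda_s(c):\mathbb C^{B_s}\to\mathbb C^{B_s}$ is defined by $\Lambda_s(c)w=\gamma_1^{s\star}(u)-\gamma_2^{s\star}(u)$. Let $\mathrm{Pos}$ and $\mathrm{Mor}$ denote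 the numbers of positive and of negative eigenvalues, with multiplicity. **Theorem.** 1. If $\sqrt{\lambda_n}>\pi/\ell_{\min}$, then for every $s\in\overline{\mathbb R}$ the set $B_s$ is finite, and for all sufficiently small $\varepsilon>0$ the map $\Lambda_s(\lambda_n+\varepsilon)$ is defined and $$n-\nu_s(f_n)=\phi_\infty(f_n)-\mathrm{Pos}\big(\Lambda_s(\lambda_n+\varepsilon)\big).$$ 2. For $s=\infty$ (without the assumption $\sqrt{\lambda_n}>\pi/\ell_{\min}$) the set $B_\infty$ is finite, and for all sufficiently small $\varepsilon>0$ the map $\Lambda_\infty(\lambda_n+\varepsilon)$ is defined and $$n-\nu_\infty(f_n)=\mathrm{Mor}\big(\Lambda_\infty(\lambda_n+\varepsilon)\big).$$ -/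

import Mathlib

open MeasureTheory Set
open scoped Classical OnePoint Interval

noncomputable section

/-- `u` is (the `C¹` representative of) a function of the Sobolev space `H²(0, ℓ)` and `g` is its
second weak derivative: `u` is differentiable on `[0, ℓ]`, and `u'` is absolutely continuous with
almost everywhere derivative `g ∈ L²(0, ℓ)`. -/
def HasSecondDeriv (ℓ : ℝ) (u g : ℝ → ℂ) : Prop :=
  DifferentiableOn ℝ u (Icc 0 ℓ) ∧ MemLp g 2 (volume.restrict (Icc 0 ℓ)) ∧
    ∀ x ∈ Icc 0 ℓ,
      derivWithin u (Icc 0 ℓ) x = derivWithin u (Icc 0 ℓ) 0 + ∫ t in (0 : ℝ)..x, g t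

theorem HasSecondDeriv.intervalIntegrable {ℓ : ℝ} {u g : ℝ → ℂ} (h : HasSecondDeriv ℓ u g)
    {x : ℝ} (hx : x ∈ Icc 0 ℓ) : IntervalIntegrable g volume 0 x := by
  have h1 : Integrable g (volume.restrict (Icc 0 ℓ)) := h.2.1.integrable (by norm_num)
  rw [intervalIntegrable_iff_integrableOn_Icc_of_le hx.1]
  exact IntegrableOn.mono_set h1 (Icc_subset_Icc_right hx.2)

theorem HasSecondDeriv.add {ℓ : ℝ} {u g v h : ℝ → ℂ} (hu : HasSecondDeriv ℓ u g)
    (hv : HasSecondDeriv ℓ v h) (hℓ : 0 < ℓ) : HasSecondDeriv ℓ (u + v) (g + h) := by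
  refine ⟨hu.1.add hv.1, hu.2.1.add hv.2.1, fun x hx => ?_⟩
  have h0 : (0 : ℝ) ∈ Icc 0 ℓ := ⟨le_rfl, hℓ.le⟩
  rw [derivWithin_add (hu.1 x hx) (hv.1 x hx), derivWithin_add (hu.1 0 h0) (hv.1 0 h0),
    hu.2.2 x hx, hv.2.2 x hx]
  have : ∫ t in (0 : ℝ)..x, (g + h) t = (∫ t in (0 : ℝ)..x, g t) + ∫ t in (0 : ℝ)..x, h t :=
    intervalIntegral.integral_add (hu.intervalIntegrable hx) (hv.intervalIntegrable hx)
  rw [this]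
  ring

theorem HasSecondDeriv.smul {ℓ : ℝ} {u g : ℝ → ℂ} (hu : HasSecondDeriv ℓ u g) (a : ℂ)
    (hℓ : 0 < ℓ) : HasSecondDeriv ℓ (a • u) (a • g) := by
  refine ⟨hu.1.const_smul a, hu.2.1.const_smul a, fun x hx => ?_⟩
  have h0 : (0 : ℝ) ∈ Icc 0 ℓ := ⟨le_rfl, hℓ.le⟩
  rw [derivWithin_const_smul a (hu.1 x hx), derivWithin_const_smul a (hu.1 0 h0), hu.2.2 x hx]
  have : ∫ t in (0 : ℝ)..x, (a • g) t = a • ∫ t in (0 : ℝ)..x, g t :=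
    intervalIntegral.integral_smul a g
  rw [this, smul_add]

/-- The Prüfer angle `α` of `s ∈ ℝ ∪ {∞}`: `s = cot α` with `α ∈ (0, π)` for real `s`, and
`α = 0` for `s = ∞`. -/
def pruferAngle : OnePoint ℝ → ℝ
  | ∞ => 0
  | (s : ℝ) => Real.pi / 2 - Real.arctan s

theorem cot_pruferAngle (s : ℝ) : Real.cot (pruferAngle (s : OnePoint ℝ)) = s := by
  change Real.cot (Real.pi / 2 - Real.arctan s) = s
  rw [Real.cot_eq_cos_div_sin, Real.cos_pi_div_two_sub, Real.sin_pi_div_two_sub,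
    ← Real.tan_eq_sin_div_cos, Real.tan_arctan]

/-- A metric graph with vertex set `V` and edge set `E` (loops and multiple edges are allowed).
The edge `e` is identified with the interval `[0, len e]`, where `0` corresponds to the vertex
`src e` and `len e` to the vertex `tgt e`; in particular every edge is oriented. -/
structure MetricGraph (V E : Type*) where
  src : E → V
  tgt : E → V
  len : E → ℝ
  len_pos : ∀ e, 0 < len e

namespace MetricGraph

variable {V E : Type*} (G : MetricGraph V E)

section topology

/-- The points of the metric graph: the vertices and the interior points of the edges. -/
inductive Point : Type _
  | vertex (v : V) : Point
  | inner (e : E) (x : ℝ) (hx : x ∈ Ioo 0 (G.len e)) : Point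

/-- The gluing map from the disjoint union of the intervals `[0, len e]` to the metric graph. -/
def pt (p : Σ e, Icc (0 : ℝ) (G.len e)) : G.Point :=
  if h0 : (p.2 : ℝ) = 0 then .vertex (G.src p.1)
  else if h1 : (p.2 : ℝ) = G.len p.1 then .vertex (G.tgt p.1)
  else .inner p.1 p.2 ⟨lt_of_le_of_ne p.2.2.1 (Ne.symm h0), lt_of_le_of_ne p.2.2.2 h1⟩

/-- The metric graph carries the quotient topology of the gluing map. -/
instance : TopologicalSpace G.Point := TopologicalSpace.coinduced G.pt inferInstance

/-- The length of the shortest edge. -/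
def minLength : ℝ := ⨅ e, G.len e

/-- The degree of a vertex is the number of edge ends at it (a loop counts twice). -/
def vertexDegree [Fintype E] (v : V) : ℕ :=
  (Finset.univ.filter fun e => G.src e = v).card + (Finset.univ.filter fun e => G.tgt e = v).card

/-- The degree of a point; interior points of edges have degree two. -/
def degree [Fintype E] : G.Point → ℕ
  | .vertex v => G.vertexDegree v
  | .inner _ _ _ => 2

/-- The orientation convention: every vertex of degree two has an ingoing and an outgoing edge. -/
def Coherent [Fintype E] : Prop :=
  ∀ v, G.vertexDegree v = 2 → (∃ e, G.src e = v) ∧ ∃ e, G.tgt e = v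

end topology

section functions

/-- The Sobolev space `H²(Γ) = ⨁ₑ H²([0, len e])`. An element is stored as a family of functions
on the edges (the `C¹` representatives), extended by zero outside `[0, len e]`. -/
def H2 : Submodule ℂ (E → ℝ → ℂ) where
  carrier := {u | ∀ e, (∀ x, x ∉ Icc 0 (G.len e) → u e x = 0) ∧
    ∃ g, HasSecondDeriv (G.len e) (u e) g}
  add_mem' := by
    intro u v hu hv e
    obtain ⟨hu0, g, hg⟩ := hu e
    obtain ⟨hv0, h, hh⟩ := hv e
    exact ⟨fun x hx => by simp [hu0 x hx, hv0 x hx], g + h, hg.add hh (G.len_pos e)⟩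
  zero_mem' := by
    intro e
    refine ⟨fun x _ => rfl, 0, ?_⟩
    have : ((0 : E → ℝ → ℂ) e) = fun _ => (0 : ℂ) := rfl
    refine ⟨?_, MemLp.zero', ?_⟩
    · rw [this]; exact differentiableOn_const 0
    · intro x _
      simp
  smul_mem' := by
    intro a u hu e
    obtain ⟨hu0, g, hg⟩ := hu e
    exact ⟨fun x hx => by simp [hu0 x hx], a • g, hg.smul a (G.len_pos e)⟩

variable {G}

theorem H2_differentiableOn (u : G.H2) (e : E) :
    DifferentiableOn ℝ (u.1 e) (Icc 0 (G.len e)) := by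
  obtain ⟨_, g, hg⟩ := u.2 e
  exact hg.1

/-- The point `0` of the edge `e`. -/
def startPt (e : E) : Icc (0 : ℝ) (G.len e) := ⟨0, le_rfl, (G.len_pos e).le⟩

/-- The point `len e` of the edge `e`. -/
def endPt (e : E) : Icc (0 : ℝ) (G.len e) := ⟨G.len e, (G.len_pos e).le, le_rfl⟩

/-- The value `u(x)` at the point `x` of the edge `e`. -/
def val (e : E) (x : Icc (0 : ℝ) (G.len e)) : G.H2 →ₗ[ℂ] ℂ where
  toFun u := u.1 e x
  map_add' _ _ := rfl
  map_smul' _ _ := rfl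

/-- The derivative `u'(x)` at the point `x` of the edge `e`, taken in the direction of the
orientation of `e` (one-sided at the two end points). -/
def der (e : E) (x : Icc (0 : ℝ) (G.len e)) : G.H2 →ₗ[ℂ] ℂ where
  toFun u := derivWithin (u.1 e) (Icc 0 (G.len e)) x
  map_add' u v := derivWithin_add (H2_differentiableOn u e x x.2) (H2_differentiableOn v e x x.2)
  map_smul' a u := derivWithin_const_smul a (H2_differentiableOn u e x x.2)

/-- `γˢ(u) = cos α u - sin α u'` at the point `x` of the edge `e`. -/
def robinTrace (s : OnePoint ℝ) (e : E) (x : Icc (0 : ℝ) (G.len e)) : G.H2 →ₗ[ℂ] ℂ :=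
  (Real.cos (pruferAngle s) : ℂ) • val e x - (Real.sin (pruferAngle s) : ℂ) • der e x

/-- `γˢ⋆(u) = sin α u + cos α u'` at the point `x` of the edge `e`. -/
def robinDualTrace (s : OnePoint ℝ) (e : E) (x : Icc (0 : ℝ) (G.len e)) : G.H2 →ₗ[ℂ] ℂ :=
  (Real.sin (pruferAngle s) : ℂ) • val e x + (Real.cos (pruferAngle s) : ℂ) • der e x

variable (G)

/-- The functions `u ∈ H²(Γ)` with `-u'' = c u` (almost everywhere) on every edge. -/
def helmholtz (c : ℝ) : Submodule ℂ G.H2 where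
  carrier := {u | ∀ e, ∃ g, HasSecondDeriv (G.len e) (u.1 e) g ∧
    ∀ᵐ x ∂(volume.restrict (Icc 0 (G.len e))), -g x = c * u.1 e x}
  add_mem' := by
    intro u v hu hv e
    obtain ⟨g, hg, hg'⟩ := hu e
    obtain ⟨h, hh, hh'⟩ := hv e
    refine ⟨g + h, hg.add hh (G.len_pos e), ?_⟩
    filter_upwards [hg', hh'] with x hx hy
    simp only [Pi.add_apply, Submodule.coe_add, mul_add, ← hx, ← hy]
    ring
  zero_mem' := by
    intro e
    obtain ⟨_, g, hg⟩ := G.H2.zero_mem e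
    refine ⟨(0 : ℂ) • g, ?_, by simp⟩
    have h := hg.smul 0 (G.len_pos e)
    rwa [show (0 : ℂ) • ((0 : E → ℝ → ℂ) e) = ((0 : G.H2) : E → ℝ → ℂ) e by
      simp] at h
  smul_mem' := by
    intro a u hu e
    obtain ⟨g, hg, hg'⟩ := hu e
    refine ⟨a • g, hg.smul a (G.len_pos e), ?_⟩
    filter_upwards [hg'] with x hx
    have : ((a • u : G.H2) : E → ℝ → ℂ) e x = a * u.1 e x := rfl
    rw [this]
    simp only [Pi.smul_apply, smul_eq_mul]
    linear_combination a * hx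

variable [Fintype E]

/-- The sum of `T e (end of e)` over the edges `e` that end at `v`. -/
def sumIn (T : (e : E) → Icc (0 : ℝ) (G.len e) → (G.H2 →ₗ[ℂ] ℂ)) (v : V) : G.H2 →ₗ[ℂ] ℂ :=
  ∑ e ∈ Finset.univ.filter (fun e => G.tgt e = v), T e (endPt e)

/-- The sum of `T e (start of e)` over the edges `e` that start at `v`. -/
def sumOut (T : (e : E) → Icc (0 : ℝ) (G.len e) → (G.H2 →ₗ[ℂ] ℂ)) (v : V) : G.H2 →ₗ[ℂ] ℂ :=
  ∑ e ∈ Finset.univ.filter (fun e => G.src e = v), T e (startPt e)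

/-- The Neumann–Kirchhoff condition at the vertex `v`: `u` is continuous at `v`, and the
derivatives directed from `v` into the edges sum up to zero. -/
def kirchhoff (v : V) : Submodule ℂ G.H2 where
  carrier := {u | (∃ a : ℂ, (∀ e, G.src e = v → val e (startPt e) u = a) ∧
      ∀ e, G.tgt e = v → val e (endPt e) u = a) ∧
    G.sumOut der v u - G.sumIn der v u = 0}
  add_mem' := by
    rintro u w ⟨⟨a, ha, ha'⟩, h⟩ ⟨⟨b, hb, hb'⟩, h'⟩
    refine ⟨⟨a + b, fun e he => ?_, fun e he => ?_⟩, ?_⟩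
    · rw [map_add, ha e he, hb e he]
    · rw [map_add, ha' e he, hb' e he]
    · rw [map_add, map_add]
      linear_combination h + h'
  zero_mem' := ⟨⟨0, fun _ _ => map_zero _, fun _ _ => map_zero _⟩, by simp⟩
  smul_mem' := by
    rintro c u ⟨⟨a, ha, ha'⟩, h⟩
    refine ⟨⟨c * a, fun e he => ?_, fun e he => ?_⟩, ?_⟩
    · rw [map_smul, ha e he, smul_eq_mul]
    · rw [map_smul, ha' e he, smul_eq_mul]
    · rw [map_smul, map_smul, smul_eq_mul, smul_eq_mul]
      linear_combination c * h

/-- The eigenspace of the Neumann–Kirchhoff Laplacian for the number `c`. -/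
def eigenspace (c : ℝ) : Submodule ℂ G.H2 := G.helmholtz c ⊓ ⨅ v, G.kirchhoff v

/-- The number of eigenvalues `≤ c` of the Neumann–Kirchhoff Laplacian, with multiplicity. -/
def eigenvalueCount (c : ℝ) : ℕ :=
  Module.finrank ℂ (⨆ μ : Iic c, G.eigenspace μ : Submodule ℂ G.H2)

/-- `(lam, f)` is the `n`-th eigenpair (`n = 1, 2, …`) of the Neumann–Kirchhoff Laplacian, and it is
generic: `lam` is simple, and neither `f` nor a derivative of `f` along an edge vanishes at a
vertex of degree larger than two. -/
structure IsGenericEigenpair (n : ℕ) (lam : ℝ) (f : G.H2) : Prop where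
  ne_zero : f ≠ 0
  mem_eigenspace : f ∈ G.eigenspace lam
  simple : Module.finrank ℂ (G.eigenspace lam) = 1
  index : G.eigenvalueCount lam = n
  generic_src : ∀ e, 2 < G.vertexDegree (G.src e) →
    val e (startPt e) f ≠ 0 ∧ der e (startPt e) f ≠ 0
  generic_tgt : ∀ e, 2 < G.vertexDegree (G.tgt e) →
    val e (endPt e) f ≠ 0 ∧ der e (endPt e) f ≠ 0

variable {G}

/-- The `s`-condition at the point `x` of the edge `e`: `f'(x) = s f(x)` for real `s`, and
`f(x) = 0` for `s = ∞`. -/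
def SCondition (f : G.H2) (e : E) (x : Icc (0 : ℝ) (G.len e)) : OnePoint ℝ → Prop
  | ∞ => val e x f = 0
  | (s : ℝ) => der e x f = s * val e x f

/-- The set of `s`-points of `f`: the points of degree one or two that satisfy the
`s`-condition. -/
def sPoints (f : G.H2) (s : OnePoint ℝ) : Set G.Point :=
  {p | (G.degree p = 1 ∨ G.degree p = 2) ∧ ∀ e x, G.pt ⟨e, x⟩ = p → SCondition f e x s}

/-- The `s`-points of degree two. -/
def sPointsTwo (f : G.H2) (s : OnePoint ℝ) : Set G.Point :=
  {p ∈ sPoints f s | G.degree p = 2}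

/-- The number of nodal points of `f`. -/
def nodalCount (f : G.H2) : ℕ := (sPoints f ∞).ncard

/-- The number of `s`-domains of `f`: the connected components of the graph without the
`s`-points of `f`. -/
def sDomainCount (f : G.H2) (s : OnePoint ℝ) : ℕ :=
  Nat.card (ConnectedComponents ((sPoints f s)ᶜ : Set G.Point))

end functions

section subdivision

variable {G}

/-- The coordinates on the edge `e` of the points of `B` in its interior. -/
def cuts (B : Finset G.Point) (e : E) : Finset ℝ :=
  B.biUnion fun p => match p with
    | .vertex _ => ∅
    | .inner e' x _ => if e' = e then {x} else ∅

/-- The points of `B` in the interior of the edge `e`, together with the two end points. -/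
def nodes (B : Finset G.Point) (e : E) : Finset ℝ := insert 0 (insert (G.len e) (cuts B e))

theorem mem_Icc_of_mem_nodes {B : Finset G.Point} {e : E} {x : ℝ} (hx : x ∈ nodes B e) :
    x ∈ Icc 0 (G.len e) := by
  rw [nodes, Finset.mem_insert, Finset.mem_insert] at hx
  rcases hx with rfl | rfl | hx
  · exact ⟨le_rfl, (G.len_pos e).le⟩
  · exact ⟨(G.len_pos e).le, le_rfl⟩
  · rw [cuts, Finset.mem_biUnion] at hx
    obtain ⟨p, _, hp⟩ := hx
    cases p with
    | vertex v => simp at hp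
    | inner e' y hy =>
      by_cases h : e' = e
      · subst h
        simp only [if_true, Finset.mem_singleton] at hp
        subst hp
        exact ⟨hy.1.le, hy.2.le⟩
      · simp [h] at hp

/-- The edges of the graph subdivided at `B`: an edge `e` together with two consecutive nodes
on it. -/
def Piece (B : Finset G.Point) : Type _ :=
  Σ e : E, {ab : nodes B e × nodes B e //
    (ab.1 : ℝ) < ab.2 ∧ ∀ x ∈ nodes B e, ¬ ((ab.1 : ℝ) < x ∧ x < ab.2)}

instance [Fintype E] (B : Finset G.Point) : Fintype (Piece B) := by
  unfold Piece
  infer_instance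

/-- The graph `Γ` with the points of `B` regarded as (artificial) vertices. For simplicity all
points of `Γ` are allowed as vertex labels; a label that is neither a vertex of `G` nor a point
of `B` has no edge at it and carries no condition. -/
def subdivide (B : Finset G.Point) : MetricGraph G.Point (Piece B) where
  src p := G.pt ⟨p.1, p.2.1.1, mem_Icc_of_mem_nodes p.2.1.1.2⟩
  tgt p := G.pt ⟨p.1, p.2.1.2, mem_Icc_of_mem_nodes p.2.1.2.2⟩
  len p := p.2.1.2 - p.2.1.1
  len_pos p := sub_pos.2 p.2.2.1

end subdivision

section robin

variable [Fintype E]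

/-- The functions `u ∈ H²(Γ)` with `-u'' = c u` on the edges that satisfy the Neumann–Kirchhoff
condition at all vertices outside `B` and have equal traces `γ₁ˢ(u) = γ₂ˢ(u)` on `B`. Here `B` is a
set of vertices of degree two, and the indices `1` and `2` belong to the unique edge that ends and
to the unique edge that starts at the vertex. -/
def robinSolutions (s : OnePoint ℝ) (c : ℝ) (B : Finset V) : Submodule ℂ G.H2 :=
  G.helmholtz c ⊓ (⨅ v : {v // v ∉ B}, G.kirchhoff v) ⊓
    ⨅ v : B, LinearMap.ker (G.sumIn (robinTrace s) v - G.sumOut (robinTrace s) v)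

/-- `u ↦ γˢ(u)`. -/
def robinData (s : OnePoint ℝ) (c : ℝ) (B : Finset V) :
    G.robinSolutions s c B →ₗ[ℂ] (B → ℂ) :=
  LinearMap.pi fun v => G.sumIn (robinTrace s) v ∘ₗ (G.robinSolutions s c B).subtype

/-- `u ↦ γ₁ˢ⋆(u) - γ₂ˢ⋆(u)`. -/
def robinDualData (s : OnePoint ℝ) (c : ℝ) (B : Finset V) :
    G.robinSolutions s c B →ₗ[ℂ] (B → ℂ) :=
  LinearMap.pi fun v => (G.sumIn (robinDualTrace s) v - G.sumOut (robinDualTrace s) v) ∘ₗ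
    (G.robinSolutions s c B).subtype

/-- For every `w` on `B` the boundary value problem `-u'' = c u`, `γ₁ˢ(u) = γ₂ˢ(u) = w` on `B`, with
Neumann–Kirchhoff conditions at the other vertices, has exactly one solution. -/
def RobinWellPosed (s : OnePoint ℝ) (c : ℝ) (B : Finset V) : Prop :=
  Function.Bijective (G.robinData s c B)

/-- The Robin map `Λₛ(c)` on `B`. It sends `w` to `γ₁ˢ⋆(u) - γ₂ˢ⋆(u)`, where `u` is the solution of the
boundary value problem with `γˢ(u) = w`. The problem decouples into the components of the graph
cut at `B`, and the signs are the orientation weights of the components at their boundary points.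
(The value is `0` if the problem is not well posed.) -/
def robinMap (s : OnePoint ℝ) (c : ℝ) (B : Finset V) : Module.End ℂ (B → ℂ) :=
  if h : G.RobinWellPosed s c B then
    G.robinDualData s c B ∘ₗ (LinearEquiv.ofBijective (G.robinData s c B) h).symm.toLinearMap
  else 0

end robin

end MetricGraph

/-- The number of positive eigenvalues of `T`, with multiplicity. -/
def posIndex {W : Type*} [AddCommGroup W] [Module ℂ W] (T : Module.End ℂ W) : ℕ :=
  Module.finrank ℂ (⨆ μ : Ioi (0 : ℝ), T.eigenspace ((μ : ℝ) : ℂ) : Submodule ℂ W)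

/-- The Morse index of `T`: the number of negative eigenvalues, with multiplicity. -/
def morseIndex {W : Type*} [AddCommGroup W] [Module ℂ W] (T : Module.End ℂ W) : ℕ :=
  Module.finrank ℂ (⨆ μ : Iio (0 : ℝ), T.eigenspace ((μ : ℝ) : ℂ) : Submodule ℂ W)

end

/-! ### Negative index, radical and orthogonal splittings of Hermitian forms. -/

section HermitianIndex

open Module

variable {A : Type*} [AddCommGroup A] [Module ℂ A]

/-! Everything is reduced to the inertia of Hermitian forms in finite dimension. Subdivide the graph
until `k · length < π` on every piece. A solution of `-u'' = k² u` is then determined by its values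
at the ends of the pieces, and `∫ |u'|² - k² |u|²` becomes the form `edgeForm k 0` on families of
end values; `edgeForm k σ` carries additional Robin terms. On each piece the form is diagonal in the
sum and the difference of the two end values, with coefficients governed by `-k tan (k l / 2)` and
`k cot (k l / 2)`, so it decreases strictly in `k` (`edgeForm_strictAnti`). Hence its negative index
does not change when `k` reaches `k₀` from the left and jumps by the dimension of the radical when
`k` leaves `k₀` to the right. On continuous end values the radical is the eigenspace, and the form
is nonnegative at `k = 0`. So the index just to the right of `k₀ = √λₙ` is `n`
(`negIndex_eq_finrank_iSup`).

The Robin map is a Schur complement of this form. If `Y₀ ≤ Y` and the form is nondegenerate on `Y₀`,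
then the index of `Y` is the index of `Y₀` plus that of the orthogonal complement of `Y₀` in `Y`
(`negIndex_eq_add_formOrth`). This is applied for `k` slightly larger than `k₀`.

For `s = ∞` take for `Y` the continuous end values and for `Y₀` those that vanish on `B_∞`. On the
complement the form is `⟨w, Λ w⟩` (`Refinement.robinMap_infty`), with index `Mor`. At `k₀` a
discrete Picone identity (`SignedSolution.picone`) writes the form on `Y₀` as a sum of nonnegative
multiples of `|u - v|²`, where `u` and `v` are the quotients by `f` at the two ends of a piece. So
the index of `Y₀` at `k₀` is zero, its radical consists of the locally constant multiples of `f` and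
has dimension `ν_∞`, and `n = ν_∞ + Mor` to the right of `k₀`. The form is also nondegenerate on `Y`
there, which gives `Mor + Pos = φ_∞`.

For real `s` take for `Y₀` the continuous end values, on which the Robin terms cancel, and for `Y`
those that may jump on `B_s`. The complement consists of solutions with equal Robin residuals `u' -
s u` on both sides of `B_s`; the form there is `-⟨w, Λ w⟩` (`Refinement.robinMap_coe`), with index
`Pos`. It remains to see that `Y` has index `ν_s + φ_∞`
(`SignedSolution.eventually_negIndex_contSpace`). From above: at `k₀` the form is nonnegative under
the `φ_∞` conditions of vanishing at the nodal points, and its radical has dimension at most `ν_s`.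
From below: the multiples of `f` that are constant between the points of `B_s ∪ B_∞` are isotropic
at `k₀` and negative afterwards.

The bound on `√λₙ` provides an `s`-point inside every edge. This makes the Wronskian of `f` and a
radical element vanish (`wronskian_eq_zero`), and it makes every nodal point split an `s`-domain
(`finrank_linkSpace_add_card`). Domains are counted throughout as the dimension of a space of
locally constant functions (`card_connectedComponents`). -/

/-- The Hermitian form `Q` is negative definite on `N`. -/
def NegDefOn (Q : A →ₗ⋆[ℂ] A →ₗ[ℂ] ℂ) (N : Submodule ℂ A) : Prop :=
  ∀ x ∈ N, x ≠ 0 → (Q x x).re < 0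

/-- The Hermitian form `Q` is positive definite on `N`. -/
def PosDefOn (Q : A →ₗ⋆[ℂ] A →ₗ[ℂ] ℂ) (N : Submodule ℂ A) : Prop :=
  ∀ x ∈ N, x ≠ 0 → 0 < (Q x x).re

/-- The negative index of inertia of the restriction of `Q` to `Y`: the largest dimension of a
subspace of `Y` on which `Q` is negative definite. -/
noncomputable def negIndex (Q : A →ₗ⋆[ℂ] A →ₗ[ℂ] ℂ) (Y : Submodule ℂ A) : ℕ :=
  sSup {d | ∃ N ≤ Y, finrank ℂ N = d ∧ NegDefOn Q N}

/-- The `Q`-orthogonal complement of `Y`. -/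
def formOrth (Q : A →ₗ⋆[ℂ] A →ₗ[ℂ] ℂ) (Y : Submodule ℂ A) : Submodule ℂ A where
  carrier := {w | ∀ z ∈ Y, Q z w = 0}
  add_mem' := by
    intro a b ha hb z hz
    rw [map_add, ha z hz, hb z hz, add_zero]
  zero_mem' := fun z _ => map_zero _
  smul_mem' := by
    intro c a ha z hz
    rw [map_smul, ha z hz, smul_zero]

/-- The radical of the restriction of `Q` to `Y`. -/
def formRadical (Q : A →ₗ⋆[ℂ] A →ₗ[ℂ] ℂ) (Y : Submodule ℂ A) : Submodule ℂ A := Y ⊓ formOrth Q Y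

variable {Q : A →ₗ⋆[ℂ] A →ₗ[ℂ] ℂ} {Y N P : Submodule ℂ A}

theorem formRadical_le : formRadical Q Y ≤ Y := inf_le_left

theorem formOrth_antitone {Y₁ Y₂ : Submodule ℂ A} (h : Y₁ ≤ Y₂) : formOrth Q Y₂ ≤ formOrth Q Y₁ :=
  fun _ hw z hz => hw z (h hz)

theorem NegDefOn.inf_eq_bot (hN : NegDefOn Q N) (hP : ∀ x ∈ P, 0 ≤ (Q x x).re) : N ⊓ P = ⊥ := by
  rw [Submodule.eq_bot_iff]
  rintro x ⟨h1, h2⟩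
  by_contra h
  exact absurd (hN x h1 h) (not_lt.2 (hP x h2))

theorem NegDefOn.inf_formOrth (hN : NegDefOn Q N) : N ⊓ formOrth Q N = ⊥ := by
  rw [Submodule.eq_bot_iff]
  rintro x ⟨h1, h2⟩
  by_contra h
  have := hN x h1 h
  rw [h2 x h1] at this
  simp at this

theorem form_add_self (hQ : Q.IsSymm) (x y : A) :
    (Q (x + y) (x + y)).re = (Q x x).re + 2 * (Q x y).re + (Q y y).re := by
  have h : Q y x = (starRingEnd ℂ) (Q x y) := (hQ.eq x y).symm
  simp only [map_add, LinearMap.add_apply, h, Complex.add_re, Complex.conj_re]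
  ring

theorem form_smul_self (a : ℂ) (y : A) : (Q (a • y) (a • y)).re = ‖a‖ ^ 2 * (Q y y).re := by
  simp only [LinearMap.map_smulₛₗ, LinearMap.smul_apply, RingHom.id_apply, smul_eq_mul]
  rw [← mul_assoc, Complex.mul_conj, Complex.re_ofReal_mul, Complex.normSq_eq_norm_sq]

/-- The equality case of Cauchy–Schwarz for a semidefinite form. Along an isotropic direction the
quadratic form is affine, and an affine function that is bounded below on the line has no linear
term. -/
theorem form_eq_zero_of_nonneg (hQ : Q.IsSymm) (hY : ∀ x ∈ Y, 0 ≤ (Q x x).re) {p : A}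
    (hp : p ∈ Y) (h0 : (Q p p).re = 0) {z : A} (hz : z ∈ Y) : Q z p = 0 := by
  by_contra h
  set b := Q z p with hb
  have key : ∀ t : ℝ, 0 ≤ (Q z z).re - 2 * t * ‖b‖ ^ 2 := by
    intro t
    have := hY (z + (-(t : ℂ) * (starRingEnd ℂ) b) • p) (Y.add_mem hz (Y.smul_mem _ hp))
    rw [form_add_self hQ, form_smul_self, h0, map_smul, smul_eq_mul, ← hb, mul_assoc,
      ← Complex.normSq_eq_conj_mul_self, ← Complex.ofReal_neg, Complex.re_ofReal_mul,
      Complex.ofReal_re, Complex.normSq_eq_norm_sq] at this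
    linarith
  have hb2 : 0 < ‖b‖ ^ 2 := by positivity
  -- This value of `t` turns the lower bound into `0 ≤ -1`.
  have := key (((Q z z).re + 1) / (2 * ‖b‖ ^ 2))
  have h2 : 2 * (((Q z z).re + 1) / (2 * ‖b‖ ^ 2)) * ‖b‖ ^ 2 = (Q z z).re + 1 := by
    field_simp
  rw [h2] at this
  linarith

theorem negDefOn_sup_formOrth {M : Submodule ℂ A} (hQ : Q.IsSymm) (hN : NegDefOn Q N)
    (hM : NegDefOn Q M) (h : M ≤ formOrth Q N) : NegDefOn Q (N ⊔ M) := by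
  intro x hx hx0
  obtain ⟨n, hn, m, hm, rfl⟩ := Submodule.mem_sup.1 hx
  rw [form_add_self hQ, h hm n hn]
  simp only [Complex.zero_re, mul_zero, add_zero]
  by_cases h1 : n = 0
  · subst h1
    rw [zero_add] at hx0
    simpa using hM m hm hx0
  · by_cases h2 : m = 0
    · subst h2
      simpa using hN n hn h1
    · exact add_neg (hN n hn h1) (hM m hm h2)

variable [FiniteDimensional ℂ A]

theorem bddAbove_negDef (Q : A →ₗ⋆[ℂ] A →ₗ[ℂ] ℂ) (Y : Submodule ℂ A) :
    BddAbove {d | ∃ N ≤ Y, finrank ℂ N = d ∧ NegDefOn Q N} := by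
  refine ⟨finrank ℂ Y, ?_⟩
  rintro d ⟨N, hN, rfl, _⟩
  exact Submodule.finrank_mono hN

theorem finrank_le_negIndex (hN : N ≤ Y) (h : NegDefOn Q N) : finrank ℂ N ≤ negIndex Q Y :=
  le_csSup (bddAbove_negDef Q Y) ⟨N, hN, rfl, h⟩

theorem exists_finrank_eq_negIndex (Q : A →ₗ⋆[ℂ] A →ₗ[ℂ] ℂ) (Y : Submodule ℂ A) :
    ∃ N ≤ Y, finrank ℂ N = negIndex Q Y ∧ NegDefOn Q N := by
  refine Nat.sSup_mem ?_ (bddAbove_negDef Q Y)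
  refine ⟨0, ⊥, bot_le, finrank_bot ℂ A, ?_⟩
  intro x hx h
  exact absurd ((Submodule.mem_bot ℂ).1 hx) h

theorem finrank_add_le_of_inf_eq_bot (hN : N ≤ Y) (hP : P ≤ Y) (h : N ⊓ P = ⊥) :
    finrank ℂ N + finrank ℂ P ≤ finrank ℂ Y := by
  rw [← Submodule.finrank_sup_add_finrank_inf_eq, h, finrank_bot, add_zero]
  exact Submodule.finrank_mono (sup_le hN hP)

/-- A negative definite subspace meets `P` only in zero. Every upper bound for an index rests on
this. -/
theorem negIndex_add_finrank_le (hP : P ≤ Y) (h : ∀ x ∈ P, 0 ≤ (Q x x).re) :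
    negIndex Q Y + finrank ℂ P ≤ finrank ℂ Y := by
  obtain ⟨N, hN, hd, hneg⟩ := exists_finrank_eq_negIndex Q Y
  rw [← hd]
  exact finrank_add_le_of_inf_eq_bot hN hP (hneg.inf_eq_bot h)

/-- Riesz representation for a nondegenerate form: pairing with a basis is injective between spaces
of equal dimension. With `l = Q.flip x` it yields the orthogonal projection of `x` to `Y`, although
`Q` is indefinite. -/
theorem exists_form_eq (h : Y ⊓ formOrth Q Y = ⊥) (l : A →ₗ⋆[ℂ] ℂ) :
    ∃ y ∈ Y, ∀ z ∈ Y, Q z y = l z := by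
  let b := Module.finBasis ℂ Y
  let L : Y →ₗ[ℂ] (Fin (finrank ℂ Y) → ℂ) := LinearMap.pi fun i => Q (b i) ∘ₗ Y.subtype
  have ext : ∀ (l₁ l₂ : A →ₗ⋆[ℂ] ℂ), (∀ i, l₁ (b i) = l₂ (b i)) → ∀ z ∈ Y, l₁ z = l₂ z := by
    intro l₁ l₂ hl z hz
    have : l₁.comp Y.subtype = l₂.comp Y.subtype := b.ext hl
    exact LinearMap.congr_fun this ⟨z, hz⟩
  have hinj : Function.Injective L := by
    rw [← LinearMap.ker_eq_bot, LinearMap.ker_eq_bot']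
    intro y hy
    have : (y : A) ∈ Y ⊓ formOrth Q Y := by
      refine ⟨y.2, fun z hz => ?_⟩
      exact ext (Q.flip y) 0 (fun i => congr_fun hy i) z hz
    rw [h, Submodule.mem_bot] at this
    exact Subtype.ext this
  have hsurj : Function.Surjective L :=
    (LinearMap.injective_iff_surjective_of_finrank_eq_finrank (by simp)).1 hinj
  obtain ⟨y, hy⟩ := hsurj fun i => l (b i)
  exact ⟨y, y.2, ext (Q.flip y) l fun i => congr_fun hy i⟩

theorem finrank_eq_add_formOrth {Y₀ : Submodule ℂ A} (hle : Y₀ ≤ Y)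
    (h : Y₀ ⊓ formOrth Q Y₀ = ⊥) :
    finrank ℂ Y = finrank ℂ Y₀ + finrank ℂ (formOrth Q Y₀ ⊓ Y : Submodule ℂ A) := by
  have hsup : Y₀ ⊔ (formOrth Q Y₀ ⊓ Y) = Y := by
    refine le_antisymm (sup_le hle inf_le_right) fun y hy => ?_
    obtain ⟨y₀, h₀, h₁⟩ := exists_form_eq h (Q.flip y)
    rw [Submodule.mem_sup]
    refine ⟨y₀, h₀, y - y₀, ⟨fun z hz => ?_, Y.sub_mem hy (hle h₀)⟩, by abel⟩
    rw [map_sub, h₁ z hz, LinearMap.flip_apply, sub_self]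
  have hinf : Y₀ ⊓ (formOrth Q Y₀ ⊓ Y) = ⊥ := by
    rw [← inf_assoc, h, bot_inf_eq]
  have := Submodule.finrank_sup_add_finrank_inf_eq Y₀ (formOrth Q Y₀ ⊓ Y)
  rw [hsup, hinf, finrank_bot, add_zero] at this
  exact this

/-- Sylvester's law of inertia: a splitting of `Y` into a negative definite part, the radical and
a positive definite part. -/
theorem exists_inertia_splitting (hQ : Q.IsSymm) (Y : Submodule ℂ A) :
    ∃ N ≤ Y, ∃ P ≤ Y, NegDefOn Q N ∧ PosDefOn Q P ∧ finrank ℂ N = negIndex Q Y ∧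
      finrank ℂ N + finrank ℂ (formRadical Q Y) + finrank ℂ P = finrank ℂ Y := by
  obtain ⟨N, hNY, hNd, hN⟩ := exists_finrank_eq_negIndex Q Y
  have hNo := hN.inf_formOrth
  set M := formOrth Q N ⊓ Y with hM
  have hMY : M ≤ Y := inf_le_right
  have hdim := finrank_eq_add_formOrth hNY hNo
  rw [← hM] at hdim
  -- `N` has maximal dimension, so its orthogonal complement in `Y` contains no vector of negative
  -- square that could enlarge it.
  have hnn : ∀ w ∈ M, 0 ≤ (Q w w).re := by
    intro w hw
    by_contra! hneg
    have hw0 : w ≠ 0 := by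
      rintro rfl
      simp at hneg
    have hspan : NegDefOn Q (Submodule.span ℂ {w}) := by
      intro x hx hx0
      obtain ⟨a, rfl⟩ := Submodule.mem_span_singleton.1 hx
      rw [form_smul_self]
      have : a ≠ 0 := fun h => hx0 (by rw [h, zero_smul])
      exact mul_neg_of_pos_of_neg (by positivity) hneg
    have hsp : Submodule.span ℂ {w} ≤ M := by
      rw [Submodule.span_singleton_le_iff_mem]; exact hw
    have hle := finrank_le_negIndex (Y := Y) (sup_le hNY (hsp.trans hMY))
      (negDefOn_sup_formOrth hQ hN hspan (hsp.trans inf_le_left))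
    have hi : N ⊓ Submodule.span ℂ {w} = ⊥ :=
      le_bot_iff.1 (hNo ▸ inf_le_inf_left N (hsp.trans inf_le_left))
    have := Submodule.finrank_sup_add_finrank_inf_eq N (Submodule.span ℂ {w})
    rw [hi, finrank_bot, finrank_span_singleton hw0] at this
    omega
  have hRM : formRadical Q Y ≤ M := fun w hw => ⟨formOrth_antitone hNY hw.2, hw.1⟩
  obtain ⟨P₀, hP₀⟩ := exists_isCompl (formRadical Q Y)
  -- `P₀` is a complement in the whole space. The modular law cuts it down to a complement of the
  -- radical in `M`.
  have hsup : formRadical Q Y ⊔ (P₀ ⊓ M) = M := by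
    rw [← sup_inf_assoc_of_le P₀ hRM, hP₀.sup_eq_top, top_inf_eq]
  have hinf : formRadical Q Y ⊓ (P₀ ⊓ M) = ⊥ := by
    rw [← inf_assoc, hP₀.inf_eq_bot, bot_inf_eq]
  refine ⟨N, hNY, P₀ ⊓ M, inf_le_right.trans hMY, hN, ?_, hNd, ?_⟩
  · intro p hp hp0
    refine lt_of_le_of_ne (hnn p hp.2) fun h0 => hp0 ?_
    -- An isotropic vector of the semidefinite space `M` is orthogonal to `M`. It is also orthogonal
    -- to `N`, and both together span `Y`.
    have hrad : p ∈ formRadical Q Y := by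
      refine ⟨hMY hp.2, fun z hz => ?_⟩
      obtain ⟨y₀, h₀, h₁⟩ := exists_form_eq hNo (Q.flip z)
      have hzM : z - y₀ ∈ M := by
        refine ⟨fun n hn => ?_, Y.sub_mem hz (hNY h₀)⟩
        rw [map_sub, h₁ n hn, LinearMap.flip_apply, sub_self]
      have e1 := form_eq_zero_of_nonneg hQ hnn hp.2 h0.symm hzM
      have e2 : Q y₀ p = 0 := hp.2.1 y₀ h₀
      rw [map_sub, LinearMap.sub_apply, e2, sub_zero] at e1
      exact e1
    have : p ∈ formRadical Q Y ⊓ (P₀ ⊓ M) := ⟨hrad, hp⟩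
    rw [hinf] at this
    exact (Submodule.mem_bot ℂ).1 this
  · have := Submodule.finrank_sup_add_finrank_inf_eq (formRadical Q Y) (P₀ ⊓ M)
    rw [hsup, hinf, finrank_bot] at this
    omega

/-- `N` bounds the index from below and `P` from above, and the dimensions leave no gap. For the
same reason there is no room for a radical, which could be joined to `P` without losing
nonnegativity. -/
theorem negIndex_eq_of_split (hQ : Q.IsSymm) (hN : N ≤ Y) (hP : P ≤ Y) (hneg : NegDefOn Q N)
    (hpos : PosDefOn Q P) (hd : finrank ℂ Y ≤ finrank ℂ N + finrank ℂ P) :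
    negIndex Q Y = finrank ℂ N ∧ formRadical Q Y = ⊥ := by
  have hpos' : ∀ x ∈ P, 0 ≤ (Q x x).re := by
    intro x hx
    by_cases h : x = 0
    · simp [h]
    · exact (hpos x hx h).le
  have h1 := finrank_le_negIndex hN hneg
  have h2 := negIndex_add_finrank_le hP hpos'
  refine ⟨by omega, ?_⟩
  obtain ⟨N', hN', P', hP', hneg', -, hd', hs⟩ := exists_inertia_splitting hQ Y
  have hR : ∀ x ∈ formRadical Q Y ⊔ P, 0 ≤ (Q x x).re := by
    intro x hx
    obtain ⟨r, hr, p, hp, rfl⟩ := Submodule.mem_sup.1 hx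
    rw [form_add_self hQ, hr.2 r hr.1, ← hQ.eq p r, hr.2 p (hP hp)]
    simpa using hpos' p hp
  have h3 := negIndex_add_finrank_le (sup_le inf_le_left hP) hR
  have hi : formRadical Q Y ⊓ P = ⊥ := by
    rw [Submodule.eq_bot_iff]
    rintro x ⟨hx1, hx2⟩
    by_contra h
    have := hpos x hx2 h
    rw [hx1.2 x hx1.1] at this
    simp at this
  have := Submodule.finrank_sup_add_finrank_inf_eq (formRadical Q Y) P
  rw [hi, finrank_bot] at this
  exact Submodule.finrank_eq_zero.1 (by omega)

/-- Additivity of the index for a Schur complement. Nondegeneracy on `Y₀` gives `Y = Y₀ ⊕ M`, and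
the inertia splittings of the two orthogonal summands are put together. This links the eigenvalue
count with the Robin map. -/
theorem negIndex_eq_add_formOrth (hQ : Q.IsSymm) {Y₀ : Submodule ℂ A} (hle : Y₀ ≤ Y)
    (h : formRadical Q Y₀ = ⊥) :
    negIndex Q Y = negIndex Q Y₀ + negIndex Q (formOrth Q Y₀ ⊓ Y) := by
  set M := formOrth Q Y₀ ⊓ Y with hM
  have hMY : M ≤ Y := inf_le_right
  have hdim := finrank_eq_add_formOrth hle h
  rw [← hM] at hdim
  obtain ⟨N₀, hN₀, P₀, hP₀, hn₀, hp₀, hd₀, hs₀⟩ := exists_inertia_splitting hQ Y₀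
  obtain ⟨N₁, hN₁, P₁, hP₁, hn₁, hp₁, hd₁, hs₁⟩ := exists_inertia_splitting hQ M
  rw [h, finrank_bot] at hs₀
  have hb : ∀ {U V : Submodule ℂ A}, U ≤ Y₀ → V ≤ M → U ⊓ V = ⊥ := by
    intro U V hU hV
    rw [← le_bot_iff]
    refine (inf_le_inf hU hV).trans ?_
    rw [← h, formRadical, hM]
    exact inf_le_inf_left _ inf_le_left
  refine le_antisymm ?_ ?_
  · have hR : ∀ x ∈ P₀ ⊔ (formRadical Q M ⊔ P₁), 0 ≤ (Q x x).re := by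
      intro x hx
      obtain ⟨p, hp, y, hy, rfl⟩ := Submodule.mem_sup.1 hx
      obtain ⟨r, hr, q, hq, rfl⟩ := Submodule.mem_sup.1 hy
      have hrq : r + q ∈ M := M.add_mem hr.1 (hP₁ hq)
      rw [form_add_self hQ, hrq.1 p (hP₀ hp), form_add_self hQ, hr.2 r hr.1, ← hQ.eq q r,
        hr.2 q (hP₁ hq)]
      have e1 : 0 ≤ (Q p p).re := by
        by_cases h : p = 0
        · simp [h]
        · exact (hp₀ p hp h).le
      have e2 : 0 ≤ (Q q q).re := by
        by_cases h : q = 0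
        · simp [h]
        · exact (hp₁ q hq h).le
      simpa using add_nonneg e1 e2
    have hle2 : formRadical Q M ⊔ P₁ ≤ M := sup_le inf_le_left hP₁
    have h3 := negIndex_add_finrank_le (sup_le (hP₀.trans hle) (hle2.trans hMY)) hR
    have e1 := Submodule.finrank_sup_add_finrank_inf_eq P₀ (formRadical Q M ⊔ P₁)
    have e2 := Submodule.finrank_sup_add_finrank_inf_eq (formRadical Q M) P₁
    rw [hb hP₀ hle2, finrank_bot] at e1
    have hi : formRadical Q M ⊓ P₁ = ⊥ := by
      rw [Submodule.eq_bot_iff]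
      rintro x ⟨hx1, hx2⟩
      by_contra h
      have := hp₁ x hx2 h
      rw [hx1.2 x hx1.1] at this
      simp at this
    rw [hi, finrank_bot] at e2
    omega
  · have e1 := Submodule.finrank_sup_add_finrank_inf_eq N₀ N₁
    rw [hb hN₀ hN₁, finrank_bot] at e1
    have := finrank_le_negIndex (Y := Y) (sup_le (hN₀.trans hle) (hN₁.trans hMY))
      (negDefOn_sup_formOrth hQ hn₀ hn₁ ((hN₁.trans inf_le_left).trans (formOrth_antitone hN₀)))
    omega

end HermitianIndex

/-! ### The index along a strictly decreasing family of forms. -/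

section PerturbedIndex

open Module Filter Topology

variable {A : Type*} [NormedAddCommGroup A] [NormedSpace ℂ A] [FiniteDimensional ℂ A]
  {Q : ℝ → A →ₗ⋆[ℂ] A →ₗ[ℂ] ℂ} {k₀ : ℝ} {Y : Submodule ℂ A}

/-- On the compact unit sphere of `P` joint continuity gives positivity for all `k` near `k₀`
simultaneously; homogeneity extends it to `P`. -/
theorem PosDefOn.eventually (hc : ∀ x, ContinuousAt (fun p : ℝ × A => (Q p.1 p.2 p.2).re) (k₀, x))
    {P : Submodule ℂ A} (hP : PosDefOn (Q k₀) P) : ∀ᶠ k in 𝓝 k₀, PosDefOn (Q k) P := by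
  have : FiniteDimensional ℝ A := FiniteDimensional.complexToReal A
  have : ProperSpace A := FiniteDimensional.proper ℝ A
  have hK : IsCompact ((P : Set A) ∩ Metric.sphere 0 1) :=
    (isCompact_sphere 0 1).inter_left P.closed_of_finiteDimensional
  have h1 : ∀ᶠ k in 𝓝 k₀, ∀ x ∈ (P : Set A) ∩ Metric.sphere 0 1, 0 < (Q k x x).re := by
    refine hK.eventually_forall_of_forall_eventually ?_
    rintro x ⟨hx, hx1⟩
    have hx0 : x ≠ 0 := by
      rintro rfl
      simp at hx1
    have hpos := hP x hx hx0
    exact (hc x).eventually (lt_mem_nhds hpos)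
  filter_upwards [h1] with k hk x hx hx0
  have hn : (0 : ℝ) < ‖x‖ := norm_pos_iff.2 hx0
  have h2 := hk (((‖x‖⁻¹ : ℝ) : ℂ) • x) ⟨P.smul_mem _ hx, by
    rw [mem_sphere_zero_iff_norm, norm_smul, Complex.norm_real, norm_inv, norm_norm,
      inv_mul_cancel₀ hn.ne']⟩
  rw [form_smul_self] at h2
  exact pos_of_mul_pos_right h2 (by positivity)

theorem NegDefOn.eventually (hc : ∀ x, ContinuousAt (fun p : ℝ × A => (Q p.1 p.2 p.2).re) (k₀, x))
    {N : Submodule ℂ A} (hN : NegDefOn (Q k₀) N) : ∀ᶠ k in 𝓝 k₀, NegDefOn (Q k) N := by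
  have h := PosDefOn.eventually (Q := fun k => -Q k) (k₀ := k₀) (P := N)
    (fun x => by
      simp only [LinearMap.neg_apply, Complex.neg_re]
      exact (hc x).neg) (fun x hx h0 => by simpa using hN x hx h0)
  filter_upwards [h] with k hk x hx h0
  simpa using hk x hx h0

theorem finrank_sup_formRadical {A : Type*} [AddCommGroup A] [Module ℂ A] [FiniteDimensional ℂ A]
    {Q : A →ₗ⋆[ℂ] A →ₗ[ℂ] ℂ} {Y N : Submodule ℂ A} (h : ∀ x ∈ N, x ≠ 0 → (Q x x).re ≠ 0) :
    finrank ℂ (N ⊔ formRadical Q Y : Submodule ℂ A) =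
      finrank ℂ N + finrank ℂ (formRadical Q Y) := by
  have hi : N ⊓ formRadical Q Y = ⊥ := by
    rw [Submodule.eq_bot_iff]
    rintro x ⟨hx1, hx2⟩
    by_contra h'
    have := h x hx1 h'
    rw [hx2.2 x hx2.1] at this
    simp at this
  have := Submodule.finrank_sup_add_finrank_inf_eq N (formRadical Q Y)
  rwa [hi, finrank_bot, add_zero] at this

theorem form_add_radical {A : Type*} [AddCommGroup A] [Module ℂ A]
    {Q : A →ₗ⋆[ℂ] A →ₗ[ℂ] ℂ} (hQ : Q.IsSymm) {Y : Submodule ℂ A} {x r : A} (hx : x ∈ Y)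
    (hr : r ∈ formRadical Q Y) : (Q (x + r) (x + r)).re = (Q x x).re := by
  rw [form_add_self hQ, hr.2 x hx, hr.2 r hr.1]
  simp

/-- To the right of `k₀` the form has decreased, so the radical joins the negative part, while the
positive part persists by openness. Both together exhaust `Y`. -/
theorem negIndex_eventually_right (hQ : ∀ k, (Q k).IsSymm)
    (hc : ∀ x, ContinuousAt (fun p : ℝ × A => (Q p.1 p.2 p.2).re) (k₀, x))
    (hm : ∀ᶠ k in 𝓝[>] k₀, ∀ x ≠ 0, (Q k x x).re < (Q k₀ x x).re) (Y : Submodule ℂ A) :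
    ∀ᶠ k in 𝓝[>] k₀,
      negIndex (Q k) Y = negIndex (Q k₀) Y + finrank ℂ (formRadical (Q k₀) Y) ∧
        formRadical (Q k) Y = ⊥ := by
  obtain ⟨N, hN, P, hP, hneg, hpos, hd, hs⟩ := exists_inertia_splitting (hQ k₀) Y
  have hfr := finrank_sup_formRadical (Y := Y) (fun x hx h0 => (hneg x hx h0).ne)
  filter_upwards [hm, nhdsWithin_le_nhds (hpos.eventually hc)] with k h1 h2
  have hneg' : NegDefOn (Q k) (N ⊔ formRadical (Q k₀) Y) := by
    intro x hx hx0
    refine (h1 x hx0).trans_le ?_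
    obtain ⟨n, hn, r, hr, rfl⟩ := Submodule.mem_sup.1 hx
    rw [form_add_radical (hQ k₀) (hN hn) hr]
    by_cases h : n = 0
    · simp [h]
    · exact (hneg n hn h).le
  have := negIndex_eq_of_split (hQ k) (sup_le hN formRadical_le) hP hneg' h2 (by omega)
  rw [hfr, hd] at this
  exact this

/-- The mirror image: to the left of `k₀` the radical belongs to the positive part, so the index is
that of `k₀`. -/
theorem negIndex_eventually_left (hQ : ∀ k, (Q k).IsSymm)
    (hc : ∀ x, ContinuousAt (fun p : ℝ × A => (Q p.1 p.2 p.2).re) (k₀, x))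
    (hm : ∀ᶠ k in 𝓝[<] k₀, ∀ x ≠ 0, (Q k₀ x x).re < (Q k x x).re) (Y : Submodule ℂ A) :
    ∀ᶠ k in 𝓝[<] k₀, negIndex (Q k) Y = negIndex (Q k₀) Y ∧ formRadical (Q k) Y = ⊥ := by
  obtain ⟨N, hN, P, hP, hneg, hpos, hd, hs⟩ := exists_inertia_splitting (hQ k₀) Y
  have hfr := finrank_sup_formRadical (Y := Y) (fun x hx h0 => (hpos x hx h0).ne')
  filter_upwards [hm, nhdsWithin_le_nhds (hneg.eventually hc)] with k h1 h2
  have hpos' : PosDefOn (Q k) (P ⊔ formRadical (Q k₀) Y) := by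
    intro x hx hx0
    refine lt_of_le_of_lt ?_ (h1 x hx0)
    obtain ⟨n, hn, r, hr, rfl⟩ := Submodule.mem_sup.1 hx
    rw [form_add_radical (hQ k₀) (hP hn) hr]
    by_cases h : n = 0
    · simp [h]
    · exact (hpos n hn h).le
  have := negIndex_eq_of_split (hQ k) hN (sup_le hP formRadical_le) h2 hpos' (by omega)
  rw [hd] at this
  exact this

end PerturbedIndex

/-! ### The Morse index of an endomorphism as the index of a form. -/

section EigenvalueIndex

open Module

theorem negIndex_eq_of_equiv {A W : Type*} [AddCommGroup A] [Module ℂ A] [FiniteDimensional ℂ A]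
    [AddCommGroup W] [Module ℂ W] [FiniteDimensional ℂ W] {Q : A →ₗ⋆[ℂ] A →ₗ[ℂ] ℂ}
    {Q' : W →ₗ⋆[ℂ] W →ₗ[ℂ] ℂ} (M : Submodule ℂ A) (D : M ≃ₗ[ℂ] W)
    (h : ∀ x : M, Q x x = Q' (D x) (D x)) : negIndex Q M = negIndex Q' ⊤ := by
  apply le_antisymm
  · obtain ⟨N, hN, hd, hneg⟩ := exists_finrank_eq_negIndex Q M
    rw [← hd]
    have h1 : finrank ℂ N = finrank ℂ ((N.comap M.subtype).map D.toLinearMap) := by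
      rw [LinearEquiv.finrank_map_eq D, (Submodule.comapSubtypeEquivOfLe hN).finrank_eq]
    rw [h1]
    refine finrank_le_negIndex le_top ?_
    rintro _ ⟨x, hx, rfl⟩ h0
    have hx0 : (x : A) ≠ 0 := by
      intro h'
      apply h0
      rw [show x = 0 from Subtype.ext h', map_zero]
    have := hneg x hx hx0
    rwa [h] at this
  · obtain ⟨N, -, hd, hneg⟩ := exists_finrank_eq_negIndex Q' ⊤
    rw [← hd]
    have h1 : finrank ℂ N = finrank ℂ ((N.map D.symm.toLinearMap).map M.subtype) := by
      rw [Submodule.finrank_map_subtype_eq, LinearEquiv.finrank_map_eq D.symm]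
    rw [h1]
    refine finrank_le_negIndex (Submodule.map_subtype_le _ _) ?_
    rintro _ ⟨_, ⟨x, hx, rfl⟩, rfl⟩ h0
    have hx0 : x ≠ 0 := by
      rintro rfl
      simp at h0
    have := hneg x hx hx0
    simpa [h] using this

/-- The sum of the eigenspaces with negative eigenvalues has no component along basis vectors with
`l i ≥ 0`, so it is negative definite. The span of those basis vectors is nonnegative and bounds the
index from above. -/
theorem morseIndex_eq_of_basis {W : Type*} [AddCommGroup W] [Module ℂ W] [FiniteDimensional ℂ W]
    {Q : W →ₗ⋆[ℂ] W →ₗ[ℂ] ℂ} {n : ℕ} (b : Basis (Fin n) ℂ W) (T : Module.End ℂ W) (l : Fin n → ℝ)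
    (hT : ∀ i, T (b i) = (l i : ℂ) • b i)
    (hQ : ∀ i j, Q (b i) (b j) = if i = j then (l i : ℂ) else 0) :
    morseIndex T = negIndex Q ⊤ := by
  have hsum : ∀ x, (Q x x).re = ∑ i, l i * ‖b.repr x i‖ ^ 2 := by
    intro x
    conv_lhs => rw [← b.sum_repr x]
    simp only [map_sum, LinearMap.sum_apply, LinearMap.map_smulₛₗ, LinearMap.smul_apply, hQ,
      RingHom.id_apply, smul_eq_mul, mul_ite, mul_zero, Complex.re_sum]
    refine Finset.sum_congr rfl fun i _ => ?_
    rw [Finset.sum_ite_eq' Finset.univ i, if_pos (Finset.mem_univ i), ← mul_assoc,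
      Complex.mul_conj, Complex.normSq_eq_norm_sq, ← Complex.ofReal_mul,
      Complex.ofReal_re, mul_comm]
  set N : Submodule ℂ W := ⨆ μ : Iio (0 : ℝ), T.eigenspace ((μ : ℝ) : ℂ) with hN
  have hcoord : ∀ x ∈ N, ∀ i, 0 ≤ l i → b.repr x i = 0 := by
    intro x hx i hi
    have : N ≤ LinearMap.ker (b.coord i) := by
      refine iSup_le fun μ y hy => ?_
      rw [Module.End.mem_eigenspace_iff] at hy
      rw [LinearMap.mem_ker, Basis.coord_apply]
      have h1 : b.repr (T y) i = (l i : ℂ) * b.repr y i := by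
        conv_lhs => rw [← b.sum_repr y]
        simp only [map_sum, map_smul, hT, Finsupp.coe_finsetSum, Finset.sum_apply,
          Finsupp.smul_apply, Basis.repr_self, smul_eq_mul, Finsupp.single_apply]
        simp [mul_comm]
      rw [hy, map_smul, Finsupp.smul_apply, smul_eq_mul] at h1
      have h2 : (((μ : ℝ) : ℂ) - l i) * b.repr y i = 0 := by linear_combination h1
      rcases mul_eq_zero.1 h2 with h3 | h3
      · rw [← Complex.ofReal_sub, Complex.ofReal_eq_zero] at h3
        have : (μ : ℝ) < 0 := μ.2
        linarith
      · exact h3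
    exact this hx
  have hneg : NegDefOn Q N := by
    intro x hx hx0
    rw [hsum]
    have hle : ∀ i ∈ Finset.univ, l i * ‖b.repr x i‖ ^ 2 ≤ 0 := by
      intro i _
      rcases le_or_gt 0 (l i) with h | h
      · simp [hcoord x hx i h]
      · exact mul_nonpos_of_nonpos_of_nonneg h.le (by positivity)
    obtain ⟨i, hi⟩ : ∃ i, b.repr x i ≠ 0 := by
      by_contra! h
      exact hx0 (b.ext_elem fun i => by simp [h i])
    refine Finset.sum_neg' hle ⟨i, Finset.mem_univ i, ?_⟩
    have hl : l i < 0 := by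
      by_contra! h
      exact hi (hcoord x hx i h)
    exact mul_neg_of_neg_of_pos hl (by positivity)
  have h1 := finrank_le_negIndex le_top hneg
  have hcard : ∀ p : Fin n → Prop,
      finrank ℂ (Submodule.span ℂ (Set.range fun i : {i // p i} => b i)) =
        Nat.card {i // p i} := fun p => by
    rw [Nat.card_eq_fintype_card]
    exact finrank_span_eq_card (b.linearIndependent.comp _ Subtype.val_injective)
  have h2 : Nat.card {i // l i < 0} ≤ finrank ℂ N := by
    rw [← hcard]
    refine Submodule.finrank_mono (Submodule.span_le.2 ?_)
    rintro _ ⟨i, rfl⟩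
    exact Submodule.mem_iSup_of_mem (⟨l i, i.2⟩ : Iio (0 : ℝ))
      (Module.End.mem_eigenspace_iff.2 (hT i))
  have h3 : negIndex Q ⊤ + finrank ℂ
      (Submodule.span ℂ (Set.range fun i : {i // ¬ l i < 0} => b i)) ≤
        finrank ℂ (⊤ : Submodule ℂ W) := by
    refine negIndex_add_finrank_le le_top fun x hx => ?_
    rw [hsum]
    refine Finset.sum_nonneg fun i _ => ?_
    rcases lt_or_ge (l i) 0 with h | h
    · have : b.repr x i = 0 := by
        have hle : Submodule.span ℂ (Set.range fun i : {i // ¬ l i < 0} => b i) ≤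
            LinearMap.ker (b.coord i) := by
          rw [Submodule.span_le]
          rintro _ ⟨j, rfl⟩
          have : (j : Fin n) ≠ i := fun e => j.2 (e ▸ h)
          simp [this]
        exact hle hx
      simp [this]
    · positivity
  rw [hcard, finrank_top, finrank_eq_card_basis b] at h3
  have h4 : Nat.card {i // l i < 0} + Nat.card {i // ¬ l i < 0} = Fintype.card (Fin n) := by
    rw [← Nat.card_sum, ← Nat.card_eq_fintype_card]
    exact Nat.card_congr (Equiv.sumCompl _)
  have : morseIndex T = finrank ℂ N := rfl
  omega

/-- The Hermitian form `(x, y) ↦ ⟨x, T y⟩` on `ι → ℂ`. -/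
noncomputable def dotForm {ι : Type*} [Fintype ι] (T : Module.End ℂ (ι → ℂ)) :
    (ι → ℂ) →ₗ⋆[ℂ] (ι → ℂ) →ₗ[ℂ] ℂ :=
  LinearMap.mk₂'ₛₗ (starRingEnd ℂ) (RingHom.id ℂ)
    (fun x y => ∑ i, (starRingEnd ℂ) (x i) * T y i)
    (fun x y z => by simp [add_mul, Finset.sum_add_distrib])
    (fun c x y => by simp [Finset.mul_sum, mul_assoc])
    (fun x y z => by simp [mul_add, Finset.sum_add_distrib])
    (fun c x y => by
      simp only [map_smul, Pi.smul_apply, smul_eq_mul, Finset.mul_sum, RingHom.id_apply]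
      exact Finset.sum_congr rfl fun i _ => by ring)

@[simp]
theorem dotForm_apply {ι : Type*} [Fintype ι] (T : Module.End ℂ (ι → ℂ)) (x y : ι → ℂ) :
    dotForm T x y = ∑ i, (starRingEnd ℂ) (x i) * T y i := rfl

/-- The spectral theorem. The space `ι → ℂ` carries the supremum norm, so `T` is transported to the
Euclidean space to obtain an orthonormal eigenbasis. -/
theorem morseIndex_eq_negIndex_dotForm {ι : Type*} [Fintype ι] (T : Module.End ℂ (ι → ℂ))
    (hT : (dotForm T).IsSymm) : morseIndex T = negIndex (dotForm T) ⊤ := by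
  let e := WithLp.linearEquiv 2 ℂ (ι → ℂ)
  let T' : Module.End ℂ (EuclideanSpace ℂ ι) := e.symm.toLinearMap ∘ₗ T ∘ₗ e.toLinearMap
  have hin : ∀ x y : EuclideanSpace ℂ ι, inner ℂ x (T' y) = dotForm T (e x) (e y) := by
    intro x y
    rw [PiLp.inner_apply, dotForm_apply]
    refine Finset.sum_congr rfl fun i _ => ?_
    rw [RCLike.inner_apply, mul_comm]
    rfl
  have hsym : T'.IsSymmetric := by
    intro x y
    rw [← inner_conj_symm, hin, hin, hT.eq]
  have hfr : finrank ℂ (EuclideanSpace ℂ ι) = Fintype.card ι := finrank_euclideanSpace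
  let b := hsym.eigenvectorBasis hfr
  have hb : ∀ i, T' (b i) = (hsym.eigenvalues hfr i : ℂ) • b i :=
    hsym.apply_eigenvectorBasis hfr
  refine morseIndex_eq_of_basis (b.toBasis.map e) T (hsym.eigenvalues hfr) ?_ ?_
  · intro i
    have := congrArg e (hb i)
    rw [map_smul] at this
    simpa [T'] using this
  · intro i j
    have := hin (b i) (b j)
    rw [hb j, inner_smul_right, orthonormal_iff_ite.1 b.orthonormal] at this
    simp only [Basis.map_apply, OrthonormalBasis.coe_toBasis]
    rw [← this]
    split_ifs with h
    · rw [h, mul_one]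
    · rw [mul_zero]

theorem posIndex_eq_morseIndex_neg {W : Type*} [AddCommGroup W] [Module ℂ W]
    (T : Module.End ℂ W) : posIndex T = morseIndex (-T) := by
  have h : ∀ μ : ℝ, T.eigenspace (μ : ℂ) = (-T).eigenspace ((-μ : ℝ) : ℂ) := by
    intro μ
    ext x
    rw [Module.End.mem_eigenspace_iff, Module.End.mem_eigenspace_iff, LinearMap.neg_apply,
      Complex.ofReal_neg, neg_smul, neg_inj]
  have : (⨆ μ : Ioi (0 : ℝ), T.eigenspace ((μ : ℝ) : ℂ)) =
      ⨆ μ : Iio (0 : ℝ), (-T).eigenspace ((μ : ℝ) : ℂ) := by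
    apply le_antisymm
    · refine iSup_le fun μ => ?_
      rw [h]
      exact le_iSup (fun μ : Iio (0 : ℝ) => (-T).eigenspace ((μ : ℝ) : ℂ))
        ⟨-μ, neg_neg_iff_pos.2 (mem_Ioi.1 μ.2)⟩
    · refine iSup_le fun μ => ?_
      have := h (-μ)
      rw [neg_neg] at this
      rw [← this]
      exact le_iSup (fun μ : Ioi (0 : ℝ) => T.eigenspace ((μ : ℝ) : ℂ))
        ⟨-μ, neg_pos.2 (mem_Iio.1 μ.2)⟩
  rw [posIndex, this, morseIndex]

/-- If `D` identifies the Hermitian form `Q` on `M` with `⟨x, T y⟩`, then the Morse index of `T` is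
the negative index of `Q` on `M`. -/
theorem morseIndex_eq_negIndex {A ι : Type*} [AddCommGroup A] [Module ℂ A]
    [FiniteDimensional ℂ A] [Fintype ι] {Q : A →ₗ⋆[ℂ] A →ₗ[ℂ] ℂ} (hQ : Q.IsSymm)
    (M : Submodule ℂ A) (D : M ≃ₗ[ℂ] (ι → ℂ)) (T : Module.End ℂ (ι → ℂ))
    (h : ∀ x y : M, Q x y = ∑ i, (starRingEnd ℂ) (D x i) * T (D y) i) :
    morseIndex T = negIndex Q M := by
  have hT : (dotForm T).IsSymm := by
    refine ⟨fun x y => ?_⟩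
    obtain ⟨x, rfl⟩ := D.surjective x
    obtain ⟨y, rfl⟩ := D.surjective y
    rw [dotForm_apply, dotForm_apply, ← h, ← h, hQ.eq]
  rw [morseIndex_eq_negIndex_dotForm T hT]
  exact (negIndex_eq_of_equiv M D fun x => h x x).symm

end EigenvalueIndex

/-! ### Fundamental solutions, including the case `k = 0`. -/

section Solutions

/-- The solution `cos (k x)` of `-u'' = k² u`. -/
noncomputable def cosSol (k x : ℝ) : ℝ := Real.cos (k * x)

/-- The solution `sin (k x) / k` of `-u'' = k² u` (which is `x` for `k = 0`). -/
noncomputable def sinSol (k x : ℝ) : ℝ := x * Real.sinc (k * x)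

theorem mul_sinSol (k x : ℝ) : k * sinSol k x = Real.sin (k * x) := by
  rw [sinSol]
  by_cases h : k * x = 0
  · rw [← mul_assoc, h]; simp
  · rw [Real.sinc_of_ne_zero h]
    rw [← mul_assoc, mul_div_cancel₀ _ h]

@[simp] theorem cosSol_zero (k : ℝ) : cosSol k 0 = 1 := by simp [cosSol]

@[simp] theorem sinSol_zero (k : ℝ) : sinSol k 0 = 0 := by simp [sinSol]

theorem hasDerivAt_cosSol (k x : ℝ) : HasDerivAt (cosSol k) (-(k ^ 2 * sinSol k x)) x := by
  have h := (Real.hasDerivAt_cos (k * x)).comp x ((hasDerivAt_id x).const_mul k)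
  have e : -Real.sin (k * x) * (k * 1) = -(k ^ 2 * sinSol k x) := by
    rw [← mul_sinSol]; ring
  rw [← e]
  exact h

theorem hasDerivAt_sinSol (k x : ℝ) : HasDerivAt (sinSol k) (cosSol k x) x := by
  by_cases hk : k = 0
  · subst hk
    have : sinSol 0 = id := by
      funext y
      simp [sinSol]
    rw [this]
    simpa [cosSol] using hasDerivAt_id x
  · have h := (((hasDerivAt_id x).const_mul k).sin).const_mul k⁻¹
    have e : k⁻¹ * (Real.cos (k * id x) * (k * 1)) = cosSol k x := by
      rw [cosSol, id]
      field_simp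
    refine (h.congr_deriv e).congr_of_eventuallyEq (Filter.Eventually.of_forall fun y => ?_)
    change sinSol k y = k⁻¹ * Real.sin (k * y)
    rw [← mul_sinSol, inv_mul_cancel_left₀ hk]

theorem cosSol_sq_add (k x : ℝ) : cosSol k x ^ 2 + k ^ 2 * sinSol k x ^ 2 = 1 := by
  have := Real.cos_sq_add_sin_sq (k * x)
  rw [← mul_sinSol] at this
  rw [cosSol]
  linear_combination this

theorem sinSol_pos {k x : ℝ} (hk : 0 ≤ k) (hx : 0 < x) (h : k * x < Real.pi) :
    0 < sinSol k x := by
  rcases hk.eq_or_lt with rfl | hk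
  · simpa [sinSol] using hx
  · have : 0 < k * sinSol k x := by
      rw [mul_sinSol]
      exact Real.sin_pos_of_pos_of_lt_pi (by positivity) h
    exact pos_of_mul_pos_right this hk.le

end Solutions

namespace MetricGraph

/-! ### Summation over the ends of edges. -/

section EdgeSums

variable {V E : Type*} {M : Type*} [AddCommGroup M] [Fintype E]

/-- Integration by parts on the graph: end terms minus start terms are regrouped by vertices, and
only the vertices with an imbalance remain. `V` may be infinite, so the sum runs over `B` and the
vertices that carry an edge. -/
theorem sum_ends (G : MetricGraph V E) (φ₀ φ₁ : E → M) (B : Finset V)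
    (h : ∀ v ∉ B, ∑ e ∈ Finset.univ.filter (fun e => G.src e = v), φ₀ e =
      ∑ e ∈ Finset.univ.filter (fun e => G.tgt e = v), φ₁ e) :
    ∑ e, (φ₁ e - φ₀ e) = ∑ v ∈ B, (∑ e ∈ Finset.univ.filter (fun e => G.tgt e = v), φ₁ e -
      ∑ e ∈ Finset.univ.filter (fun e => G.src e = v), φ₀ e) := by
  set T : Finset V := B ∪ (Finset.univ.image G.src ∪ Finset.univ.image G.tgt) with hT
  have h1 : ∑ e, φ₁ e = ∑ v ∈ T, ∑ e ∈ Finset.univ.filter (fun e => G.tgt e = v), φ₁ e :=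
    (Finset.sum_fiberwise_of_maps_to (fun e _ => by simp [hT]) _).symm
  have h0 : ∑ e, φ₀ e = ∑ v ∈ T, ∑ e ∈ Finset.univ.filter (fun e => G.src e = v), φ₀ e :=
    (Finset.sum_fiberwise_of_maps_to (fun e _ => by simp [hT]) _).symm
  rw [Finset.sum_sub_distrib, h1, h0, ← Finset.sum_sub_distrib]
  refine (Finset.sum_subset Finset.subset_union_left fun v _ hv => ?_).symm
  rw [h v hv, sub_self]

end EdgeSums

/-! ### Solutions on the edges and the eigenspaces of the Laplacian. -/

section Helmholtz

variable {V E : Type*} {G : MetricGraph V E}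

theorem uniqueDiffOn_edge (e : E) : UniqueDiffOn ℝ (Icc 0 (G.len e)) :=
  uniqueDiffOn_Icc (G.len_pos e)

theorem hasDerivWithinAt_H2 (u : G.H2) (e : E) (x : Icc (0 : ℝ) (G.len e)) :
    HasDerivWithinAt (u.1 e) (der e x u) (Icc 0 (G.len e)) x :=
  (H2_differentiableOn u e x x.2).hasDerivWithinAt

/-- Regularity: `g` agrees almost everywhere with the continuous function `-c u`, so the integral
formula for `u'` can be differentiated at every point. -/
theorem hasDerivWithinAt_derivWithin {c : ℝ} {u : G.H2} (hu : u ∈ G.helmholtz c) (e : E) {x : ℝ}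
    (hx : x ∈ Icc 0 (G.len e)) :
    HasDerivWithinAt (derivWithin (u.1 e) (Icc 0 (G.len e))) (-c * u.1 e x)
      (Icc 0 (G.len e)) x := by
  obtain ⟨g, ⟨hd, hg2, hg⟩, hae⟩ := hu e
  have h0l := (G.len_pos e).le
  have hcont : ContinuousOn (fun x => -c * u.1 e x) (Icc 0 (G.len e)) :=
    (continuousOn_const.mul hd.continuousOn)
  -- The constant extension beyond the ends makes the integrand continuous on the line, so that the
  -- fundamental theorem also applies at the end points.
  set U : ℝ → ℂ := IccExtend h0l (Icc 0 (G.len e) |>.domRestrict fun x => -c * u.1 e x) with hU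
  have hUc : Continuous U := hcont.domRestrict.Icc_extend'
  have hUeq : ∀ t ∈ Icc 0 (G.len e), U t = -c * u.1 e t := fun t ht => by
    rw [hU, IccExtend_of_mem _ _ ht]; rfl
  have hae' : ∀ᵐ t, t ∈ Icc 0 (G.len e) → g t = U t := by
    rw [ae_restrict_iff' measurableSet_Icc] at hae
    filter_upwards [hae] with t ht htm
    rw [hUeq t htm, neg_mul, ← ht htm, neg_neg]
  have hint : ∀ y ∈ Icc 0 (G.len e), derivWithin (u.1 e) (Icc 0 (G.len e)) y =
      derivWithin (u.1 e) (Icc 0 (G.len e)) 0 + ∫ t in (0 : ℝ)..y, U t := by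
    intro y hy
    rw [hg y hy]
    congr 1
    refine intervalIntegral.integral_congr_ae ?_
    filter_upwards [hae'] with t ht htm
    rw [uIoc_of_le hy.1] at htm
    exact ht ⟨htm.1.le, htm.2.trans hy.2⟩
  rw [← hUeq x hx]
  have hd' : HasDerivAt (fun y => derivWithin (u.1 e) (Icc 0 (G.len e)) 0 + ∫ t in (0 : ℝ)..y, U t)
      (U x) x :=
    (intervalIntegral.integral_hasDerivAt_right (hUc.intervalIntegrable _ _)
      hUc.stronglyMeasurable.stronglyMeasurableAtFilter hUc.continuousAt).const_add _
  exact hd'.hasDerivWithinAt.congr hint (hint x hx)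

theorem eq_of_hasDerivWithinAt_zero {l : ℝ} {F : Type*} [NormedAddCommGroup F] [NormedSpace ℝ F]
    {φ : ℝ → F} (hl : 0 < l)
    (h : ∀ x ∈ Icc 0 l, HasDerivWithinAt φ 0 (Icc 0 l) x) {x : ℝ} (hx : x ∈ Icc 0 l) :
    φ x = φ 0 :=
  constant_of_derivWithin_zero (fun y hy => (h y hy).differentiableWithinAt)
    (fun y hy => (h y (Ico_subset_Icc_self hy)).derivWithin
      (uniqueDiffOn_Icc hl y (Ico_subset_Icc_self hy))) x hx

/-- The Wronskians of `u` with the two fundamental solutions are constant. The resulting linear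
system is inverted by `cosSol² + k² sinSol² = 1`. -/
theorem val_der_eq {k : ℝ} {u : G.H2} (hu : u ∈ G.helmholtz (k ^ 2)) (e : E)
    (x : Icc (0 : ℝ) (G.len e)) :
    val e x u = cosSol k x * val e (startPt e) u + sinSol k x * der e (startPt e) u ∧
      der e x u = cosSol k x * der e (startPt e) u -
        k ^ 2 * sinSol k x * val e (startPt e) u := by
  set f := u.1 e with hf
  set f' := derivWithin f (Icc 0 (G.len e)) with hf'
  have hC : ∀ y, HasDerivWithinAt (fun y => (cosSol k y : ℂ))
      (-(k ^ 2 * sinSol k y)) (Icc 0 (G.len e)) y := fun y => by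
    have := (hasDerivAt_cosSol k y).ofReal_comp
    push_cast at this
    exact this.hasDerivWithinAt
  have hS : ∀ y, HasDerivWithinAt (fun y => (sinSol k y : ℂ)) (cosSol k y) (Icc 0 (G.len e)) y := fun y =>
    (hasDerivAt_sinSol k y).ofReal_comp.hasDerivWithinAt
  have hF : ∀ y ∈ Icc 0 (G.len e), HasDerivWithinAt f (f' y) (Icc 0 (G.len e)) y := fun y hy => hasDerivWithinAt_H2 u e ⟨y, hy⟩
  have hF' : ∀ y ∈ Icc 0 (G.len e), HasDerivWithinAt f' (-k ^ 2 * f y) (Icc 0 (G.len e)) y := fun y hy => by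
    have := hasDerivWithinAt_derivWithin hu e hy
    push_cast at this
    exact this
  have h1 : cosSol k x * f x - sinSol k x * f' x = f 0 := by
    have := eq_of_hasDerivWithinAt_zero (G.len_pos e)
      (φ := fun y => (cosSol k y : ℂ) * f y - sinSol k y * f' y) (fun y hy => by
        have := ((hC y).mul (hF y hy)).sub ((hS y).mul (hF' y hy))
        refine this.congr_deriv ?_
        ring) x.2
    simpa using this
  have h2 : k ^ 2 * sinSol k x * f x + cosSol k x * f' x = f' 0 := by
    have := eq_of_hasDerivWithinAt_zero (G.len_pos e)
      (φ := (fun y => (k : ℂ) ^ 2 * ((sinSol k y : ℂ) * f y)) + fun y => cosSol k y * f' y) (fun y hy => by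
        have := (((hS y).mul (hF y hy)).const_mul ((k : ℂ) ^ 2)).add ((hC y).mul (hF' y hy))
        refine this.congr_deriv ?_
        ring) x.2
    simp only [Pi.add_apply, sinSol_zero, cosSol_zero, Complex.ofReal_zero, Complex.ofReal_one, zero_mul,
      mul_zero, one_mul, zero_add] at this
    rw [← this]
    ring
  have h3 : (cosSol k x : ℂ) ^ 2 + k ^ 2 * sinSol k x ^ 2 = 1 := by
    exact_mod_cast cosSol_sq_add k x
  change f x = cosSol k x * f 0 + sinSol k x * f' 0 ∧
    f' x = cosSol k x * f' 0 - k ^ 2 * sinSol k x * f 0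
  rw [← h1, ← h2]
  constructor
  · linear_combination -(f x) * h3
  · linear_combination -(f' x) * h3

/-- The function whose restriction to the edge `e` is the solution of `-u'' = k² u` with initial
values `d e` at the start of `e`. -/
noncomputable def solFun (G : MetricGraph V E) (k : ℝ) (d : E → ℂ × ℂ) (e : E) (x : ℝ) : ℂ :=
  if x ∈ Icc 0 (G.len e) then cosSol k x * (d e).1 + sinSol k x * (d e).2 else 0

theorem solFun_hasDerivWithinAt (k : ℝ) (d : E → ℂ × ℂ) (e : E) {x : ℝ}
    (hx : x ∈ Icc 0 (G.len e)) :
    HasDerivWithinAt (G.solFun k d e) (cosSol k x * (d e).2 - k ^ 2 * sinSol k x * (d e).1)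
      (Icc 0 (G.len e)) x := by
  have h := ((hasDerivAt_cosSol k x).ofReal_comp.mul_const (d e).1).add
    ((hasDerivAt_sinSol k x).ofReal_comp.mul_const (d e).2)
  have h' := (h.hasDerivWithinAt (s := Icc 0 (G.len e))).congr_of_mem
    (f₁ := G.solFun k d e) (fun y hy => by simp [solFun, hy]) hx
  refine h'.congr_deriv ?_
  push_cast
  ring

theorem solFun_hasSecondDeriv (k : ℝ) (d : E → ℂ × ℂ) (e : E) :
    HasSecondDeriv (G.len e) (G.solFun k d e) fun x => -k ^ 2 * G.solFun k d e x := by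
  have hder : ∀ x ∈ Icc 0 (G.len e), derivWithin (G.solFun k d e) (Icc 0 (G.len e)) x =
      cosSol k x * (d e).2 - k ^ 2 * sinSol k x * (d e).1 := fun x hx =>
    (solFun_hasDerivWithinAt k d e hx).derivWithin (uniqueDiffOn_edge e x hx)
  have hcont : ContinuousOn (fun x => -(k : ℂ) ^ 2 * G.solFun k d e x) (Icc 0 (G.len e)) :=
    continuousOn_const.mul fun x hx => (solFun_hasDerivWithinAt k d e hx).continuousWithinAt
  refine ⟨fun x hx => (solFun_hasDerivWithinAt k d e hx).differentiableWithinAt, ?_, ?_⟩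
  · obtain ⟨C, hC⟩ := isCompact_Icc.exists_bound_of_continuousOn hcont
    exact MemLp.of_bound (hcont.aestronglyMeasurable measurableSet_Icc) C
      ((ae_restrict_iff' measurableSet_Icc).2 (Filter.Eventually.of_forall hC))
  · intro x hx
    rw [hder x hx, hder 0 ⟨le_rfl, (G.len_pos e).le⟩]
    have hsub : [[0, x]] ⊆ Icc 0 (G.len e) := by
      rw [uIcc_of_le hx.1]; exact Icc_subset_Icc_right hx.2
    have hF : ∀ y ∈ [[0, x]], HasDerivAt
        (fun y : ℝ => (cosSol k y : ℂ) * (d e).2 - k ^ 2 * (sinSol k y * (d e).1))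
        (-(k : ℂ) ^ 2 * G.solFun k d e y) y := by
      intro y hy
      have h := ((hasDerivAt_cosSol k y).ofReal_comp.mul_const (d e).2).sub
        (((hasDerivAt_sinSol k y).ofReal_comp.mul_const (d e).1).const_mul ((k : ℂ) ^ 2))
      refine h.congr_deriv ?_
      have e1 : G.solFun k d e y = cosSol k y * (d e).1 + sinSol k y * (d e).2 :=
        if_pos (hsub hy)
      rw [e1]
      push_cast
      ring
    rw [intervalIntegral.integral_eq_sub_of_hasDerivAt hF
      ((hcont.mono hsub).intervalIntegrable)]
    simp
    ring

/-- The solution of `-u'' = k² u` on the edges with given initial values. -/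
noncomputable def sol (G : MetricGraph V E) (k : ℝ) (d : E → ℂ × ℂ) : G.H2 :=
  ⟨G.solFun k d, fun e => ⟨fun _ hx => if_neg hx,
    _, solFun_hasSecondDeriv k d e⟩⟩

theorem sol_mem_helmholtz (k : ℝ) (d : E → ℂ × ℂ) : G.sol k d ∈ G.helmholtz (k ^ 2) := by
  refine fun e => ⟨_, solFun_hasSecondDeriv k d e, Filter.Eventually.of_forall fun x => ?_⟩
  push_cast
  change -(-(k : ℂ) ^ 2 * G.solFun k d e x) = k ^ 2 * G.solFun k d e x
  ring

theorem val_sol (k : ℝ) (d : E → ℂ × ℂ) (e : E) (x : Icc (0 : ℝ) (G.len e)) :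
    val e x (G.sol k d) = cosSol k x * (d e).1 + sinSol k x * (d e).2 := by
  change G.solFun k d e x = _
  rw [solFun, if_pos x.2]

theorem der_sol (k : ℝ) (d : E → ℂ × ℂ) (e : E) (x : Icc (0 : ℝ) (G.len e)) :
    der e x (G.sol k d) = cosSol k x * (d e).2 - k ^ 2 * sinSol k x * (d e).1 :=
  (solFun_hasDerivWithinAt k d e x.2).derivWithin (uniqueDiffOn_edge e x x.2)

theorem H2_ext {u v : G.H2} (h : ∀ e x, val e x u = val e x v) : u = v := by
  apply Subtype.ext
  funext e x
  by_cases hx : x ∈ Icc 0 (G.len e)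
  · exact h e ⟨x, hx⟩
  · rw [(u.2 e).1 x hx, (v.2 e).1 x hx]

/-- Differentiating the relation twice multiplies the summand with parameter `c` by `-c`. -/
theorem sum_smul_eq_zero_of_sum_eq_zero {s : Finset ℝ} {u : ℝ → G.H2}
    (hu : ∀ c, u c ∈ G.helmholtz c) (h : ∑ c ∈ s, u c = 0) : ∑ c ∈ s, (c : ℂ) • u c = 0 := by
  apply H2_ext
  intro e x
  have hder : ∀ y ∈ Icc 0 (G.len e),
      ∑ c ∈ s, derivWithin ((u c).1 e) (Icc 0 (G.len e)) y = 0 := by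
    intro y hy
    have := congrArg (der e ⟨y, hy⟩) h
    rw [map_sum, map_zero] at this
    exact this
  have h1 : HasDerivWithinAt
      (fun y => ∑ c ∈ s, derivWithin ((u c).1 e) (Icc 0 (G.len e)) y)
      (∑ c ∈ s, -(c : ℂ) * (u c).1 e x) (Icc 0 (G.len e)) x :=
    HasDerivWithinAt.fun_sum fun c _ => hasDerivWithinAt_derivWithin (hu c) e x.2
  have h2 := (hasDerivWithinAt_const (x : ℝ) (Icc 0 (G.len e)) (0 : ℂ)).congr_of_mem hder x.2
  have h3 := (uniqueDiffOn_edge e x x.2).eq_deriv _ h1 h2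
  rw [map_sum, map_zero]
  simp only [map_smul, smul_eq_mul]
  rw [← neg_eq_zero, ← Finset.sum_neg_distrib, ← h3]
  exact Finset.sum_congr rfl fun c _ => by rw [neg_mul]; rfl

variable [Fintype E]

/-- No inner product is needed: subtracting `a` times a relation from its twice differentiated form
removes the summand with parameter `a`, and induction on the number of summands applies. -/
theorem iSupIndep_eigenspace (G : MetricGraph V E) : iSupIndep G.eigenspace := by
  have key : ∀ (s : Finset ℝ) (u : ℝ → G.H2), (∀ c, u c ∈ G.eigenspace c) →
      ∑ c ∈ s, u c = 0 → ∀ c ∈ s, u c = 0 := by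
    intro s
    induction s using Finset.induction_on with
    | empty => simp
    | insert a s ha ih =>
      intro u hu hs
      have h1 := sum_smul_eq_zero_of_sum_eq_zero (fun c => (hu c).1) hs
      have h2 : ∑ c ∈ s, ((c : ℂ) - a) • u c = 0 := by
        rw [Finset.sum_insert ha] at hs h1
        rw [Finset.sum_congr rfl fun (c : ℝ) _ => sub_smul (c : ℂ) (a : ℂ) (u c),
          Finset.sum_sub_distrib,
          ← Finset.smul_sum]
        have e1 : ∑ c ∈ s, u c = -u a := by
          rw [eq_neg_iff_add_eq_zero, add_comm]; exact hs
        have e2 : ∑ c ∈ s, (c : ℂ) • u c = -((a : ℂ) • u a) := by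
          rw [eq_neg_iff_add_eq_zero, add_comm]; exact h1
        rw [e1, e2, smul_neg, sub_self]
      have h3 := ih (fun c => ((c : ℂ) - a) • u c)
        (fun c => Submodule.smul_mem _ _ (hu c)) h2
      have h4 : ∀ c ∈ s, u c = 0 := fun c hc => by
        refine (smul_eq_zero.1 (h3 c hc)).resolve_left ?_
        intro h
        exact ha (Complex.ofReal_injective (sub_eq_zero.1 h) ▸ hc)
      intro c hc
      rcases Finset.mem_insert.1 hc with rfl | hc
      · rw [Finset.sum_insert ha, Finset.sum_eq_zero h4, add_zero] at hs
        exact hs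
      · exact h4 c hc
  rw [iSupIndep_iff_forall_dfinsupp]
  intro i x v hv
  rw [DFinsupp.lsum_apply_apply, DFinsupp.sumAddHom_apply, DFinsupp.sum] at hv
  have hi : i ∉ (v.erase i).support := by simp
  have := key (insert i (v.erase i).support) (fun c => if c = i then -(x : G.H2) else v c)
    (fun c => by
      split_ifs with h
      · subst h
        exact Submodule.neg_mem _ x.2
      · exact (v c).2) (by
      rw [Finset.sum_insert hi, if_pos rfl, ← hv, neg_add_eq_zero]
      refine Finset.sum_congr rfl fun c hc => ?_
      have hc' : c ≠ i := fun h => hi (h ▸ hc)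
      rw [if_neg hc', DFinsupp.erase_ne hc']
      rfl) i (Finset.mem_insert_self _ _)
  rw [if_pos rfl, neg_eq_zero] at this
  exact Subtype.ext this

theorem mem_eigenspace_iff {c : ℝ} {u : G.H2} :
    u ∈ G.eigenspace c ↔ u ∈ G.helmholtz c ∧ ∀ v, u ∈ G.kirchhoff v := by
  rw [eigenspace, Submodule.mem_inf, Submodule.mem_iInf]

/-- `Re (ū u')` has derivative `|u'|² - c |u|² ≥ 0` on every edge, while the Neumann–Kirchhoff
conditions make its total increment zero. So it is constant on every edge, and `c < 0` forces `u =
0`. -/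
theorem eigenspace_eq_bot_of_neg (G : MetricGraph V E) {c : ℝ} (hc : c < 0) :
    G.eigenspace c = ⊥ := by
  rw [Submodule.eq_bot_iff]
  intro u hu
  rw [mem_eigenspace_iff] at hu
  obtain ⟨hu, hv⟩ := hu
  let φ : (e : E) → ℝ → ℝ := fun e x =>
    ((starRingEnd ℂ) (u.1 e x) * derivWithin (u.1 e) (Icc 0 (G.len e)) x).re
  have hφ : ∀ e, ∀ x ∈ Icc 0 (G.len e), HasDerivWithinAt (φ e)
      (‖derivWithin (u.1 e) (Icc 0 (G.len e)) x‖ ^ 2 - c * ‖u.1 e x‖ ^ 2)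
      (Icc 0 (G.len e)) x := by
    intro e x hx
    have h1 := hasDerivWithinAt_H2 u e ⟨x, hx⟩
    have h2 := hasDerivWithinAt_derivWithin hu e hx
    have h3 := Complex.reCLM.hasFDerivAt.comp_hasDerivWithinAt x (h1.star.mul h2)
    have e1 : Complex.reCLM (star (der e ⟨x, hx⟩ u) * derivWithin (u.1 e) (Icc 0 (G.len e)) x +
        star (u.1 e x) * (-c * u.1 e x)) =
        ‖derivWithin (u.1 e) (Icc 0 (G.len e)) x‖ ^ 2 - c * ‖u.1 e x‖ ^ 2 := by
      rw [Complex.reCLM_apply, Complex.add_re, ← Complex.normSq_eq_norm_sq,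
        ← Complex.normSq_eq_norm_sq]
      change ((starRingEnd ℂ) (derivWithin (u.1 e) (Icc 0 (G.len e)) x) * _).re +
        ((starRingEnd ℂ) (u.1 e x) * _).re = _
      rw [← Complex.normSq_eq_conj_mul_self, Complex.ofReal_re, mul_left_comm,
        ← Complex.normSq_eq_conj_mul_self, ← Complex.ofReal_neg, ← Complex.ofReal_mul,
        Complex.ofReal_re]
      ring
    rw [← e1]
    exact h3
  have hmono : ∀ e, MonotoneOn (φ e) (Icc 0 (G.len e)) := by
    intro e
    refine monotoneOn_of_hasDerivWithinAt_nonneg (convex_Icc _ _)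
      (fun x hx => (hφ e x hx).continuousWithinAt)
      (fun x hx => (hφ e x (interior_subset hx)).mono interior_subset) fun x hx => ?_
    nlinarith [sq_nonneg ‖derivWithin (u.1 e) (Icc 0 (G.len e)) x‖, sq_nonneg ‖u.1 e x‖]
  have hsum : ∑ e, (φ e (G.len e) - φ e 0) = 0 := by
    have := G.sum_ends (fun e => φ e 0) (fun e => φ e (G.len e)) ∅ (fun v _ => by
      obtain ⟨⟨a, ha, hb⟩, hs⟩ := hv v
      have e1 : ∑ e ∈ Finset.univ.filter (fun e => G.src e = v), φ e 0 =
          ((starRingEnd ℂ) a * G.sumOut der v u).re := by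
        rw [sumOut, LinearMap.sum_apply, Finset.mul_sum, Complex.re_sum]
        refine Finset.sum_congr rfl fun e he => ?_
        rw [← ha e (Finset.mem_filter.1 he).2]
        rfl
      have e2 : ∑ e ∈ Finset.univ.filter (fun e => G.tgt e = v), φ e (G.len e) =
          ((starRingEnd ℂ) a * G.sumIn der v u).re := by
        rw [sumIn, LinearMap.sum_apply, Finset.mul_sum, Complex.re_sum]
        refine Finset.sum_congr rfl fun e he => ?_
        rw [← hb e (Finset.mem_filter.1 he).2]
        rfl
      rw [e1, e2, sub_eq_zero.1 hs])
    simpa using this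
  have hle : ∀ e, 0 ≤ φ e (G.len e) - φ e 0 := fun e => sub_nonneg.2
    (hmono e ⟨le_rfl, (G.len_pos e).le⟩ ⟨(G.len_pos e).le, le_rfl⟩ (G.len_pos e).le)
  apply H2_ext
  intro e x
  have h0 := (Finset.sum_eq_zero_iff_of_nonneg fun e _ => hle e).1 hsum e (Finset.mem_univ e)
  have hconst : ∀ y ∈ Icc 0 (G.len e), φ e y = φ e 0 := by
    intro y hy
    have h1 := hmono e ⟨le_rfl, (G.len_pos e).le⟩ hy hy.1
    have h2 := hmono e hy ⟨(G.len_pos e).le, le_rfl⟩ hy.2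
    linarith
  have h2 := (hasDerivWithinAt_const (x : ℝ) (Icc 0 (G.len e)) (φ e 0)).congr_of_mem hconst x.2
  have h3 := (uniqueDiffOn_edge e x x.2).eq_deriv _ (hφ e x x.2) h2
  have h4 : ‖u.1 e x‖ ^ 2 = 0 := by
    nlinarith [sq_nonneg ‖derivWithin (u.1 e) (Icc 0 (G.len e)) x‖, sq_nonneg ‖u.1 e x‖]
  have h5 : ‖u.1 e x‖ = 0 := by simpa using h4
  exact norm_eq_zero.1 h5

end Helmholtz

end MetricGraph

/-! ### Coefficients of the Dirichlet-to-Neumann map of an interval. -/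

section EdgeCoefficients

/-- The diagonal coefficient of the Dirichlet-to-Neumann map of `-u'' = k² u` on `[0, l]`. -/
noncomputable def coA (k l : ℝ) : ℝ := cosSol k l / sinSol k l

/-- Minus the off-diagonal coefficient of the Dirichlet-to-Neumann map of `-u'' = k² u` on
`[0, l]`. -/
noncomputable def coB (k l : ℝ) : ℝ := 1 / sinSol k l

theorem coB_pos {k l : ℝ} (hk : 0 ≤ k) (hl : 0 < l) (h : k * l < Real.pi) : 0 < coB k l :=
  one_div_pos.2 (sinSol_pos hk hl h)

/-- The Dirichlet-to-Neumann matrix has diagonal `coA` and off-diagonal `-coB`; this is its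
eigenvalue on `(1, 1)`, and `coA + coB` is the one on `(1, -1)`. Half-angle formulas make the
dependence on `k` visible. -/
theorem coA_sub_coB {k l : ℝ} (hk : 0 ≤ k) (hl : 0 < l) (h : k * l < Real.pi) :
    coA k l - coB k l = -(k * Real.tan (k * l / 2)) := by
  have hs := sinSol_pos hk hl h
  have ht : 0 < Real.cos (k * l / 2) :=
    Real.cos_pos_of_mem_Ioo ⟨by have := mul_nonneg hk hl.le; linarith [Real.pi_pos], by linarith⟩
  have h1 : k * sinSol k l = 2 * Real.sin (k * l / 2) * Real.cos (k * l / 2) := by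
    rw [mul_sinSol, ← Real.sin_two_mul]; congr 1; ring
  have h2 : cosSol k l = 1 - 2 * Real.sin (k * l / 2) ^ 2 := by
    have e : k * l = 2 * (k * l / 2) := by ring
    rw [cosSol]
    conv_lhs => rw [e, Real.cos_two_mul, Real.cos_sq']
    ring
  rw [coA, coB, ← sub_div, Real.tan_eq_sin_div_cos, h2]
  rw [div_eq_iff hs.ne']
  have : k * (Real.sin (k * l / 2) / Real.cos (k * l / 2)) * sinSol k l =
      (k * sinSol k l) * (Real.sin (k * l / 2) / Real.cos (k * l / 2)) := by ring
  rw [neg_mul, this, h1]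
  field_simp
  ring

theorem coA_add_coB {k l : ℝ} (hk : 0 < k) (hl : 0 < l) (h : k * l < Real.pi) :
    coA k l + coB k l = k * (Real.cos (k * l / 2) / Real.sin (k * l / 2)) := by
  have hs := sinSol_pos hk.le hl h
  have hp : 0 < k * l := mul_pos hk hl
  have ht : 0 < Real.sin (k * l / 2) := Real.sin_pos_of_pos_of_lt_pi (by linarith) (by linarith)
  have h1 : k * sinSol k l = 2 * Real.sin (k * l / 2) * Real.cos (k * l / 2) := by
    rw [mul_sinSol, ← Real.sin_two_mul]; congr 1; ring
  have h2 : cosSol k l = 2 * Real.cos (k * l / 2) ^ 2 - 1 := by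
    rw [cosSol, ← Real.cos_two_mul]; congr 1; ring
  rw [coA, coB, ← add_div, h2, div_eq_iff hs.ne']
  have : k * (Real.cos (k * l / 2) / Real.sin (k * l / 2)) * sinSol k l =
      (k * sinSol k l) * (Real.cos (k * l / 2) / Real.sin (k * l / 2)) := by ring
  rw [this, h1]
  field_simp
  ring

theorem coA_sub_coB_lt {k k' l : ℝ} (hk : 0 ≤ k) (hkk : k < k') (hl : 0 < l)
    (h : k' * l < Real.pi) : coA k' l - coB k' l < coA k l - coB k l := by
  have hm : k * l < k' * l := mul_lt_mul_of_pos_right hkk hl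
  have h0 : 0 ≤ k * l := mul_nonneg hk hl.le
  rw [coA_sub_coB hk hl (by linarith), coA_sub_coB (by linarith) hl h, neg_lt_neg_iff]
  have ht : Real.tan (k * l / 2) < Real.tan (k' * l / 2) :=
    Real.tan_lt_tan_of_nonneg_of_lt_pi_div_two (by linarith) (by linarith) (by linarith)
  have ht0 : 0 ≤ Real.tan (k * l / 2) :=
    Real.tan_nonneg_of_nonneg_of_le_pi_div_two (by linarith) (by linarith)
  exact mul_lt_mul'' hkk ht hk ht0

/-- Strict concavity puts the sine above its chord from the origin, that is, `sin x / x` decreases.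
-/
theorem mul_sin_lt_mul_sin {a b : ℝ} (ha : 0 < a) (hab : a < b) (hb : b ≤ Real.pi) :
    a * Real.sin b < b * Real.sin a := by
  have hb0 : 0 < b := ha.trans hab
  have h0 : (0 : ℝ) ∈ Icc 0 Real.pi := ⟨le_rfl, Real.pi_pos.le⟩
  have hb' : b ∈ Icc 0 Real.pi := ⟨hb0.le, hb⟩
  have hp : 0 < 1 - a / b := by rw [sub_pos, div_lt_one hb0]; exact hab
  have hq : 0 < a / b := div_pos ha hb0
  have := strictConcaveOn_sin_Icc.2 h0 hb' hb0.ne hp hq (by ring)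
  simp only [Real.sin_zero, smul_eq_mul, mul_zero, zero_add, div_mul_cancel₀ _ hb0.ne'] at this
  rw [div_mul_eq_mul_div, div_lt_iff₀ hb0] at this
  linarith

theorem coA_add_coB_lt {k k' l : ℝ} (hk : 0 ≤ k) (hkk : k < k') (hl : 0 < l)
    (h : k' * l < Real.pi) : coA k' l + coB k' l < coA k l + coB k l := by
  have hm : k * l < k' * l := mul_lt_mul_of_pos_right hkk hl
  have h0 : 0 ≤ k * l := mul_nonneg hk hl.le
  have hk' : 0 < k' := hk.trans_lt hkk
  have hs' : 0 < Real.sin (k' * l / 2) :=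
    Real.sin_pos_of_pos_of_lt_pi (by linarith) (by linarith)
  rw [coA_add_coB hk' hl h]
  rcases hk.eq_or_lt with rfl | hk
  · have e : coA 0 l + coB 0 l = 2 / l := by
      simp [coA, coB, cosSol, sinSol]
      ring
    rw [e, ← mul_div_assoc, div_lt_div_iff₀ hs' hl]
    -- At `k = 0` the coefficient degenerates to `2 / l`, and the comparison becomes `x < tan x`.
    have h1 := Real.lt_tan (x := k' * l / 2) (by linarith) (by linarith)
    have hc : 0 < Real.cos (k' * l / 2) := Real.cos_pos_of_mem_Ioo ⟨by linarith, by linarith⟩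
    rw [Real.tan_eq_sin_div_cos, lt_div_iff₀ hc] at h1
    linarith
  · have hp : 0 < k * l := mul_pos hk hl
    have hs : 0 < Real.sin (k * l / 2) :=
      Real.sin_pos_of_pos_of_lt_pi (by linarith) (by linarith)
    rw [coA_add_coB hk hl (by linarith), ← mul_div_assoc, ← mul_div_assoc,
      div_lt_div_iff₀ hs' hs]
    -- Expanded by the addition theorems, the inequality for the difference and the sum of the two
    -- angles is the cross-multiplied claim.
    have h1 := mul_sin_lt_mul_sin (a := k' * l / 2 - k * l / 2) (b := k' * l / 2 + k * l / 2)
      (by linarith) (by linarith) (by linarith)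
    rw [Real.sin_add, Real.sin_sub] at h1
    have h2 : l * (k' * Real.cos (k' * l / 2) * Real.sin (k * l / 2)) <
        l * (k * Real.cos (k * l / 2) * Real.sin (k' * l / 2)) := by
      nlinarith [h1]
    exact lt_of_mul_lt_mul_left h2 hl.le

end EdgeCoefficients

namespace MetricGraph

/-! ### The discretised quadratic form. -/

section EdgeForm

variable {V E : Type*} (G : MetricGraph V E)

/-- The derivative at the start of the edge `e` of the solution of `-u'' = k² u` with prescribed
values at the two ends. -/
noncomputable def slopeStart (k : ℝ) (e : E) : (E → ℂ × ℂ) →ₗ[ℂ] ℂ where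
  toFun w := coB k (G.len e) * (w e).2 - coA k (G.len e) * (w e).1
  map_add' w z := by simp only [Pi.add_apply, Prod.fst_add, Prod.snd_add]; ring
  map_smul' c w := by
    simp only [Pi.smul_apply, Prod.smul_fst, Prod.smul_snd, smul_eq_mul, RingHom.id_apply]; ring

/-- The derivative at the end of the edge `e` of the solution of `-u'' = k² u` with prescribed
values at the two ends. -/
noncomputable def slopeEnd (k : ℝ) (e : E) : (E → ℂ × ℂ) →ₗ[ℂ] ℂ where
  toFun w := coA k (G.len e) * (w e).2 - coB k (G.len e) * (w e).1
  map_add' w z := by simp only [Pi.add_apply, Prod.fst_add, Prod.snd_add]; ring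
  map_smul' c w := by
    simp only [Pi.smul_apply, Prod.smul_fst, Prod.smul_snd, smul_eq_mul, RingHom.id_apply]; ring

/-- The Robin residual `u' - σ u` at the start of `e`. -/
noncomputable def fluxStart (k : ℝ) (σ : V → ℝ) (e : E) : (E → ℂ × ℂ) →ₗ[ℂ] ℂ :=
  G.slopeStart k e - (σ (G.src e) : ℂ) • (LinearMap.fst ℂ ℂ ℂ ∘ₗ LinearMap.proj e)

/-- The Robin residual `u' - σ u` at the end of `e`. -/
noncomputable def fluxEnd (k : ℝ) (σ : V → ℝ) (e : E) : (E → ℂ × ℂ) →ₗ[ℂ] ℂ :=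
  G.slopeEnd k e - (σ (G.tgt e) : ℂ) • (LinearMap.snd ℂ ℂ ℂ ∘ₗ LinearMap.proj e)

theorem slopeStart_apply (k : ℝ) (e : E) (w : E → ℂ × ℂ) :
    G.slopeStart k e w = coB k (G.len e) * (w e).2 - coA k (G.len e) * (w e).1 := rfl

theorem slopeEnd_apply (k : ℝ) (e : E) (w : E → ℂ × ℂ) :
    G.slopeEnd k e w = coA k (G.len e) * (w e).2 - coB k (G.len e) * (w e).1 := rfl

theorem fluxStart_apply (k : ℝ) (σ : V → ℝ) (e : E) (w : E → ℂ × ℂ) :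
    G.fluxStart k σ e w = G.slopeStart k e w - σ (G.src e) * (w e).1 := rfl

theorem fluxEnd_apply (k : ℝ) (σ : V → ℝ) (e : E) (w : E → ℂ × ℂ) :
    G.fluxEnd k σ e w = G.slopeEnd k e w - σ (G.tgt e) * (w e).2 := rfl

theorem fluxStart_zero (k : ℝ) (e : E) : G.fluxStart k 0 e = G.slopeStart k e := by
  ext w : 1
  simp [fluxStart_apply]

theorem fluxEnd_zero (k : ℝ) (e : E) : G.fluxEnd k 0 e = G.slopeEnd k e := by
  ext w : 1
  simp [fluxEnd_apply]

variable [Fintype E]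

/-- The form `∑ₑ ∫ (z̄' w' - k² z̄ w)` with Robin terms, on functions that solve `-u'' = k² u` on the
edges and are represented by their values at the two ends of each edge. -/
noncomputable def edgeForm (k : ℝ) (σ : V → ℝ) : (E → ℂ × ℂ) →ₗ⋆[ℂ] (E → ℂ × ℂ) →ₗ[ℂ] ℂ :=
  LinearMap.mk₂'ₛₗ (starRingEnd ℂ) (RingHom.id ℂ)
    (fun z w => ∑ e, ((starRingEnd ℂ) (z e).2 * G.fluxEnd k σ e w -
      (starRingEnd ℂ) (z e).1 * G.fluxStart k σ e w))
    (fun x y z => by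
      rw [← Finset.sum_add_distrib]
      refine Finset.sum_congr rfl fun e _ => ?_
      simp only [Pi.add_apply, Prod.fst_add, Prod.snd_add, map_add]
      ring)
    (fun c x y => by
      rw [smul_eq_mul, Finset.mul_sum]
      refine Finset.sum_congr rfl fun e _ => ?_
      simp only [Pi.smul_apply, Prod.smul_fst, Prod.smul_snd, smul_eq_mul, map_mul]
      ring)
    (fun x y z => by
      rw [← Finset.sum_add_distrib]
      refine Finset.sum_congr rfl fun e _ => ?_
      simp only [map_add]
      ring)
    (fun c x y => by
      rw [smul_eq_mul, Finset.mul_sum]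
      refine Finset.sum_congr rfl fun e _ => ?_
      simp only [map_smul, smul_eq_mul, RingHom.id_apply]
      ring)

theorem edgeForm_apply (k : ℝ) (σ : V → ℝ) (z w : E → ℂ × ℂ) :
    G.edgeForm k σ z w = ∑ e, ((starRingEnd ℂ) (z e).2 * G.fluxEnd k σ e w -
      (starRingEnd ℂ) (z e).1 * G.fluxStart k σ e w) := rfl

theorem edgeForm_isSymm (k : ℝ) (σ : V → ℝ) : (G.edgeForm k σ).IsSymm := by
  refine ⟨fun z w => ?_⟩
  rw [edgeForm_apply, edgeForm_apply, map_sum]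
  refine Finset.sum_congr rfl fun e _ => ?_
  simp only [fluxStart_apply, fluxEnd_apply, slopeStart_apply, slopeEnd_apply, map_sub, map_mul,
    Complex.conj_conj, Complex.conj_ofReal]
  ring

/-- Sum and difference of the end values diagonalise each two by two block, so that `k` enters only
through the two monotone coefficients. -/
theorem edgeForm_self_re (k : ℝ) (σ : V → ℝ) (w : E → ℂ × ℂ) :
    (G.edgeForm k σ w w).re = ∑ e,
      ((coA k (G.len e) - coB k (G.len e)) / 2 * ‖(w e).1 + (w e).2‖ ^ 2 +
        (coA k (G.len e) + coB k (G.len e)) / 2 * ‖(w e).1 - (w e).2‖ ^ 2 -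
        σ (G.tgt e) * ‖(w e).2‖ ^ 2 + σ (G.src e) * ‖(w e).1‖ ^ 2) := by
  rw [edgeForm_apply, Complex.re_sum]
  refine Finset.sum_congr rfl fun e _ => ?_
  simp only [fluxStart_apply, fluxEnd_apply, slopeStart_apply, slopeEnd_apply,
    ← Complex.normSq_eq_norm_sq, Complex.normSq_apply, Complex.add_re, Complex.add_im,
    Complex.sub_re, Complex.sub_im, Complex.mul_re, Complex.mul_im, Complex.conj_re,
    Complex.conj_im, Complex.ofReal_re, Complex.ofReal_im]
  ring

/-- Both coefficients decrease strictly, and on an edge where `w` is not zero the sum or the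
difference of its end values is not zero. -/
theorem edgeForm_strictAnti (σ : V → ℝ) {k k' : ℝ} (hk : 0 ≤ k) (hkk : k < k')
    (h : ∀ e, k' * G.len e < Real.pi) {w : E → ℂ × ℂ} (hw : w ≠ 0) :
    (G.edgeForm k' σ w w).re < (G.edgeForm k σ w w).re := by
  rw [edgeForm_self_re, edgeForm_self_re]
  have h1 : ∀ e, coA k' (G.len e) - coB k' (G.len e) < coA k (G.len e) - coB k (G.len e) :=
    fun e => coA_sub_coB_lt hk hkk (G.len_pos e) (h e)
  have h2 : ∀ e, coA k' (G.len e) + coB k' (G.len e) < coA k (G.len e) + coB k (G.len e) :=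
    fun e => coA_add_coB_lt hk hkk (G.len_pos e) (h e)
  obtain ⟨e₀, he₀⟩ : ∃ e, w e ≠ 0 := Function.ne_iff.1 hw
  refine Finset.sum_lt_sum (fun e _ => ?_) ⟨e₀, Finset.mem_univ _, ?_⟩
  · have e1 := mul_le_mul_of_nonneg_right (h1 e).le (sq_nonneg ‖(w e).1 + (w e).2‖)
    have e2 := mul_le_mul_of_nonneg_right (h2 e).le (sq_nonneg ‖(w e).1 - (w e).2‖)
    linarith
  · have e1 := mul_le_mul_of_nonneg_right (h1 e₀).le (sq_nonneg ‖(w e₀).1 + (w e₀).2‖)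
    have e2 := mul_le_mul_of_nonneg_right (h2 e₀).le (sq_nonneg ‖(w e₀).1 - (w e₀).2‖)
    by_cases hp : (w e₀).1 + (w e₀).2 = 0
    · have hm : (w e₀).1 - (w e₀).2 ≠ 0 := by
        intro hm
        apply he₀
        have a1 : (w e₀).1 = 0 := by linear_combination (hp + hm) / 2
        have a2 : (w e₀).2 = 0 := by linear_combination (hp - hm) / 2
        exact Prod.ext a1 a2
      have e3 := mul_lt_mul_of_pos_right (h2 e₀)
        (show 0 < ‖(w e₀).1 - (w e₀).2‖ ^ 2 by positivity)
      linarith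
    · have e3 := mul_lt_mul_of_pos_right (h1 e₀)
        (show 0 < ‖(w e₀).1 + (w e₀).2‖ ^ 2 by positivity)
      linarith

theorem continuousAt_edgeForm (σ : V → ℝ) {k : ℝ} (hk : 0 ≤ k)
    (h : ∀ e, k * G.len e < Real.pi) (w : E → ℂ × ℂ) :
    ContinuousAt (fun p : ℝ × (E → ℂ × ℂ) => (G.edgeForm p.1 σ p.2 p.2).re) (k, w) := by
  simp only [edgeForm_self_re]
  refine tendsto_finsetSum _ fun e _ => ?_
  have hs := (sinSol_pos hk (G.len_pos e) (h e)).ne'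
  have hS : ContinuousAt (fun p : ℝ × (E → ℂ × ℂ) => sinSol p.1 (G.len e)) (k, w) := by
    have : Continuous fun p : ℝ × (E → ℂ × ℂ) => sinSol p.1 (G.len e) := by
      unfold sinSol
      exact continuous_const.mul (Real.continuous_sinc.comp (continuous_fst.mul continuous_const))
    exact this.continuousAt
  have hC : ContinuousAt (fun p : ℝ × (E → ℂ × ℂ) => cosSol p.1 (G.len e)) (k, w) := by
    have : Continuous fun p : ℝ × (E → ℂ × ℂ) => cosSol p.1 (G.len e) := by
      unfold cosSol
      fun_prop
    exact this.continuousAt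
  have hA : ContinuousAt (fun p : ℝ × (E → ℂ × ℂ) => coA p.1 (G.len e)) (k, w) := hC.div hS hs
  have hB : ContinuousAt (fun p : ℝ × (E → ℂ × ℂ) => coB p.1 (G.len e)) (k, w) :=
    continuousAt_const.div hS hs
  have h1 : ContinuousAt (fun p : ℝ × (E → ℂ × ℂ) => (p.2 e).1) (k, w) := by fun_prop
  have h2 : ContinuousAt (fun p : ℝ × (E → ℂ × ℂ) => (p.2 e).2) (k, w) := by fun_prop
  exact ((((hA.sub hB).div_const 2).mul ((h1.add h2).norm.pow 2)).add
    (((hA.add hB).div_const 2).mul ((h1.sub h2).norm.pow 2))).sub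
      (continuousAt_const.mul (h2.norm.pow 2)) |>.add (continuousAt_const.mul (h1.norm.pow 2))

variable {G}

/-- At `k = 0` the form is `∑ₑ |w₁ - w₂|² / lₑ`. This starts the eigenvalue count at index zero. -/
theorem edgeForm_zero_nonneg (w : E → ℂ × ℂ) : 0 ≤ (G.edgeForm 0 0 w w).re := by
  rw [edgeForm_self_re]
  refine Finset.sum_nonneg fun e _ => ?_
  have hl := G.len_pos e
  have e1 : coA 0 (G.len e) - coB 0 (G.len e) = 0 := by simp [coA, coB, cosSol, sinSol]
  have e2 : coA 0 (G.len e) + coB 0 (G.len e) = 2 / G.len e := by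
    simp [coA, coB, cosSol, sinSol]
    ring
  rw [e1, e2]
  simp only [Pi.zero_apply]
  have : 0 ≤ 2 / G.len e / 2 * ‖(w e).1 - (w e).2‖ ^ 2 := by positivity
  linarith

end EdgeForm

/-! ### Spaces of end values and their orthogonal complements. -/

section Spaces

variable {V E : Type*} (G : MetricGraph V E)

/-- End values that are continuous at all vertices outside `B`. -/
def contSpace (B : Set V) : Submodule ℂ (E → ℂ × ℂ) where
  carrier := {w | ∀ v ∉ B, ∃ a : ℂ, (∀ e, G.src e = v → (w e).1 = a) ∧
    ∀ e, G.tgt e = v → (w e).2 = a}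
  add_mem' := by
    intro w z hw hz v hv
    obtain ⟨a, ha, ha'⟩ := hw v hv
    obtain ⟨b, hb, hb'⟩ := hz v hv
    refine ⟨a + b, fun e he => ?_, fun e he => ?_⟩
    · rw [Pi.add_apply, Prod.fst_add, ha e he, hb e he]
    · rw [Pi.add_apply, Prod.snd_add, ha' e he, hb' e he]
  zero_mem' := fun v _ => ⟨0, fun _ _ => rfl, fun _ _ => rfl⟩
  smul_mem' := by
    intro c w hw v hv
    obtain ⟨a, ha, ha'⟩ := hw v hv
    refine ⟨c * a, fun e he => ?_, fun e he => ?_⟩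
    · rw [Pi.smul_apply, Prod.smul_fst, ha e he, smul_eq_mul]
    · rw [Pi.smul_apply, Prod.smul_snd, ha' e he, smul_eq_mul]

/-- End values that vanish at the vertices in `B`. -/
def vanishOn (B : Set V) : Submodule ℂ (E → ℂ × ℂ) where
  carrier := {w | (∀ e, G.src e ∈ B → (w e).1 = 0) ∧ ∀ e, G.tgt e ∈ B → (w e).2 = 0}
  add_mem' := by
    rintro w z ⟨hw, hw'⟩ ⟨hz, hz'⟩
    refine ⟨fun e he => ?_, fun e he => ?_⟩
    · rw [Pi.add_apply, Prod.fst_add, hw e he, hz e he, add_zero]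
    · rw [Pi.add_apply, Prod.snd_add, hw' e he, hz' e he, add_zero]
  zero_mem' := ⟨fun _ _ => rfl, fun _ _ => rfl⟩
  smul_mem' := by
    rintro c w ⟨hw, hw'⟩
    refine ⟨fun e he => ?_, fun e he => ?_⟩
    · rw [Pi.smul_apply, Prod.smul_fst, hw e he, smul_zero]
    · rw [Pi.smul_apply, Prod.smul_snd, hw' e he, smul_zero]

variable {G}

theorem contSpace_mono {B B' : Set V} (h : B ⊆ B') : G.contSpace B ≤ G.contSpace B' :=
  fun _ hw v hv => hw v fun hvB => hv (h hvB)

variable [Fintype E]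

/-- Flux balance is the natural boundary condition of the form. Testing with the indicator of a
vertex outside `B` gives the balance there; conversely `sum_ends` leaves only vertices at which the
test function vanishes. -/
theorem mem_formOrth_vanishOn_iff {k : ℝ} {σ : V → ℝ} {B : Finset V} {w : E → ℂ × ℂ} :
    w ∈ formOrth (G.edgeForm k σ) (G.contSpace ∅ ⊓ G.vanishOn B) ↔
      ∀ v ∉ B, ∑ e ∈ Finset.univ.filter (fun e => G.src e = v), G.fluxStart k σ e w =
        ∑ e ∈ Finset.univ.filter (fun e => G.tgt e = v), G.fluxEnd k σ e w := by
  constructor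
  · intro hw v hv
    let z : E → ℂ × ℂ := fun e => (if G.src e = v then 1 else 0, if G.tgt e = v then 1 else 0)
    have hz : z ∈ G.contSpace ∅ ⊓ G.vanishOn B := by
      refine ⟨fun v' _ => ⟨if v' = v then 1 else 0, ?_, ?_⟩, ?_, ?_⟩
      · rintro e rfl; rfl
      · rintro e rfl; rfl
      · intro e he
        have : G.src e ≠ v := fun h => hv (h ▸ he)
        simp [z, this]
      · intro e he
        have : G.tgt e ≠ v := fun h => hv (h ▸ he)
        simp [z, this]
    have := hw z hz
    rw [edgeForm_apply, Finset.sum_sub_distrib, sub_eq_zero] at this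
    simp only [z, apply_ite (starRingEnd ℂ), map_one, map_zero, ite_mul, one_mul, zero_mul] at this
    rw [← Finset.sum_filter, ← Finset.sum_filter] at this
    exact this.symm
  · rintro hw z ⟨hz, hz0, hz1⟩
    rw [edgeForm_apply, G.sum_ends (fun e => (starRingEnd ℂ) (z e).1 * G.fluxStart k σ e w)
      (fun e => (starRingEnd ℂ) (z e).2 * G.fluxEnd k σ e w) B]
    · refine Finset.sum_eq_zero fun v hv => ?_
      rw [Finset.sum_eq_zero, Finset.sum_eq_zero, sub_zero]
      · intro e he
        rw [hz0 e ((Finset.mem_filter.1 he).2 ▸ hv), map_zero, zero_mul]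
      · intro e he
        rw [hz1 e ((Finset.mem_filter.1 he).2 ▸ hv), map_zero, zero_mul]
    · intro v hv
      obtain ⟨a, ha, ha'⟩ := hz v (by simp)
      have h0 : ∀ e ∈ Finset.univ.filter (fun e => G.src e = v),
          (starRingEnd ℂ) (z e).1 * G.fluxStart k σ e w =
            (starRingEnd ℂ) a * G.fluxStart k σ e w := fun e he => by
        rw [ha e (Finset.mem_filter.1 he).2]
      have h1 : ∀ e ∈ Finset.univ.filter (fun e => G.tgt e = v),
          (starRingEnd ℂ) (z e).2 * G.fluxEnd k σ e w =
            (starRingEnd ℂ) a * G.fluxEnd k σ e w := fun e he => by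
        rw [ha' e (Finset.mem_filter.1 he).2]
      rw [Finset.sum_congr rfl h0, Finset.sum_congr rfl h1, ← Finset.mul_sum, ← Finset.mul_sum,
        hw v hv]

theorem mem_formOrth_contSpace_empty_iff {k : ℝ} {σ : V → ℝ} {w : E → ℂ × ℂ} :
    w ∈ formOrth (G.edgeForm k σ) (G.contSpace ∅) ↔
      ∀ v, ∑ e ∈ Finset.univ.filter (fun e => G.src e = v), G.fluxStart k σ e w =
        ∑ e ∈ Finset.univ.filter (fun e => G.tgt e = v), G.fluxEnd k σ e w := by
  have h : G.contSpace ∅ ⊓ G.vanishOn ((∅ : Finset V) : Set V) = G.contSpace ∅ := by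
    refine inf_eq_left.2 fun w _ => ?_
    exact ⟨fun e he => by simp at he, fun e he => by simp at he⟩
  rw [← h, mem_formOrth_vanishOn_iff]
  simp

/-- At a vertex of `B` the values on different edge ends are independent, so a test function
supported at a single end is allowed. -/
theorem flux_eq_zero_of_mem_formOrth {k : ℝ} {σ : V → ℝ} {B : Set V} {w : E → ℂ × ℂ}
    (hw : w ∈ formOrth (G.edgeForm k σ) (G.contSpace B)) :
    (∀ e, G.src e ∈ B → G.fluxStart k σ e w = 0) ∧ ∀ e, G.tgt e ∈ B → G.fluxEnd k σ e w = 0 := by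
  constructor
  · intro e he
    let z : E → ℂ × ℂ := fun e' => (if e' = e then 1 else 0, 0)
    have hz : z ∈ G.contSpace B := by
      refine fun v hv => ⟨0, fun e' he' => ?_, fun e' he' => rfl⟩
      have : e' ≠ e := by
        rintro rfl
        exact hv (he' ▸ he)
      simp [z, this]
    have := hw z hz
    simpa [edgeForm_apply, z, apply_ite (starRingEnd ℂ)] using this
  · intro e he
    let z : E → ℂ × ℂ := fun e' => (0, if e' = e then 1 else 0)
    have hz : z ∈ G.contSpace B := by
      refine fun v hv => ⟨0, fun e' he' => rfl, fun e' he' => ?_⟩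
      have : e' ≠ e := by
        rintro rfl
        exact hv (he' ▸ he)
      simp [z, this]
    have := hw z hz
    simpa [edgeForm_apply, z, apply_ite (starRingEnd ℂ)] using this

end Spaces

end MetricGraph

namespace MetricGraph

/-! ### Counting eigenvalues by the index. -/

section Counting

open Module Filter Topology

variable {V E : Type*} {G : MetricGraph V E} [Fintype E]

theorem eventually_short {k₀ : ℝ} (h : ∀ e, k₀ * G.len e < Real.pi) :
    ∀ᶠ k in 𝓝 k₀, ∀ e, k * G.len e < Real.pi := by
  rw [eventually_all]
  intro e
  have : ContinuousAt (fun k : ℝ => k * G.len e) k₀ := by fun_prop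
  exact this.eventually (gt_mem_nhds (h e))

theorem edgeForm_negIndex_eventually_right (σ : V → ℝ) {k₀ : ℝ} (hk : 0 ≤ k₀)
    (h : ∀ e, k₀ * G.len e < Real.pi) (Y : Submodule ℂ (E → ℂ × ℂ)) :
    ∀ᶠ k in 𝓝[>] k₀, negIndex (G.edgeForm k σ) Y =
        negIndex (G.edgeForm k₀ σ) Y + finrank ℂ (formRadical (G.edgeForm k₀ σ) Y) ∧
      formRadical (G.edgeForm k σ) Y = ⊥ := by
  refine negIndex_eventually_right (Q := fun k => G.edgeForm k σ)
    (fun k => G.edgeForm_isSymm k σ) (G.continuousAt_edgeForm σ hk h) ?_ Y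
  filter_upwards [self_mem_nhdsWithin, nhdsWithin_le_nhds (eventually_short h)] with k h1 h2 w hw
  exact G.edgeForm_strictAnti σ hk h1 h2 hw

theorem edgeForm_negIndex_eventually_left (σ : V → ℝ) {k₀ : ℝ} (hk : 0 < k₀)
    (h : ∀ e, k₀ * G.len e < Real.pi) (Y : Submodule ℂ (E → ℂ × ℂ)) :
    ∀ᶠ k in 𝓝[<] k₀, negIndex (G.edgeForm k σ) Y = negIndex (G.edgeForm k₀ σ) Y ∧
      formRadical (G.edgeForm k σ) Y = ⊥ := by
  refine negIndex_eventually_left (Q := fun k => G.edgeForm k σ)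
    (fun k => G.edgeForm_isSymm k σ) (G.continuousAt_edgeForm σ hk.le h) ?_ Y
  filter_upwards [self_mem_nhdsWithin, nhdsWithin_le_nhds (lt_mem_nhds hk)] with k h1 h2 w hw
  exact G.edgeForm_strictAnti σ h2.le h1 h hw

variable {X : Type*} [AddCommGroup X] [Module ℂ X] {F : ℝ → Submodule ℂ X}

theorem iSup_Iio_sup (c : ℝ) : (⨆ μ : Iio c, F μ) ⊔ F c = ⨆ μ : Iic c, F μ := by
  apply le_antisymm
  · refine sup_le (iSup_le fun μ => ?_) ?_
    · exact le_iSup (fun μ : Iic c => F μ) ⟨μ, (mem_Iio.1 μ.2).le⟩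
    · exact le_iSup (fun μ : Iic c => F μ) ⟨c, mem_Iic.2 le_rfl⟩
  · refine iSup_le fun μ => ?_
    rcases (mem_Iic.1 μ.2).lt_or_eq with h | h
    · exact le_sup_of_le_left (le_iSup (fun μ : Iio c => F μ) ⟨μ, h⟩)
    · rw [h]; exact le_sup_right

theorem iSup_Iio_eq_of_bot {a c : ℝ} (hac : a ≤ c) (h : ∀ μ, a ≤ μ → μ < c → F μ = ⊥) :
    (⨆ μ : Iio c, F μ) = ⨆ μ : Iio a, F μ := by
  apply le_antisymm
  · refine iSup_le fun μ => ?_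
    rcases lt_or_ge (μ : ℝ) a with h1 | h1
    · exact le_iSup (fun μ : Iio a => F μ) ⟨μ, h1⟩
    · rw [h μ h1 μ.2]; exact bot_le
  · exact iSup_le fun μ =>
      le_iSup (fun μ : Iio c => F μ) ⟨μ, (mem_Iio.1 μ.2).trans_le hac⟩

theorem iSup_Iio_eq_of_bot' {a c : ℝ} (hac : a < c) (h : ∀ μ, a < μ → μ < c → F μ = ⊥) :
    (⨆ μ : Iio c, F μ) = (⨆ μ : Iio a, F μ) ⊔ F a := by
  apply le_antisymm
  · refine iSup_le fun μ => ?_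
    rcases lt_trichotomy (μ : ℝ) a with h1 | h1 | h1
    · exact le_sup_of_le_left (le_iSup (fun μ : Iio a => F μ) ⟨μ, h1⟩)
    · rw [h1]; exact le_sup_right
    · rw [h μ h1 μ.2]; exact bot_le
  · refine sup_le (iSup_le fun μ => ?_) ?_
    · exact le_iSup (fun μ : Iio c => F μ) ⟨μ, (mem_Iio.1 μ.2).trans hac⟩
    · exact le_iSup (fun μ : Iio c => F μ) ⟨a, hac⟩

theorem finrank_iSup_Iio_sup (hF : iSupIndep F) (c : ℝ)
    [FiniteDimensional ℂ (⨆ μ : Iio c, F μ : Submodule ℂ X)] [FiniteDimensional ℂ (F c)] :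
    finrank ℂ ((⨆ μ : Iio c, F μ) ⊔ F c : Submodule ℂ X) =
      finrank ℂ (⨆ μ : Iio c, F μ : Submodule ℂ X) + finrank ℂ (F c) := by
  have hle : (⨆ μ : Iio c, F μ) ≤ ⨆ (μ) (_ : μ ≠ c), F μ :=
    iSup_le fun μ => le_iSup₂_of_le (μ : ℝ) (mem_Iio.1 μ.2).ne le_rfl
  have hd : (⨆ μ : Iio c, F μ) ⊓ F c = ⊥ :=
    disjoint_iff.1 ((hF c).symm.mono_left hle)
  have := Submodule.finrank_sup_add_finrank_inf_eq (⨆ μ : Iio c, F μ) (F c)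
  rwa [hd, finrank_bot, add_zero] at this

theorem eventually_Icc {K k₀ : ℝ} {p : ℝ → Prop} (h0 : p k₀)
    (hr : ∀ᶠ k in 𝓝[>] k₀, k ≤ K → p k) (hl : ∀ᶠ k in 𝓝[<] k₀, 0 ≤ k → p k) :
    ∀ᶠ k in 𝓝[Icc 0 K] k₀, p k := by
  rw [eventually_nhdsWithin_iff] at hr hl ⊢
  filter_upwards [hr, hl] with k h1 h2 hk
  rcases lt_trichotomy k k₀ with h | h | h
  · exact h2 h hk.1
  · rwa [h]
  · exact h1 h hk.2

/-- If the eigenspace `F (k²)` has the dimension of the radical of the form `edgeForm k 0` on `Y`,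
then the number of eigenvalues `≤ k₀²` is the negative index of `edgeForm k 0` on `Y` for `k`
slightly larger than `k₀`. -/
theorem negIndex_eq_finrank_iSup (Y : Submodule ℂ (E → ℂ × ℂ)) (hF : iSupIndep F)
    (hneg : ∀ c < 0, F c = ⊥) {K : ℝ} (hK : ∀ e, K * G.len e < Real.pi)
    (hfin : ∀ k ∈ Icc 0 K, FiniteDimensional ℂ (F (k ^ 2)))
    (hdim : ∀ k ∈ Icc 0 K,
      finrank ℂ (F (k ^ 2)) = finrank ℂ (formRadical (G.edgeForm k 0) Y))
    {k₀ : ℝ} (hk₀ : k₀ ∈ Icc 0 K) :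
    ∀ᶠ k in 𝓝[>] k₀,
      negIndex (G.edgeForm k 0) Y = finrank ℂ (⨆ μ : Iic (k₀ ^ 2), F μ : Submodule ℂ X) := by
  let W : ℝ → Submodule ℂ X := fun k => ⨆ μ : Iio (k ^ 2), F μ
  -- The eigenvalues strictly below `k²` are counted correctly at `k`. Finite dimensionality is part
  -- of the claim, because `finrank` is zero for infinite dimensional spaces.
  let S : ℝ → Prop := fun k =>
    FiniteDimensional ℂ (W k) ∧ finrank ℂ (W k) = negIndex (G.edgeForm k 0) Y
  have hshort : ∀ k ∈ Icc 0 K, ∀ e, k * G.len e < Real.pi := fun k hk e =>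
    (mul_le_mul_of_nonneg_right hk.2 (G.len_pos e).le).trans_lt (hK e)
  have hbot : ∀ k ∈ Icc 0 K, formRadical (G.edgeForm k 0) Y = ⊥ → F (k ^ 2) = ⊥ := by
    intro k hk h
    have := hfin k hk
    rw [← Submodule.finrank_eq_zero (R := ℂ), hdim k hk, h, finrank_bot]
  have hsq : ∀ {a b μ : ℝ}, 0 ≤ a → 0 ≤ b → a ^ 2 < μ → μ < b ^ 2 → a < √μ ∧ √μ < b := by
    intro a b μ ha hb h1 h2
    exact ⟨Real.lt_sqrt ha |>.2 h1, (Real.sqrt_lt' (lt_of_le_of_ne hb (by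
      rintro rfl
      nlinarith [sq_nonneg a]))).2 h2⟩
  -- Just to the right of `k₁` the radical is trivial, so only the eigenspace of `k₁²` is added to
  -- the count. The index jumps by the radical at `k₁`, which has the same dimension.
  have hright : ∀ k₁ ∈ Icc 0 K, ∀ᶠ k in 𝓝[>] k₁, k ≤ K → (S k ↔ S k₁) := by
    intro k₁ hk₁
    have h1 := edgeForm_negIndex_eventually_right 0 hk₁.1 (hshort k₁ hk₁) Y
    obtain ⟨δ, hδ, h2⟩ := mem_nhdsGT_iff_exists_Ioo_subset.1 h1
    filter_upwards [Ioo_mem_nhdsGT hδ] with k hk hkK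
    have hW : W k = W k₁ ⊔ F (k₁ ^ 2) := by
      refine iSup_Iio_eq_of_bot' (by nlinarith [hk.1, hk₁.1]) fun μ h3 h4 => ?_
      have h5 := hsq hk₁.1 (hk₁.1.trans hk.1.le) h3 h4
      have h6 : √μ ^ 2 = μ := Real.sq_sqrt ((sq_nonneg k₁).trans h3.le)
      rw [← h6]
      exact hbot _ ⟨Real.sqrt_nonneg _, h5.2.le.trans hkK⟩ (h2 ⟨h5.1, h5.2.trans hk.2⟩).2
    have hf := hfin k₁ hk₁
    have hi := (h2 hk).1
    constructor
    · rintro ⟨ha, hb⟩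
      have ha' : FiniteDimensional ℂ (W k₁) := by
        rw [hW] at ha
        exact Submodule.finiteDimensional_of_le (le_sup_left : W k₁ ≤ W k₁ ⊔ F (k₁ ^ 2))
      refine ⟨ha', ?_⟩
      rw [hW, finrank_iSup_Iio_sup hF, hi, hdim k₁ hk₁] at hb
      exact Nat.add_right_cancel hb
    · rintro ⟨ha, hb⟩
      refine ⟨by rw [hW]; infer_instance, ?_⟩
      rw [hW, finrank_iSup_Iio_sup hF, hi, hdim k₁ hk₁, ← hb]
  -- Just to the left of `k₁` there is no eigenvalue, and the index is that of `k₁`.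
  have hleft : ∀ k₁ ∈ Icc 0 K, ∀ᶠ k in 𝓝[<] k₁, 0 ≤ k → (S k ↔ S k₁) := by
    intro k₁ hk₁
    rcases hk₁.1.eq_or_lt with rfl | hpos
    · filter_upwards [self_mem_nhdsWithin] with k h1 h2
      exact absurd h2 (not_le.2 h1)
    have h1 := edgeForm_negIndex_eventually_left 0 hpos (hshort k₁ hk₁) Y
    obtain ⟨δ, hδ, h2⟩ := mem_nhdsLT_iff_exists_Ioo_subset.1 h1
    filter_upwards [Ioo_mem_nhdsLT hδ] with k hk hk0
    have hW : W k₁ = W k := by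
      refine iSup_Iio_eq_of_bot (by nlinarith [hk.2]) fun μ h3 h4 => ?_
      have h6 : √μ ^ 2 = μ := Real.sq_sqrt ((sq_nonneg k).trans h3)
      have h5 : √μ < k₁ := (Real.sqrt_lt' hpos).2 h4
      have h7 : k ≤ √μ := Real.le_sqrt_of_sq_le h3
      rw [← h6]
      exact hbot _ ⟨Real.sqrt_nonneg _, h5.le.trans hk₁.2⟩ (h2 ⟨hk.1.trans_le h7, h5⟩).2
    have hi := (h2 hk).1
    change (FiniteDimensional ℂ (W k) ∧ finrank ℂ (W k) = _) ↔
      (FiniteDimensional ℂ (W k₁) ∧ finrank ℂ (W k₁) = _)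
    rw [hi, hW]
  -- The truth value of `S` is locally constant on the interval, hence constant. It is decided at `k
  -- = 0`, where both counts are zero.
  have hcont : ContinuousOn (fun k => decide (S k)) (Icc 0 K) := by
    intro k₁ hk₁
    refine tendsto_nhds_of_eventually_eq ?_
    have : ∀ᶠ k in 𝓝[Icc 0 K] k₁, (S k ↔ S k₁) :=
      eventually_Icc Iff.rfl (hright k₁ hk₁) (hleft k₁ hk₁)
    filter_upwards [this] with k hk
    simp [hk]
  have h00 : S 0 := by
    have hW : W 0 = ⊥ := by
      refine iSup_eq_bot.2 fun μ => hneg μ ?_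
      have := mem_Iio.1 μ.2
      simpa using this
    have hn : negIndex (G.edgeForm 0 0) Y = 0 := by
      have := negIndex_add_finrank_le (Q := G.edgeForm 0 0) (le_refl Y)
        fun w _ => edgeForm_zero_nonneg w
      omega
    refine ⟨by rw [hW]; infer_instance, by rw [hW, hn, finrank_bot]⟩
  have hS : S k₀ := by
    have := isPreconnected_Icc.constant hcont (x := 0) (y := k₀)
      ⟨le_rfl, hk₀.1.trans hk₀.2⟩ hk₀
    simpa [h00] using this
  filter_upwards [edgeForm_negIndex_eventually_right 0 hk₀.1 (hshort k₀ hk₀) Y] with k hk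
  obtain ⟨ha, hb⟩ := hS
  have := hfin k₀ hk₀
  rw [hk.1, ← iSup_Iio_sup, finrank_iSup_Iio_sup hF, ← hb, hdim k₀ hk₀]

end Counting

end MetricGraph

/-! ### The transfer matrix of `-u'' = k² u`. -/

section Evolution

theorem cosSol_add (k x y : ℝ) :
    cosSol k (x + y) = cosSol k x * cosSol k y - k ^ 2 * sinSol k x * sinSol k y := by
  have h := Real.cos_add (k * x) (k * y)
  rw [← mul_sinSol, ← mul_sinSol] at h
  simp only [cosSol]
  rw [mul_add, h]
  ring

theorem sinSol_add (k x y : ℝ) :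
    sinSol k (x + y) = sinSol k x * cosSol k y + cosSol k x * sinSol k y := by
  by_cases hk : k = 0
  · subst hk
    simp [sinSol, cosSol]
  · have h := Real.sin_add (k * x) (k * y)
    rw [← mul_add, ← mul_sinSol, ← mul_sinSol, ← mul_sinSol] at h
    apply mul_left_cancel₀ hk
    rw [h, cosSol, cosSol]
    ring

/-- The evolution over the distance `x` of the pair `(u, u')` of a solution of `-u'' = k² u`. -/
noncomputable def evolve (k x : ℝ) (p : ℂ × ℂ) : ℂ × ℂ :=
  (cosSol k x * p.1 + sinSol k x * p.2, cosSol k x * p.2 - k ^ 2 * sinSol k x * p.1)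

theorem evolve_add (k x y : ℝ) (p : ℂ × ℂ) :
    evolve k (x + y) p = evolve k x (evolve k y p) := by
  ext
  · simp only [evolve, cosSol_add, sinSol_add]
    push_cast
    ring
  · simp only [evolve, cosSol_add, sinSol_add]
    push_cast
    ring

@[simp]
theorem evolve_zero (k : ℝ) (p : ℂ × ℂ) : evolve k 0 p = p := by
  simp [evolve]

end Evolution

namespace MetricGraph

/-! ### Values and derivatives along an edge. -/

section States

variable {V E : Type*} {G : MetricGraph V E}

/-- The pair `(u, u')` at the point `x` of the edge `e`. -/
noncomputable def state (u : G.H2) (e : E) (x : ℝ) : ℂ × ℂ :=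
  (u.1 e x, derivWithin (u.1 e) (Icc 0 (G.len e)) x)

theorem state_eq_evolve {k : ℝ} {u : G.H2} (hu : u ∈ G.helmholtz (k ^ 2)) (e : E) {x : ℝ}
    (hx : x ∈ Icc 0 (G.len e)) : state u e x = evolve k x (state u e 0) := by
  have h := val_der_eq hu e ⟨x, hx⟩
  exact Prod.ext h.1 h.2

theorem state_eq_evolve_sub {k : ℝ} {u : G.H2} (hu : u ∈ G.helmholtz (k ^ 2)) (e : E) {x y : ℝ}
    (hx : x ∈ Icc 0 (G.len e)) (hy : y ∈ Icc 0 (G.len e)) :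
    state u e y = evolve k (y - x) (state u e x) := by
  rw [state_eq_evolve hu e hy, state_eq_evolve hu e hx, ← evolve_add, sub_add_cancel]

theorem state_sol (k : ℝ) (d : E → ℂ × ℂ) (e : E) {x : ℝ} (hx : x ∈ Icc 0 (G.len e)) :
    state (G.sol k d) e x = evolve k x (d e) :=
  Prod.ext (val_sol k d e ⟨x, hx⟩) (der_sol k d e ⟨x, hx⟩)

theorem eq_of_state_zero_eq {k : ℝ} {u v : G.H2} (hu : u ∈ G.helmholtz (k ^ 2))
    (hv : v ∈ G.helmholtz (k ^ 2)) (h : ∀ e, state u e 0 = state v e 0) : u = v := by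
  apply H2_ext
  intro e x
  have := state_eq_evolve hu e x.2
  rw [h e, ← state_eq_evolve hv e x.2] at this
  exact congrArg Prod.fst this

/-- The pair `(u, u')` at the start of an edge, in terms of the end values. -/
noncomputable def startState (G : MetricGraph V E) (k : ℝ) (w : E → ℂ × ℂ) (e : E) : ℂ × ℂ :=
  ((w e).1, G.slopeStart k e w)

/-- The pair `(u, u')` at the end of an edge, in terms of the end values. -/
noncomputable def endState (G : MetricGraph V E) (k : ℝ) (w : E → ℂ × ℂ) (e : E) : ℂ × ℂ :=
  ((w e).2, G.slopeEnd k e w)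

/-- The slopes are defined from the end values by division by `sinSol`, which is nonzero because `k
· len < π`. The Dirichlet-to-Neumann matrix and the transfer matrix then describe the same solution.
-/
theorem endState_eq_evolve {k : ℝ} (hk : 0 ≤ k) {e : E} (he : k * G.len e < Real.pi)
    (w : E → ℂ × ℂ) : G.endState k w e = evolve k (G.len e) (G.startState k w e) := by
  have hs : (sinSol k (G.len e) : ℂ) ≠ 0 :=
    Complex.ofReal_ne_zero.2 (sinSol_pos hk (G.len_pos e) he).ne'
  have h3 : (cosSol k (G.len e) : ℂ) ^ 2 + k ^ 2 * sinSol k (G.len e) ^ 2 = 1 := by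
    exact_mod_cast cosSol_sq_add k (G.len e)
  ext
  · simp only [endState, startState, evolve, slopeStart_apply, coA, coB]
    push_cast
    field_simp
    ring
  · simp only [endState, startState, evolve, slopeStart_apply, slopeEnd_apply, coA, coB]
    push_cast
    field_simp
    linear_combination (w e).1 * h3

theorem start_end_eq_of_evolve {k : ℝ} (hk : 0 ≤ k) {e : E} (he : k * G.len e < Real.pi)
    {w : E → ℂ × ℂ} {p q : ℂ × ℂ} (h1 : (w e).1 = p.1) (h2 : (w e).2 = q.1)
    (hpq : q = evolve k (G.len e) p) : G.startState k w e = p ∧ G.endState k w e = q := by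
  have hs : (sinSol k (G.len e) : ℂ) ≠ 0 :=
    Complex.ofReal_ne_zero.2 (sinSol_pos hk (G.len_pos e) he).ne'
  have h3 : G.startState k w e = p := by
    refine Prod.ext h1 ?_
    simp only [startState, slopeStart_apply, coA, coB, h1, h2, hpq, evolve]
    push_cast
    field_simp
    ring
  exact ⟨h3, by rw [endState_eq_evolve hk he, h3, hpq]⟩

end States

/-! ### Neumann–Kirchhoff conditions for functions and for end values. -/

section KirchhoffValues

variable {V E : Type*} (G : MetricGraph V E) [Fintype E]

/-- End values of solutions of `-u'' = k² u` with Neumann–Kirchhoff conditions outside `B`. -/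
noncomputable def kirchhoffVals (k : ℝ) (B : Finset V) : Submodule ℂ (E → ℂ × ℂ) :=
  G.contSpace B ⊓ formOrth (G.edgeForm k 0) (G.contSpace ∅ ⊓ G.vanishOn B)

variable {G}

theorem mem_kirchhoffVals_iff {k : ℝ} {B : Finset V} {w : E → ℂ × ℂ} :
    w ∈ G.kirchhoffVals k B ↔ ∀ v ∉ B,
      (∃ a : ℂ, (∀ e, G.src e = v → (w e).1 = a) ∧ ∀ e, G.tgt e = v → (w e).2 = a) ∧
      ∑ e ∈ Finset.univ.filter (fun e => G.src e = v), G.slopeStart k e w =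
        ∑ e ∈ Finset.univ.filter (fun e => G.tgt e = v), G.slopeEnd k e w := by
  rw [kirchhoffVals, Submodule.mem_inf, mem_formOrth_vanishOn_iff]
  simp only [fluxStart_zero, fluxEnd_zero]
  constructor
  · exact fun h v hv => ⟨h.1 v hv, h.2 v hv⟩
  · exact fun h => ⟨fun v hv => (h v hv).1, fun v hv => (h v hv).2⟩

/-- Solutions of `-u'' = c u` with Neumann–Kirchhoff conditions outside `B`. -/
noncomputable def kirchhoffOff (G : MetricGraph V E) (c : ℝ) (B : Finset V) : Submodule ℂ G.H2 :=
  G.helmholtz c ⊓ ⨅ v : {v // v ∉ B}, G.kirchhoff v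

theorem mem_kirchhoffOff_iff {c : ℝ} {B : Finset V} {u : G.H2} :
    u ∈ G.kirchhoffOff c B ↔ u ∈ G.helmholtz c ∧ ∀ v ∉ B, u ∈ G.kirchhoff v := by
  rw [kirchhoffOff, Submodule.mem_inf, Submodule.mem_iInf]
  simp

theorem eigenspace_eq_kirchhoffOff (c : ℝ) : G.eigenspace c = G.kirchhoffOff c ∅ := by
  ext u
  rw [mem_eigenspace_iff, mem_kirchhoffOff_iff]
  simp

end KirchhoffValues

end MetricGraph

/-! ### Refinements of a graph and the discretisation of solutions. -/

theorem sum_filter_eq_of_iff {ι M : Type*} [Fintype ι] [AddCommMonoid M] {p : ι → Prop}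
    [DecidablePred p] {i : ι} (h : ∀ j, p j ↔ j = i) (φ : ι → M) :
    ∑ j ∈ Finset.univ.filter p, φ j = φ i := by
  have : Finset.univ.filter p = {i} := by
    ext j
    simp [h]
  rw [this, Finset.sum_singleton]

/-- The graph `H'` arises from `H` by inserting vertices of degree two. -/
structure Refinement {W F W' F' : Type*} (H : MetricGraph W F) (H' : MetricGraph W' F') where
  proj : F' → F
  off : F' → ℝ
  vert : W → W'
  first : F → F'
  last : F → F'
  vert_inj : Function.Injective vert
  off_nonneg : ∀ e, 0 ≤ off e
  off_add_le : ∀ e, off e + H'.len e ≤ H.len (proj e)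
  proj_first : ∀ e, proj (first e) = e
  off_first : ∀ e, off (first e) = 0
  eq_first : ∀ e, off e = 0 → e = first (proj e)
  proj_last : ∀ e, proj (last e) = e
  off_last : ∀ e, off (last e) + H'.len (last e) = H.len e
  eq_last : ∀ e, off e + H'.len e = H.len (proj e) → e = last (proj e)
  src_first : ∀ e, H'.src (first e) = vert (H.src e)
  tgt_last : ∀ e, H'.tgt (last e) = vert (H.tgt e)
  exists_next : ∀ e, off e + H'.len e ≠ H.len (proj e) →
    ∃ e', proj e = proj e' ∧ off e' = off e + H'.len e
  exists_prev : ∀ e, off e ≠ 0 → ∃ e', proj e' = proj e ∧ off e = off e' + H'.len e'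
  tgt_eq_src : ∀ e e', proj e = proj e' → off e' = off e + H'.len e → H'.tgt e = H'.src e'
  src_unique : ∀ e, off e ≠ 0 → ∀ e', H'.src e' = H'.src e → e' = e
  tgt_unique : ∀ e, off e + H'.len e ≠ H.len (proj e) → ∀ e', H'.tgt e' = H'.tgt e → e' = e
  const : ∀ {α : Type} (g : F' → α),
    (∀ e e', proj e = proj e' → off e' = off e + H'.len e → g e = g e') →
      ∀ e e', proj e = proj e' → g e = g e'

namespace Refinement

open MetricGraph

variable {W F W' F' : Type*} {H : MetricGraph W F} {H' : MetricGraph W' F'}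
  (R : Refinement H H')

/-- The inserted vertices. -/
def IsNew (x : W') : Prop := ∃ e, R.off e ≠ 0 ∧ H'.src e = x

/-- The values of `u` at the ends of the edges of the refined graph. -/
noncomputable def ends : H.H2 →ₗ[ℂ] (F' → ℂ × ℂ) where
  toFun u e := (u.1 (R.proj e) (R.off e), u.1 (R.proj e) (R.off e + H'.len e))
  map_add' _ _ := rfl
  map_smul' _ _ := rfl

theorem ends_apply (u : H.H2) (e : F') :
    R.ends u e = (u.1 (R.proj e) (R.off e), u.1 (R.proj e) (R.off e + H'.len e)) := rfl

theorem off_mem (e : F') : R.off e ∈ Icc 0 (H.len (R.proj e)) :=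
  ⟨R.off_nonneg e, (le_add_of_nonneg_right (H'.len_pos e).le).trans (R.off_add_le e)⟩

theorem off_add_mem (e : F') : R.off e + H'.len e ∈ Icc 0 (H.len (R.proj e)) :=
  ⟨add_nonneg (R.off_nonneg e) (H'.len_pos e).le, R.off_add_le e⟩

theorem tgt_end_of_not_isNew {x : W'} (hx : ¬ R.IsNew x) {e : F'} (he : H'.tgt e = x) :
    R.off e + H'.len e = H.len (R.proj e) := by
  by_contra h
  obtain ⟨e', h1, h2⟩ := R.exists_next e h
  refine hx ⟨e', ?_, by rw [← R.tgt_eq_src e e' h1 h2, he]⟩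
  rw [h2]
  exact (add_pos_of_nonneg_of_pos (R.off_nonneg e) (H'.len_pos e)).ne'

theorem src_off_of_not_isNew {x : W'} (hx : ¬ R.IsNew x) {e : F'} (he : H'.src e = x) :
    R.off e = 0 := by
  by_contra h
  exact hx ⟨e, h, he⟩

variable {k : ℝ}

theorem states_ends (hk : 0 ≤ k) {u : H.H2} (hu : u ∈ H.helmholtz (k ^ 2)) {e : F'}
    (he : k * H'.len e < Real.pi) :
    H'.startState k (R.ends u) e = state u (R.proj e) (R.off e) ∧
      H'.endState k (R.ends u) e = state u (R.proj e) (R.off e + H'.len e) := by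
  refine start_end_eq_of_evolve hk he rfl rfl ?_
  rw [state_eq_evolve_sub hu _ (R.off_mem e) (R.off_add_mem e), add_sub_cancel_left]

theorem slopeStart_ends (hk : 0 ≤ k) {u : H.H2} (hu : u ∈ H.helmholtz (k ^ 2)) {e : F'}
    (he : k * H'.len e < Real.pi) :
    H'.slopeStart k e (R.ends u) = (state u (R.proj e) (R.off e)).2 :=
  congrArg Prod.snd (R.states_ends hk hu he).1

theorem slopeEnd_ends (hk : 0 ≤ k) {u : H.H2} (hu : u ∈ H.helmholtz (k ^ 2)) {e : F'}
    (he : k * H'.len e < Real.pi) :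
    H'.slopeEnd k e (R.ends u) = (state u (R.proj e) (R.off e + H'.len e)).2 :=
  congrArg Prod.snd (R.states_ends hk hu he).2

theorem eq_of_ends_eq (hk : 0 ≤ k) (hs : ∀ e, k * H'.len e < Real.pi) {u v : H.H2}
    (hu : u ∈ H.helmholtz (k ^ 2)) (hv : v ∈ H.helmholtz (k ^ 2)) (h : R.ends u = R.ends v) :
    u = v := by
  refine eq_of_state_zero_eq hu hv fun e => ?_
  have h1 := (R.states_ends hk hu (hs (R.first e))).1
  rw [h, (R.states_ends hk hv (hs (R.first e))).1, R.proj_first, R.off_first] at h1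
  exact h1.symm

theorem ends_first (u : H.H2) (e : F) : (R.ends u (R.first e)).1 = val e (startPt e) u := by
  rw [ends_apply, R.proj_first, R.off_first]
  rfl

theorem ends_last (u : H.H2) (e : F) : (R.ends u (R.last e)).2 = val e (endPt e) u := by
  rw [ends_apply, R.off_last, R.proj_last]
  rfl

theorem slopeStart_first (hk : 0 ≤ k) (hs : ∀ e, k * H'.len e < Real.pi) {u : H.H2}
    (hu : u ∈ H.helmholtz (k ^ 2)) (e : F) :
    H'.slopeStart k (R.first e) (R.ends u) = der e (startPt e) u := by
  rw [R.slopeStart_ends hk hu (hs _), R.proj_first, R.off_first]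
  rfl

theorem slopeEnd_last (hk : 0 ≤ k) (hs : ∀ e, k * H'.len e < Real.pi) {u : H.H2}
    (hu : u ∈ H.helmholtz (k ^ 2)) (e : F) :
    H'.slopeEnd k (R.last e) (R.ends u) = der e (endPt e) u := by
  rw [R.slopeEnd_ends hk hu (hs _), R.off_last, R.proj_last]
  rfl

variable [Fintype F] [Fintype F']

theorem sum_src {M : Type*} [AddCommMonoid M] {v : W} (hv : ¬ R.IsNew (R.vert v)) (φ : F' → M) :
    ∑ e ∈ Finset.univ.filter (fun e => H'.src e = R.vert v), φ e =
      ∑ e ∈ Finset.univ.filter (fun e => H.src e = v), φ (R.first e) := by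
  have hf : ∀ e, H'.src e = R.vert v → R.first (R.proj e) = e := fun e he =>
    (R.eq_first e (R.src_off_of_not_isNew hv he)).symm
  refine Finset.sum_nbij' R.proj R.first ?_ ?_ ?_ ?_ ?_
  · intro e he
    have he := (Finset.mem_filter.1 he).2
    refine Finset.mem_filter.2 ⟨Finset.mem_univ _, R.vert_inj ?_⟩
    rw [← R.src_first, hf e he, he]
  · intro e he
    refine Finset.mem_filter.2 ⟨Finset.mem_univ _, ?_⟩
    rw [R.src_first, (Finset.mem_filter.1 he).2]
  · exact fun e he => hf e (Finset.mem_filter.1 he).2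
  · exact fun e _ => R.proj_first e
  · intro e he
    rw [hf e (Finset.mem_filter.1 he).2]

theorem sum_tgt {M : Type*} [AddCommMonoid M] {v : W} (hv : ¬ R.IsNew (R.vert v)) (φ : F' → M) :
    ∑ e ∈ Finset.univ.filter (fun e => H'.tgt e = R.vert v), φ e =
      ∑ e ∈ Finset.univ.filter (fun e => H.tgt e = v), φ (R.last e) := by
  have hf : ∀ e, H'.tgt e = R.vert v → R.last (R.proj e) = e := fun e he =>
    (R.eq_last e (R.tgt_end_of_not_isNew hv he)).symm
  refine Finset.sum_nbij' R.proj R.last ?_ ?_ ?_ ?_ ?_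
  · intro e he
    have he := (Finset.mem_filter.1 he).2
    refine Finset.mem_filter.2 ⟨Finset.mem_univ _, R.vert_inj ?_⟩
    rw [← R.tgt_last, hf e he, he]
  · intro e he
    refine Finset.mem_filter.2 ⟨Finset.mem_univ _, ?_⟩
    rw [R.tgt_last, (Finset.mem_filter.1 he).2]
  · exact fun e he => hf e (Finset.mem_filter.1 he).2
  · exact fun e _ => R.proj_last e
  · intro e he
    rw [hf e (Finset.mem_filter.1 he).2]

theorem mem_kirchhoff_iff (hk : 0 ≤ k) (hs : ∀ e, k * H'.len e < Real.pi) {u : H.H2}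
    (hu : u ∈ H.helmholtz (k ^ 2)) {v : W} (hv : ¬ R.IsNew (R.vert v)) :
    u ∈ H.kirchhoff v ↔
      (∃ a : ℂ, (∀ e, H'.src e = R.vert v → (R.ends u e).1 = a) ∧
        ∀ e, H'.tgt e = R.vert v → (R.ends u e).2 = a) ∧
      ∑ e ∈ Finset.univ.filter (fun e => H'.src e = R.vert v), H'.slopeStart k e (R.ends u) =
        ∑ e ∈ Finset.univ.filter (fun e => H'.tgt e = R.vert v), H'.slopeEnd k e (R.ends u) := by
  rw [R.sum_src hv, R.sum_tgt hv]
  simp only [R.slopeStart_first hk hs hu, R.slopeEnd_last hk hs hu]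
  have h2 : H.sumOut der v u - H.sumIn der v u = 0 ↔
      ∑ e ∈ Finset.univ.filter (fun e => H.src e = v), der e (startPt e) u =
        ∑ e ∈ Finset.univ.filter (fun e => H.tgt e = v), der e (endPt e) u := by
    rw [sub_eq_zero, sumOut, sumIn, LinearMap.sum_apply, LinearMap.sum_apply]
  change ((∃ a : ℂ, (∀ e, H.src e = v → val e (startPt e) u = a) ∧
      ∀ e, H.tgt e = v → val e (endPt e) u = a) ∧ _ = (0 : ℂ)) ↔ _
  rw [h2]
  refine and_congr_left fun _ => exists_congr fun a => and_congr ?_ ?_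
  · constructor
    · intro h e he
      have e1 := R.eq_first e (R.src_off_of_not_isNew hv he)
      rw [e1, ends_first]
      refine h _ (R.vert_inj ?_)
      rw [← R.src_first, ← e1, he]
    · intro h e he
      rw [← ends_first R]
      exact h _ (by rw [R.src_first, he])
  · constructor
    · intro h e he
      have e1 := R.eq_last e (R.tgt_end_of_not_isNew hv he)
      rw [e1, ends_last]
      refine h _ (R.vert_inj ?_)
      rw [← R.tgt_last, ← e1, he]
    · intro h e he
      rw [← ends_last R]
      exact h _ (by rw [R.tgt_last, he])

/-- At an inserted vertex the conditions express that `u` is continuously differentiable there; at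
an old vertex they are those of `H`; at a label without edges they are void. -/
theorem ends_mem_kirchhoffVals (hk : 0 ≤ k) (hs : ∀ e, k * H'.len e < Real.pi) {B : Finset W}
    {B' : Finset W'} (hB : ∀ v, R.vert v ∈ B' ↔ v ∈ B) {u : H.H2}
    (hu : u ∈ H.kirchhoffOff (k ^ 2) B) : R.ends u ∈ H'.kirchhoffVals k B' := by
  rw [mem_kirchhoffOff_iff] at hu
  rw [mem_kirchhoffVals_iff]
  intro x hx
  by_cases hnew : R.IsNew x
  · obtain ⟨e₂, h0, rfl⟩ := hnew
    obtain ⟨e₁, h1, h2⟩ := R.exists_prev e₂ h0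
    have hl : R.off e₁ + H'.len e₁ ≠ H.len (R.proj e₁) := by
      rw [← h2, h1]
      have := R.off_add_le e₂
      have := H'.len_pos e₂
      linarith
    have ht := R.tgt_eq_src e₁ e₂ h1 h2
    have hsrc : ∀ e, H'.src e = H'.src e₂ ↔ e = e₂ :=
      fun e => ⟨R.src_unique e₂ h0 e, fun h => by rw [h]⟩
    have htgt : ∀ e, H'.tgt e = H'.src e₂ ↔ e = e₁ := fun e => by
      rw [← ht]
      exact ⟨R.tgt_unique e₁ hl e, fun h => by rw [h]⟩
    have hst : H'.endState k (R.ends u) e₁ = H'.startState k (R.ends u) e₂ := by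
      rw [(R.states_ends hk hu.1 (hs e₁)).2, (R.states_ends hk hu.1 (hs e₂)).1, h2, h1]
    rw [sum_filter_eq_of_iff hsrc, sum_filter_eq_of_iff htgt]
    refine ⟨⟨(R.ends u e₂).1, ?_, ?_⟩, ?_⟩
    · intro e he
      rw [(hsrc e).1 he]
    · intro e he
      rw [(htgt e).1 he]
      exact congrArg Prod.fst hst
    · exact (congrArg Prod.snd hst).symm
  · by_cases hex : ∃ v, R.vert v = x
    · obtain ⟨v, rfl⟩ := hex
      exact (R.mem_kirchhoff_iff hk hs hu.1 hnew).1 (hu.2 v fun h => hx ((hB v).2 h))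
    · have hsrc : ∀ e, H'.src e ≠ x := by
        intro e he
        have e1 := R.eq_first e (R.src_off_of_not_isNew hnew he)
        exact hex ⟨_, by rw [← R.src_first, ← e1, he]⟩
      have htgt : ∀ e, H'.tgt e ≠ x := by
        intro e he
        have e1 := R.eq_last e (R.tgt_end_of_not_isNew hnew he)
        exact hex ⟨_, by rw [← R.tgt_last, ← e1, he]⟩
      simp [hsrc, htgt]

/-- At an inserted vertex the conditions match value and derivative of the two neighbouring pieces.
So all pieces of an edge continue one and the same solution on that edge. -/
theorem exists_ends_eq (hk : 0 ≤ k) (hs : ∀ e, k * H'.len e < Real.pi) {B : Finset W}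
    {B' : Finset W'} (hB : ∀ v, R.vert v ∈ B' ↔ v ∈ B) (hnew : ∀ x ∈ B', ¬ R.IsNew x)
    {w : F' → ℂ × ℂ} (hw : w ∈ H'.kirchhoffVals k B') :
    ∃ u ∈ H.kirchhoffOff (k ^ 2) B, R.ends u = w := by
  rw [mem_kirchhoffVals_iff] at hw
  -- The initial data at the start of the whole edge, computed by evolving backwards from the piece;
  -- they turn out not to depend on the piece.
  let g : F' → ℂ × ℂ := fun e => evolve k (-R.off e) (H'.startState k w e)
  have hg : ∀ e e', R.proj e = R.proj e' → g e = g e' := by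
    refine R.const g fun e₁ e₂ h1 h2 => ?_
    have h0 : R.off e₂ ≠ 0 := by
      rw [h2]
      exact (add_pos_of_nonneg_of_pos (R.off_nonneg e₁) (H'.len_pos e₁)).ne'
    have hl : R.off e₁ + H'.len e₁ ≠ H.len (R.proj e₁) := by
      rw [← h2, h1]
      have := R.off_add_le e₂
      have := H'.len_pos e₂
      linarith
    have ht := R.tgt_eq_src e₁ e₂ h1 h2
    have hsrc : ∀ e, H'.src e = H'.src e₂ ↔ e = e₂ :=
      fun e => ⟨R.src_unique e₂ h0 e, fun h => by rw [h]⟩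
    have htgt : ∀ e, H'.tgt e = H'.src e₂ ↔ e = e₁ := fun e => by
      rw [← ht]
      exact ⟨R.tgt_unique e₁ hl e, fun h => by rw [h]⟩
    obtain ⟨⟨a, ha, ha'⟩, hsum⟩ := hw (H'.src e₂) fun h => hnew _ h ⟨e₂, h0, rfl⟩
    rw [sum_filter_eq_of_iff hsrc, sum_filter_eq_of_iff htgt] at hsum
    have hst : H'.endState k w e₁ = H'.startState k w e₂ :=
      Prod.ext ((ha' e₁ ht).trans (ha e₂ rfl).symm) hsum.symm
    change evolve k (-R.off e₁) (H'.startState k w e₁) =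
      evolve k (-R.off e₂) (H'.startState k w e₂)
    rw [← hst, endState_eq_evolve hk (hs e₁), ← evolve_add, h2]
    congr 1
    ring
  let d : F → ℂ × ℂ := fun e => H'.startState k w (R.first e)
  have hd : ∀ e, evolve k (R.off e) (d (R.proj e)) = H'.startState k w e := by
    intro e
    have h1 := hg (R.first (R.proj e)) e (R.proj_first _)
    simp only [g, R.off_first, neg_zero, evolve_zero] at h1
    change evolve k (R.off e) (H'.startState k w (R.first (R.proj e))) = _
    rw [h1, ← evolve_add, add_neg_cancel, evolve_zero]
  have hu : H.sol k d ∈ H.helmholtz (k ^ 2) := sol_mem_helmholtz k d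
  have hends : R.ends (H.sol k d) = w := by
    funext e
    have e1 := state_sol k d (R.proj e) (R.off_mem e)
    have e2 := state_sol k d (R.proj e) (R.off_add_mem e)
    rw [hd] at e1
    have e3 : R.off e + H'.len e = H'.len e + R.off e := add_comm _ _
    rw [e3, evolve_add, hd, ← endState_eq_evolve hk (hs e), ← e3] at e2
    have a1 : (R.ends (H.sol k d) e).1 = (w e).1 := (Prod.ext_iff.1 e1).1
    have a2 : (R.ends (H.sol k d) e).2 = (w e).2 := (Prod.ext_iff.1 e2).1
    exact Prod.ext a1 a2
  refine ⟨H.sol k d, ?_, hends⟩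
  rw [mem_kirchhoffOff_iff]
  refine ⟨hu, fun v hv => ?_⟩
  -- If `H` is itself a subdivision, all points are vertex labels of `H`, and an inserted vertex may
  -- be among them. It has no edge of `H`, so the condition there is empty.
  by_cases hn : R.IsNew (R.vert v)
  · obtain ⟨e₂, h0, h2⟩ := hn
    obtain ⟨e₁, h1, h3⟩ := R.exists_prev e₂ h0
    have hl : R.off e₁ + H'.len e₁ ≠ H.len (R.proj e₁) := by
      rw [← h3, h1]
      have := R.off_add_le e₂
      have := H'.len_pos e₂
      linarith
    have hsrc : ∀ e, H.src e ≠ v := by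
      intro e he
      have := R.src_unique e₂ h0 (R.first e) (by rw [R.src_first, he, h2])
      exact h0 (by rw [← this, R.off_first])
    have htgt : ∀ e, H.tgt e ≠ v := by
      intro e he
      have := R.tgt_unique e₁ hl (R.last e) (by
        rw [R.tgt_last, he, R.tgt_eq_src e₁ e₂ h1 h3, h2])
      apply hl
      rw [← this, R.off_last, R.proj_last]
    refine ⟨⟨0, fun e he => absurd he (hsrc e), fun e he => absurd he (htgt e)⟩, ?_⟩
    simp [sumOut, sumIn, hsrc, htgt]
  · rw [R.mem_kirchhoff_iff hk hs hu hn, hends]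
    exact hw _ fun h => hv ((hB v).1 h)

/-- The solutions of `-u'' = k² u` on `H` with Neumann–Kirchhoff conditions outside `B` correspond to
their values at the vertices of a sufficiently fine refinement. -/
noncomputable def endsEquiv (hk : 0 ≤ k) (hs : ∀ e, k * H'.len e < Real.pi) {B : Finset W}
    {B' : Finset W'} (hB : ∀ v, R.vert v ∈ B' ↔ v ∈ B) (hnew : ∀ x ∈ B', ¬ R.IsNew x) :
    H.kirchhoffOff (k ^ 2) B ≃ₗ[ℂ] H'.kirchhoffVals k B' :=
  LinearEquiv.ofBijective
    (R.ends.restrict fun _ hu => R.ends_mem_kirchhoffVals hk hs hB hu) (by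
      constructor
      · intro u v h
        exact Subtype.ext (R.eq_of_ends_eq hk hs (mem_kirchhoffOff_iff.1 u.2).1
          (mem_kirchhoffOff_iff.1 v.2).1 (congrArg Subtype.val h))
      · rintro ⟨w, hw⟩
        obtain ⟨u, hu, h⟩ := R.exists_ends_eq hk hs hB hnew hw
        exact ⟨⟨u, hu⟩, Subtype.ext h⟩)

end Refinement

/-! ### Indices of an endomorphism read off from boundary data. -/

section MoreIndex

open Module

theorem negIndex_add_negIndex_neg {A : Type*} [AddCommGroup A] [Module ℂ A]
    [FiniteDimensional ℂ A] {Q : A →ₗ⋆[ℂ] A →ₗ[ℂ] ℂ} (hQ : Q.IsSymm) (Y : Submodule ℂ A)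
    (h : formRadical Q Y = ⊥) : negIndex Q Y + negIndex (-Q) Y = finrank ℂ Y := by
  obtain ⟨N, hN, P, hP, hneg, hpos, hd, hs⟩ := exists_inertia_splitting hQ Y
  rw [h, finrank_bot] at hs
  have h1 : finrank ℂ P ≤ negIndex (-Q) Y :=
    finrank_le_negIndex hP fun x hx h0 => by simpa using hpos x hx h0
  have h2 := negIndex_add_finrank_le (Q := -Q) hN fun x hx => by
    by_cases h0 : x = 0
    · simp [h0]
    · simpa using (hneg x hx h0).le
  omega

theorem morseIndex_of_data {A X ι : Type*} [AddCommGroup A] [Module ℂ A]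
    [FiniteDimensional ℂ A] [AddCommMonoid X] [Module ℂ X] [Fintype ι]
    {Q : A →ₗ⋆[ℂ] A →ₗ[ℂ] ℂ} (hQ : Q.IsSymm) (M : Submodule ℂ A) (φ : X ≃ₗ[ℂ] M)
    (T : Module.End ℂ (ι → ℂ)) (data : X →ₗ[ℂ] (ι → ℂ)) (hb : Function.Bijective data)
    (h : ∀ x y : X, Q (φ x) (φ y) = ∑ i, (starRingEnd ℂ) (data x i) * T (data y) i) :
    morseIndex T = negIndex Q M := by
  refine morseIndex_eq_negIndex hQ M (φ.symm.trans (LinearEquiv.ofBijective data hb)) _ ?_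
  intro x y
  obtain ⟨x, rfl⟩ := φ.surjective x
  obtain ⟨y, rfl⟩ := φ.surjective y
  rw [h]
  simp

theorem posIndex_of_data {A X ι : Type*} [AddCommGroup A] [Module ℂ A]
    [FiniteDimensional ℂ A] [AddCommMonoid X] [Module ℂ X] [Fintype ι]
    {Q : A →ₗ⋆[ℂ] A →ₗ[ℂ] ℂ} (hQ : Q.IsSymm) (M : Submodule ℂ A) (φ : X ≃ₗ[ℂ] M)
    (T : Module.End ℂ (ι → ℂ)) (data : X →ₗ[ℂ] (ι → ℂ)) (hb : Function.Bijective data)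
    (h : ∀ x y : X, Q (φ x) (φ y) = -∑ i, (starRingEnd ℂ) (data x i) * T (data y) i) :
    posIndex T = negIndex Q M := by
  rw [posIndex_eq_morseIndex_neg]
  refine morseIndex_of_data hQ M φ (-T) data hb fun x y => ?_
  rw [h]
  simp

end MoreIndex

namespace MetricGraph

/-! ### Robin traces, fluxes and Green's formula. -/

section FluxForms

variable {V E : Type*} {G : MetricGraph V E}

theorem robinTrace_infty (e : E) (x : Icc (0 : ℝ) (G.len e)) (u : G.H2) :
    robinTrace ∞ e x u = val e x u := by
  have : pruferAngle ∞ = 0 := rfl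
  simp [robinTrace, this]

theorem robinDualTrace_infty (e : E) (x : Icc (0 : ℝ) (G.len e)) (u : G.H2) :
    robinDualTrace ∞ e x u = der e x u := by
  have : pruferAngle ∞ = 0 := rfl
  simp [robinDualTrace, this]

theorem sin_pruferAngle_pos (s : ℝ) : 0 < Real.sin (pruferAngle (s : OnePoint ℝ)) := by
  change 0 < Real.sin (Real.pi / 2 - Real.arctan s)
  rw [Real.sin_pi_div_two_sub]
  exact Real.cos_arctan_pos s

theorem cos_pruferAngle (s : ℝ) : Real.cos (pruferAngle (s : OnePoint ℝ)) =
    s * Real.sin (pruferAngle (s : OnePoint ℝ)) := by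
  have := cot_pruferAngle s
  rw [Real.cot_eq_cos_div_sin, div_eq_iff (sin_pruferAngle_pos s).ne'] at this
  exact this

theorem robinTrace_coe (s : ℝ) (e : E) (x : Icc (0 : ℝ) (G.len e)) (u : G.H2) :
    robinTrace (s : OnePoint ℝ) e x u =
      -Real.sin (pruferAngle (s : OnePoint ℝ)) * (der e x u - s * val e x u) := by
  simp only [robinTrace, cos_pruferAngle, LinearMap.sub_apply, LinearMap.smul_apply, smul_eq_mul]
  push_cast
  ring

theorem robinDualTrace_coe (s : ℝ) (e : E) (x : Icc (0 : ℝ) (G.len e)) (u : G.H2) :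
    robinDualTrace (s : OnePoint ℝ) e x u =
      Real.sin (pruferAngle (s : OnePoint ℝ)) * (val e x u + s * der e x u) := by
  simp only [robinDualTrace, cos_pruferAngle, LinearMap.add_apply, LinearMap.smul_apply,
    smul_eq_mul]
  push_cast
  ring

theorem sin_pruferAngle_sq (s : ℝ) :
    Real.sin (pruferAngle (s : OnePoint ℝ)) ^ 2 * (1 + s ^ 2) = 1 := by
  have := Real.sin_sq_add_cos_sq (pruferAngle (s : OnePoint ℝ))
  rw [cos_pruferAngle] at this
  linarith

variable [Fintype E]

/-- Tested with single edge ends at `B`, a representation of a functional becomes a prescription of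
fluxes. This produces solutions with given Robin data. -/
theorem flux_eq_of_form_eq {k : ℝ} {σ : V → ℝ} {B : Set V} {w : E → ℂ × ℂ} {α β : E → ℂ}
    (hw : ∀ z ∈ G.contSpace B, G.edgeForm k σ z w =
      ∑ e, ((starRingEnd ℂ) (z e).2 * β e - (starRingEnd ℂ) (z e).1 * α e)) :
    (∀ e, G.src e ∈ B → G.fluxStart k σ e w = α e) ∧
      ∀ e, G.tgt e ∈ B → G.fluxEnd k σ e w = β e := by
  constructor
  · intro e he
    let z : E → ℂ × ℂ := fun e' => (if e' = e then 1 else 0, 0)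
    have hz : z ∈ G.contSpace B := by
      refine fun v hv => ⟨0, fun e' he' => ?_, fun e' he' => rfl⟩
      have : e' ≠ e := by
        rintro rfl
        exact hv (he' ▸ he)
      simp [z, this]
    have := hw z hz
    simpa [edgeForm_apply, z, apply_ite (starRingEnd ℂ)] using this
  · intro e he
    let z : E → ℂ × ℂ := fun e' => (0, if e' = e then 1 else 0)
    have hz : z ∈ G.contSpace B := by
      refine fun v hv => ⟨0, fun e' he' => rfl, fun e' he' => ?_⟩
      have : e' ≠ e := by
        rintro rfl
        exact hv (he' ▸ he)
      simp [z, this]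
    have := hw z hz
    simpa [edgeForm_apply, z, apply_ite (starRingEnd ℂ)] using this

/-- Green's formula: continuity of `z` and the Kirchhoff condition for `w` cancel all boundary terms
outside `B`. -/
theorem edgeForm_eq_sum {k : ℝ} {σ : V → ℝ} {B : Finset V} (hσ : ∀ v ∉ B, σ v = 0)
    {z w : E → ℂ × ℂ} (hz : z ∈ G.contSpace B) (hw : w ∈ G.kirchhoffVals k B) :
    G.edgeForm k σ z w = ∑ v ∈ B,
      (∑ e ∈ Finset.univ.filter (fun e => G.tgt e = v),
          (starRingEnd ℂ) (z e).2 * G.fluxEnd k σ e w -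
        ∑ e ∈ Finset.univ.filter (fun e => G.src e = v),
          (starRingEnd ℂ) (z e).1 * G.fluxStart k σ e w) := by
  rw [edgeForm_apply, G.sum_ends (fun e => (starRingEnd ℂ) (z e).1 * G.fluxStart k σ e w)
    (fun e => (starRingEnd ℂ) (z e).2 * G.fluxEnd k σ e w) B]
  intro v hv
  obtain ⟨a, ha, ha'⟩ := hz v hv
  have hs := (mem_kirchhoffVals_iff.1 hw v hv).2
  have h0 : ∀ e ∈ Finset.univ.filter (fun e => G.src e = v),
      (starRingEnd ℂ) (z e).1 * G.fluxStart k σ e w =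
        (starRingEnd ℂ) a * G.slopeStart k e w := fun e he => by
    have he := (Finset.mem_filter.1 he).2
    rw [ha e he, fluxStart_apply, he, hσ v hv, Complex.ofReal_zero, zero_mul, sub_zero]
  have h1 : ∀ e ∈ Finset.univ.filter (fun e => G.tgt e = v),
      (starRingEnd ℂ) (z e).2 * G.fluxEnd k σ e w =
        (starRingEnd ℂ) a * G.slopeEnd k e w := fun e he => by
    have he := (Finset.mem_filter.1 he).2
    rw [ha' e he, fluxEnd_apply, he, hσ v hv, Complex.ofReal_zero, zero_mul, sub_zero]
  rw [Finset.sum_congr rfl h0, Finset.sum_congr rfl h1, ← Finset.mul_sum, ← Finset.mul_sum, hs]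

/-- The vertices in `B` have exactly one ingoing and one outgoing edge. -/
def TwoSided (G : MetricGraph V E) (B : Set V) : Prop :=
  ∀ v ∈ B, (∃ e, ∀ e', G.tgt e' = v ↔ e' = e) ∧ ∃ e, ∀ e', G.src e' = v ↔ e' = e

theorem mem_robinSolutions_iff {s : OnePoint ℝ} {c : ℝ} {B : Finset V} {u : G.H2} :
    u ∈ G.robinSolutions s c B ↔ u ∈ G.kirchhoffOff c B ∧
      ∀ v ∈ B, G.sumIn (robinTrace s) v u = G.sumOut (robinTrace s) v u := by
  rw [robinSolutions, kirchhoffOff, Submodule.mem_inf, Submodule.mem_iInf]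
  simp only [LinearMap.mem_ker, LinearMap.sub_apply, sub_eq_zero, Subtype.forall]

theorem sumIn_apply_of_iff (T : (e : E) → Icc (0 : ℝ) (G.len e) → (G.H2 →ₗ[ℂ] ℂ)) {v : V}
    {e : E} (h : ∀ e', G.tgt e' = v ↔ e' = e) (u : G.H2) : G.sumIn T v u = T e (endPt e) u := by
  rw [sumIn, LinearMap.sum_apply, sum_filter_eq_of_iff h]

theorem sumOut_apply_of_iff (T : (e : E) → Icc (0 : ℝ) (G.len e) → (G.H2 →ₗ[ℂ] ℂ)) {v : V}
    {e : E} (h : ∀ e', G.src e' = v ↔ e' = e) (u : G.H2) :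
    G.sumOut T v u = T e (startPt e) u := by
  rw [sumOut, LinearMap.sum_apply, sum_filter_eq_of_iff h]

theorem robinMap_robinData {s : OnePoint ℝ} {c : ℝ} {B : Finset V} (h : G.RobinWellPosed s c B)
    (u : G.robinSolutions s c B) :
    G.robinMap s c B (G.robinData s c B u) = G.robinDualData s c B u := by
  rw [robinMap, dif_pos h, LinearMap.comp_apply, LinearEquiv.coe_coe]
  congr 1
  exact (LinearEquiv.ofBijective (G.robinData s c B) h).symm_apply_apply u

end FluxForms

end MetricGraph

/-! ### The Robin map as the form on an orthogonal complement. -/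

namespace Refinement

open MetricGraph Module

variable {W F W' F' : Type*} {H : MetricGraph W F} {H' : MetricGraph W' F'}
  (R : Refinement H H') {k : ℝ}

/-- The image of a set of vertices. -/
def mapVert (B : Finset W) : Finset W' := B.map ⟨R.vert, R.vert_inj⟩

theorem vert_mem_mapVert {B : Finset W} {v : W} : R.vert v ∈ R.mapVert B ↔ v ∈ B :=
  Finset.mem_map' (⟨R.vert, R.vert_inj⟩ : W ↪ W')

theorem exists_of_mem_mapVert {B : Finset W} {x : W'} (h : x ∈ R.mapVert B) :
    ∃ v ∈ B, R.vert v = x := Finset.mem_map.1 h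

theorem tgt_iff {v : W} (hv : ¬ R.IsNew (R.vert v)) {e : F} (h : ∀ e', H.tgt e' = v ↔ e' = e)
    (e' : F') : H'.tgt e' = R.vert v ↔ e' = R.last e := by
  constructor
  · intro he
    have e1 := R.eq_last e' (R.tgt_end_of_not_isNew hv he)
    rwa [(h (R.proj e')).1 (R.vert_inj (by rw [← R.tgt_last, ← e1, he]))] at e1
  · rintro rfl
    rw [R.tgt_last, (h e).2 rfl]

theorem src_iff {v : W} (hv : ¬ R.IsNew (R.vert v)) {e : F} (h : ∀ e', H.src e' = v ↔ e' = e)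
    (e' : F') : H'.src e' = R.vert v ↔ e' = R.first e := by
  constructor
  · intro he
    have e1 := R.eq_first e' (R.src_off_of_not_isNew hv he)
    rwa [(h (R.proj e')).1 (R.vert_inj (by rw [← R.src_first, ← e1, he]))] at e1
  · rintro rfl
    rw [R.src_first, (h e).2 rfl]

variable {B : Finset W}

theorem not_isNew_of_mem (hnew : ∀ v ∈ B, ¬ R.IsNew (R.vert v)) :
    ∀ x ∈ R.mapVert B, ¬ R.IsNew x := by
  intro x hx
  obtain ⟨v, hv, rfl⟩ := R.exists_of_mem_mapVert hx
  exact hnew v hv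

variable [Fintype F] [Fintype F']

/-- The restriction of `ends` to the Robin solutions, onto a given space of end values. -/
noncomputable def robinEquiv (hk : 0 ≤ k) (hs : ∀ e, k * H'.len e < Real.pi)
    (hnew : ∀ v ∈ B, ¬ R.IsNew (R.vert v)) (s : OnePoint ℝ) (M : Submodule ℂ (F' → ℂ × ℂ))
    (hM : M ≤ H'.kirchhoffVals k (R.mapVert B))
    (h : ∀ u ∈ H.kirchhoffOff (k ^ 2) B, u ∈ H.robinSolutions s (k ^ 2) B ↔ R.ends u ∈ M) :
    H.robinSolutions s (k ^ 2) B ≃ₗ[ℂ] M :=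
  LinearEquiv.ofBijective
    (R.ends.restrict fun u hu => (h u (mem_robinSolutions_iff.1 hu).1).1 hu) (by
      constructor
      · intro u v huv
        have hu := (mem_kirchhoffOff_iff.1 (mem_robinSolutions_iff.1 u.2).1).1
        have hv := (mem_kirchhoffOff_iff.1 (mem_robinSolutions_iff.1 v.2).1).1
        exact Subtype.ext (R.eq_of_ends_eq hk hs hu hv (congrArg Subtype.val huv))
      · rintro ⟨w, hw⟩
        obtain ⟨u, hu, hw'⟩ := R.exists_ends_eq hk hs (fun v => R.vert_mem_mapVert)
          (R.not_isNew_of_mem hnew) (hM hw)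
        exact ⟨⟨u, (h u hu).2 (by rw [hw']; exact hw)⟩, Subtype.ext hw'⟩)

theorem edgeForm_ends (hk : 0 ≤ k) (hs : ∀ e, k * H'.len e < Real.pi)
    (hnew : ∀ v ∈ B, ¬ R.IsNew (R.vert v)) {σ : W' → ℝ} (hσ : ∀ v ∉ R.mapVert B, σ v = 0)
    {u v : H.H2} (hu : u ∈ H.kirchhoffOff (k ^ 2) B) (hv : v ∈ H.kirchhoffOff (k ^ 2) B) :
    H'.edgeForm k σ (R.ends u) (R.ends v) = ∑ b : B,
      (∑ e ∈ Finset.univ.filter (fun e => H.tgt e = b), (starRingEnd ℂ) (val e (endPt e) u) *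
          (der e (endPt e) v - σ (R.vert b) * val e (endPt e) v) -
        ∑ e ∈ Finset.univ.filter (fun e => H.src e = b), (starRingEnd ℂ) (val e (startPt e) u) *
          (der e (startPt e) v - σ (R.vert b) * val e (startPt e) v)) := by
  have hu' := R.ends_mem_kirchhoffVals hk hs (fun v => R.vert_mem_mapVert) hu
  have hv' := R.ends_mem_kirchhoffVals hk hs (fun v => R.vert_mem_mapVert) hv
  have hvh := (mem_kirchhoffOff_iff.1 hv).1
  rw [edgeForm_eq_sum hσ hu'.1 hv', mapVert, Finset.sum_map,
    ← Finset.sum_coe_sort B]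
  refine Finset.sum_congr rfl fun b _ => ?_
  change ∑ e ∈ Finset.univ.filter (fun e => H'.tgt e = R.vert b), _ -
    ∑ e ∈ Finset.univ.filter (fun e => H'.src e = R.vert b), _ = _
  rw [R.sum_tgt (hnew b b.2), R.sum_src (hnew b b.2)]
  congr 1
  · refine Finset.sum_congr rfl fun e he => ?_
    rw [fluxEnd_apply, R.ends_last, R.ends_last, R.slopeEnd_last hk hs hvh, R.tgt_last,
      (Finset.mem_filter.1 he).2]
  · refine Finset.sum_congr rfl fun e he => ?_
    rw [fluxStart_apply, R.ends_first, R.ends_first, R.slopeStart_first hk hs hvh, R.src_first,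
      (Finset.mem_filter.1 he).2]

-- Solutions with equal Dirichlet traces on `B` are the continuous end values orthogonal to those
-- vanishing on `B`. Green's formula leaves the common value on `B` times the jump of the
-- derivative, which is `⟨w, Λ w⟩`. The trivial radical means that zero is the only solution with
-- zero data; existence follows by orthogonal projection.
set_option maxHeartbeats 400000 in
theorem robinMap_infty (hk : 0 ≤ k) (hs : ∀ e, k * H'.len e < Real.pi)
    (hnew : ∀ v ∈ B, ¬ R.IsNew (R.vert v)) (htwo : H.TwoSided B)
    (hrad : formRadical (H'.edgeForm k 0)
      (H'.contSpace ∅ ⊓ H'.vanishOn (R.mapVert B)) = ⊥) :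
    H.RobinWellPosed ∞ (k ^ 2) B ∧
      (∀ M, M = formOrth (H'.edgeForm k 0) (H'.contSpace ∅ ⊓ H'.vanishOn (R.mapVert B)) ⊓
          H'.contSpace ∅ →
        morseIndex (H.robinMap ∞ (k ^ 2) B) = negIndex (H'.edgeForm k 0) M ∧
        posIndex (H.robinMap ∞ (k ^ 2) B) = negIndex (-H'.edgeForm k 0) M ∧
        finrank ℂ M = B.card) := by
  set M := formOrth (H'.edgeForm k 0) (H'.contSpace ∅ ⊓ H'.vanishOn (R.mapVert B)) ⊓
    H'.contSpace ∅ with hMdef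
  have hM : M ≤ H'.kirchhoffVals k (R.mapVert B) := fun w hw =>
    ⟨contSpace_mono (empty_subset _) hw.2, hw.1⟩
  have hiff : ∀ u ∈ H.kirchhoffOff (k ^ 2) B,
      u ∈ H.robinSolutions ∞ (k ^ 2) B ↔ R.ends u ∈ M := by
    intro u hu
    have hu' := R.ends_mem_kirchhoffVals hk hs (fun v => R.vert_mem_mapVert) hu
    rw [mem_robinSolutions_iff]
    constructor
    · rintro ⟨-, h⟩
      refine ⟨hu'.2, fun x _ => ?_⟩
      by_cases hx : x ∈ R.mapVert B
      · obtain ⟨v, hv, rfl⟩ := R.exists_of_mem_mapVert hx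
        obtain ⟨⟨e₁, h1⟩, e₂, h2⟩ := htwo v hv
        have h3 := h v hv
        rw [sumIn_apply_of_iff _ h1, sumOut_apply_of_iff _ h2, robinTrace_infty,
          robinTrace_infty] at h3
        refine ⟨val e₂ (startPt e₂) u, fun e he => ?_, fun e he => ?_⟩
        · rw [(R.src_iff (hnew v hv) h2 e).1 he, R.ends_first]
        · rw [(R.tgt_iff (hnew v hv) h1 e).1 he, R.ends_last, h3]
      · exact hu'.1 x hx
    · intro h
      refine ⟨hu, fun v hv => ?_⟩
      obtain ⟨⟨e₁, h1⟩, e₂, h2⟩ := htwo v hv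
      rw [sumIn_apply_of_iff _ h1, sumOut_apply_of_iff _ h2, robinTrace_infty, robinTrace_infty]
      obtain ⟨a, ha, ha'⟩ := h.2 (R.vert v) (by simp)
      rw [← R.ends_first, ← R.ends_last, ha _ (by rw [R.src_first, (h2 e₂).2 rfl]),
        ha' _ (by rw [R.tgt_last, (h1 e₁).2 rfl])]
  obtain ⟨φ, hφ⟩ : ∃ φ : H.robinSolutions ∞ (k ^ 2) B ≃ₗ[ℂ] M,
      ∀ u, (φ u : F' → ℂ × ℂ) = R.ends u :=
    ⟨R.robinEquiv hk hs hnew ∞ M hM hiff, fun _ => rfl⟩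
  have hdata : ∀ (u : H.robinSolutions ∞ (k ^ 2) B) (b : B) (e : F), H.tgt e = b →
      H.robinData ∞ (k ^ 2) B u b = (R.ends u (R.last e)).2 := by
    intro u b e he
    obtain ⟨⟨e₁, h1⟩, e₂, h2⟩ := htwo b b.2
    change H.sumIn (robinTrace ∞) b u.1 = _
    rw [sumIn_apply_of_iff _ h1, robinTrace_infty, R.ends_last, (h1 e).1 he]
  have hbij : Function.Bijective (H.robinData ∞ (k ^ 2) B) := by
    constructor
    · refine (injective_iff_map_eq_zero _).2 fun u hu => ?_
      have hum : R.ends u.1 ∈ M := (hφ u) ▸ (φ u).2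
      have h0 : R.ends u.1 ∈ formRadical (H'.edgeForm k 0)
          (H'.contSpace ∅ ⊓ H'.vanishOn (R.mapVert B)) := by
        refine ⟨⟨hum.2, ?_⟩, hum.1⟩
        have hend : ∀ e, H'.tgt e ∈ R.mapVert B → (R.ends u.1 e).2 = 0 := by
          intro e he
          obtain ⟨v, hv, he⟩ := R.exists_of_mem_mapVert he
          obtain ⟨⟨e₁, h1⟩, e₂, h2⟩ := htwo v hv
          rw [(R.tgt_iff (hnew v hv) h1 e).1 he.symm,
            ← hdata u ⟨v, hv⟩ e₁ ((h1 e₁).2 rfl), hu]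
          rfl
        refine ⟨fun e he => ?_, hend⟩
        obtain ⟨v, hv, hev⟩ := R.exists_of_mem_mapVert he
        obtain ⟨⟨e₁, h1⟩, -⟩ := htwo v hv
        obtain ⟨a, ha, ha'⟩ := hum.2 (R.vert v) (by simp)
        have ht := (R.tgt_iff (hnew v hv) h1 _).2 rfl
        rw [ha e hev.symm, ← ha' _ ht]
        exact hend _ (by rw [ht, hev]; exact he)
      rw [hrad, Submodule.mem_bot] at h0
      have : φ u = 0 := Subtype.ext ((hφ u).trans h0)
      exact φ.map_eq_zero_iff.1 this
    · intro w
      let c : W' → ℂ := fun x => if h : ∃ b : B, R.vert b = x then w h.choose else 0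
      have hc : ∀ b : B, c (R.vert b) = w b := by
        intro b
        have hex : ∃ b' : B, R.vert b' = R.vert b := ⟨b, rfl⟩
        have : hex.choose = b := Subtype.ext (R.vert_inj hex.choose_spec)
        simp only [c, dif_pos hex, this]
      let y₀ : F' → ℂ × ℂ := fun e => (c (H'.src e), c (H'.tgt e))
      have hy₀ : y₀ ∈ H'.contSpace ∅ := fun x _ =>
        ⟨c x, fun e he => by simp [y₀, he], fun e he => by simp [y₀, he]⟩
      -- Any continuous extension of the data is corrected by its projection to the functions
      -- vanishing on `B`; this makes it a solution and keeps the data.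
      obtain ⟨y₁, hy₁, h1⟩ := exists_form_eq hrad ((H'.edgeForm k 0).flip y₀)
      have hy : y₀ - y₁ ∈ M := by
        refine ⟨fun z hz => ?_, Submodule.sub_mem _ hy₀ hy₁.1⟩
        rw [map_sub, h1 z hz, LinearMap.flip_apply, sub_self]
      refine ⟨φ.symm ⟨_, hy⟩, ?_⟩
      funext b
      obtain ⟨⟨e₁, h1⟩, -⟩ := htwo b b.2
      have ht := (R.tgt_iff (hnew b b.2) h1 _).2 rfl
      rw [hdata _ b e₁ ((h1 e₁).2 rfl), ← hφ, LinearEquiv.apply_symm_apply]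
      have h2 : (y₁ (R.last e₁)).2 = 0 := hy₁.2.2 _ (by
        rw [ht]; exact R.vert_mem_mapVert.2 b.2)
      change c (H'.tgt (R.last e₁)) - (y₁ (R.last e₁)).2 = w b
      rw [h2, sub_zero, ht, hc]
  have hform : ∀ u v : H.robinSolutions ∞ (k ^ 2) B, H'.edgeForm k 0 (φ u) (φ v) =
      ∑ b, (starRingEnd ℂ) (H.robinData ∞ (k ^ 2) B u b) *
        H.robinDualData ∞ (k ^ 2) B v b := by
    intro u v
    have hu := mem_robinSolutions_iff.1 u.2
    rw [hφ, hφ, R.edgeForm_ends hk hs hnew (σ := 0) (fun _ _ => rfl) hu.1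
      (mem_robinSolutions_iff.1 v.2).1]
    refine Finset.sum_congr rfl fun b _ => ?_
    obtain ⟨⟨e₁, h1⟩, e₂, h2⟩ := htwo b b.2
    have h3 := hu.2 b b.2
    change _ = (starRingEnd ℂ) (H.sumIn (robinTrace ∞) b u.1) *
      (H.sumIn (robinDualTrace ∞) b - H.sumOut (robinDualTrace ∞) b) v.1
    rw [LinearMap.sub_apply]
    rw [sumIn_apply_of_iff _ h1, sumOut_apply_of_iff _ h2, robinTrace_infty,
      robinTrace_infty] at h3
    rw [sumIn_apply_of_iff _ h1, sumIn_apply_of_iff _ h1, sumOut_apply_of_iff _ h2,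
      robinTrace_infty, robinDualTrace_infty, robinDualTrace_infty, sum_filter_eq_of_iff h1,
      sum_filter_eq_of_iff h2, ← h3]
    simp only [Pi.zero_apply, Complex.ofReal_zero, zero_mul, sub_zero]
    ring
  refine ⟨hbij, ?_⟩
  rintro _ rfl
  refine ⟨?_, ?_, ?_⟩
  · refine morseIndex_of_data (H'.edgeForm_isSymm k 0) M φ (H.robinMap ∞ (k ^ 2) B)
      (H.robinData ∞ (k ^ 2) B) hbij fun u v => ?_
    rw [robinMap_robinData hbij, hform]
  · refine posIndex_of_data (Q := -H'.edgeForm k 0) ⟨fun x y => ?_⟩ M φ (H.robinMap ∞ (k ^ 2) B)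
      (H.robinData ∞ (k ^ 2) B) hbij fun u v => ?_
    · rw [LinearMap.neg_apply, LinearMap.neg_apply, LinearMap.neg_apply, LinearMap.neg_apply,
        map_neg, (H'.edgeForm_isSymm k 0).eq]
    · rw [robinMap_robinData hbij, LinearMap.neg_apply, LinearMap.neg_apply, hform]
  · rw [(φ.symm.trans (LinearEquiv.ofBijective _ hbij)).finrank_eq]
    simp

-- Compared with `s = ∞`, values and fluxes exchange their roles: `u' - s u` is common to both sides
-- of `B`, and `u` may jump. Orthogonality to all continuous end values says that the fluxes match.
-- As `γˢ` is `-sin α` times the flux, the form becomes `-⟨w, Λ w⟩`, and its negative index counts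
-- the positive eigenvalues.
set_option maxHeartbeats 400000 in
theorem robinMap_coe (hk : 0 ≤ k) (hs : ∀ e, k * H'.len e < Real.pi)
    (hnew : ∀ v ∈ B, ¬ R.IsNew (R.vert v)) (htwo : H.TwoSided B) (s : ℝ) {σ : W' → ℝ}
    (hσ : σ = fun x => if x ∈ R.mapVert B then s else 0)
    (hrad : formRadical (H'.edgeForm k σ) (H'.contSpace (R.mapVert B)) = ⊥) :
    H.RobinWellPosed s (k ^ 2) B ∧
      posIndex (H.robinMap s (k ^ 2) B) = negIndex (H'.edgeForm k σ)
        (formOrth (H'.edgeForm k σ) (H'.contSpace ∅) ⊓ H'.contSpace (R.mapVert B)) := by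
  have hσ0 : ∀ x ∉ R.mapVert B, σ x = 0 := fun x hx => by simp [hσ, hx]
  have hσ1 : ∀ v ∈ B, σ (R.vert v) = s := fun v hv => by
    simp [hσ, R.vert_mem_mapVert, hv]
  have hsin := Complex.ofReal_ne_zero.2 (sin_pruferAngle_pos s).ne'
  set M := formOrth (H'.edgeForm k σ) (H'.contSpace ∅) ⊓ H'.contSpace (R.mapVert B) with hMdef
  have hM : M ≤ H'.kirchhoffVals k (R.mapVert B) := by
    intro w hw
    rw [mem_kirchhoffVals_iff]
    refine fun x hx => ⟨hw.2 x hx, ?_⟩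
    have h1 := mem_formOrth_contSpace_empty_iff.1 hw.1 x
    have h2 : ∀ e ∈ Finset.univ.filter (fun e => H'.src e = x),
        H'.fluxStart k σ e w = H'.slopeStart k e w := fun e he => by
      rw [fluxStart_apply, (Finset.mem_filter.1 he).2, hσ0 x hx]; simp
    have h3 : ∀ e ∈ Finset.univ.filter (fun e => H'.tgt e = x),
        H'.fluxEnd k σ e w = H'.slopeEnd k e w := fun e he => by
      rw [fluxEnd_apply, (Finset.mem_filter.1 he).2, hσ0 x hx]; simp
    rwa [Finset.sum_congr rfl h2, Finset.sum_congr rfl h3] at h1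
  have hfluxS : ∀ u ∈ H.helmholtz (k ^ 2), ∀ e, H.src e ∈ B →
      H'.fluxStart k σ (R.first e) (R.ends u) =
        der e (startPt e) u - s * val e (startPt e) u := fun u hu e he => by
    rw [fluxStart_apply, R.slopeStart_first hk hs hu, R.ends_first, R.src_first, hσ1 _ he]
  have hfluxE : ∀ u ∈ H.helmholtz (k ^ 2), ∀ e, H.tgt e ∈ B →
      H'.fluxEnd k σ (R.last e) (R.ends u) =
        der e (endPt e) u - s * val e (endPt e) u := fun u hu e he => by
    rw [fluxEnd_apply, R.slopeEnd_last hk hs hu, R.ends_last, R.tgt_last, hσ1 _ he]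
  have hiff : ∀ u ∈ H.kirchhoffOff (k ^ 2) B,
      u ∈ H.robinSolutions s (k ^ 2) B ↔ R.ends u ∈ M := by
    intro u hu
    have hu' := R.ends_mem_kirchhoffVals hk hs (fun v => R.vert_mem_mapVert) hu
    have huh := (mem_kirchhoffOff_iff.1 hu).1
    have key : ∀ v ∈ B, H.sumIn (robinTrace s) v u = H.sumOut (robinTrace s) v u ↔
        ∑ e ∈ Finset.univ.filter (fun e => H'.src e = R.vert v),
          H'.fluxStart k σ e (R.ends u) =
        ∑ e ∈ Finset.univ.filter (fun e => H'.tgt e = R.vert v),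
          H'.fluxEnd k σ e (R.ends u) := by
      intro v hv
      obtain ⟨⟨e₁, h1⟩, e₂, h2⟩ := htwo v hv
      have h1' := (h1 e₁).2 rfl
      have h2' := (h2 e₂).2 rfl
      rw [R.sum_src (hnew v hv), R.sum_tgt (hnew v hv), sum_filter_eq_of_iff h1,
        sum_filter_eq_of_iff h2, sumIn_apply_of_iff _ h1, sumOut_apply_of_iff _ h2,
        robinTrace_coe, robinTrace_coe, hfluxS u huh e₂ (h2' ▸ hv), hfluxE u huh e₁ (h1' ▸ hv),
        mul_right_inj' (neg_ne_zero.2 hsin)]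
      exact eq_comm
    rw [mem_robinSolutions_iff]
    constructor
    · rintro ⟨-, h⟩
      refine ⟨mem_formOrth_contSpace_empty_iff.2 fun x => ?_, hu'.1⟩
      by_cases hx : x ∈ R.mapVert B
      · obtain ⟨v, hv, rfl⟩ := R.exists_of_mem_mapVert hx
        exact (key v hv).1 (h v hv)
      · have h1 := (mem_kirchhoffVals_iff.1 hu' x hx).2
        have h2 : ∀ e ∈ Finset.univ.filter (fun e => H'.src e = x),
            H'.fluxStart k σ e (R.ends u) = H'.slopeStart k e (R.ends u) := fun e he => by
          rw [fluxStart_apply, (Finset.mem_filter.1 he).2, hσ0 x hx]; simp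
        have h3 : ∀ e ∈ Finset.univ.filter (fun e => H'.tgt e = x),
            H'.fluxEnd k σ e (R.ends u) = H'.slopeEnd k e (R.ends u) := fun e he => by
          rw [fluxEnd_apply, (Finset.mem_filter.1 he).2, hσ0 x hx]; simp
        rwa [Finset.sum_congr rfl h2, Finset.sum_congr rfl h3]
    · intro h
      exact ⟨hu, fun v hv => (key v hv).2 (mem_formOrth_contSpace_empty_iff.1 h.1 _)⟩
  obtain ⟨φ, hφ⟩ : ∃ φ : H.robinSolutions s (k ^ 2) B ≃ₗ[ℂ] M,
      ∀ u, (φ u : F' → ℂ × ℂ) = R.ends u :=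
    ⟨R.robinEquiv hk hs hnew s M hM hiff, fun _ => rfl⟩
  have hdata : ∀ (u : H.robinSolutions s (k ^ 2) B) (b : B) (e : F), H.tgt e = b →
      H.robinData s (k ^ 2) B u b = -Real.sin (pruferAngle (s : OnePoint ℝ)) *
        H'.fluxEnd k σ (R.last e) (R.ends u) := by
    intro u b e he
    obtain ⟨⟨e₁, h1⟩, e₂, h2⟩ := htwo b b.2
    have huh := (mem_kirchhoffOff_iff.1 (mem_robinSolutions_iff.1 u.2).1).1
    change H.sumIn (robinTrace s) b u.1 = _
    rw [sumIn_apply_of_iff _ h1, robinTrace_coe, (h1 e).1 he,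
      hfluxE u huh e₁ (((h1 e₁).2 rfl) ▸ b.2)]
  have hbij : Function.Bijective (H.robinData s (k ^ 2) B) := by
    constructor
    · refine (injective_iff_map_eq_zero _).2 fun u hu => ?_
      have hum : R.ends u.1 ∈ M := (hφ u) ▸ (φ u).2
      have hend : ∀ e, H'.tgt e ∈ R.mapVert B → H'.fluxEnd k σ e (R.ends u.1) = 0 := by
        intro e he
        obtain ⟨v, hv, he⟩ := R.exists_of_mem_mapVert he
        obtain ⟨⟨e₁, h1⟩, e₂, h2⟩ := htwo v hv
        have h3 := hdata u ⟨v, hv⟩ e₁ ((h1 e₁).2 rfl)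
        rw [hu] at h3
        rw [(R.tgt_iff (hnew v hv) h1 e).1 he.symm]
        exact (mul_eq_zero.1 h3.symm).resolve_left (neg_ne_zero.2 hsin)
      have hstart : ∀ e, H'.src e ∈ R.mapVert B → H'.fluxStart k σ e (R.ends u.1) = 0 := by
        intro e he
        obtain ⟨v, hv, hev⟩ := R.exists_of_mem_mapVert he
        obtain ⟨⟨e₁, h1⟩, e₂, h2⟩ := htwo v hv
        have h3 := mem_formOrth_contSpace_empty_iff.1 hum.1 (R.vert v)
        have ht := R.tgt_iff (hnew v hv) h1
        have hsr := R.src_iff (hnew v hv) h2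
        rw [sum_filter_eq_of_iff ht, sum_filter_eq_of_iff hsr,
          hend _ (by rw [(ht _).2 rfl, hev]; exact he)] at h3
        rw [(hsr e).1 hev.symm, h3]
      have h0 : R.ends u.1 ∈ formRadical (H'.edgeForm k σ) (H'.contSpace (R.mapVert B)) := by
        refine ⟨hum.2, fun z hz => ?_⟩
        rw [edgeForm_eq_sum hσ0 hz (hM hum)]
        refine Finset.sum_eq_zero fun x hx => ?_
        rw [Finset.sum_eq_zero, Finset.sum_eq_zero, sub_zero]
        · intro e he
          rw [hstart e ((Finset.mem_filter.1 he).2 ▸ hx), mul_zero]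
        · intro e he
          rw [hend e ((Finset.mem_filter.1 he).2 ▸ hx), mul_zero]
      rw [hrad, Submodule.mem_bot] at h0
      have : φ u = 0 := Subtype.ext ((hφ u).trans h0)
      exact φ.map_eq_zero_iff.1 this
    · intro w
      let c : W' → ℂ := fun x => if h : ∃ b : B, R.vert b = x then
        -(w h.choose / Real.sin (pruferAngle (s : OnePoint ℝ))) else 0
      have hc : ∀ b : B, c (R.vert b) = -(w b / Real.sin (pruferAngle (s : OnePoint ℝ))) := by
        intro b
        have hex : ∃ b' : B, R.vert b' = R.vert b := ⟨b, rfl⟩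
        have : hex.choose = b := Subtype.ext (R.vert_inj hex.choose_spec)
        simp only [c, dif_pos hex, this]
      have hc0 : ∀ x ∉ R.mapVert B, c x = 0 := by
        intro x hx
        refine dif_neg ?_
        rintro ⟨b, rfl⟩
        exact hx (R.vert_mem_mapVert.2 b.2)
      -- The vector representing this functional has the prescribed flux `c` on both sides of every
      -- point of `B`. On continuous test functions the two sides cancel.
      let l : (F' → ℂ × ℂ) →ₗ⋆[ℂ] ℂ :=
        { toFun := fun z => ∑ e, ((starRingEnd ℂ) (z e).2 * c (H'.tgt e) -
            (starRingEnd ℂ) (z e).1 * c (H'.src e))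
          map_add' := fun z z' => by
            rw [← Finset.sum_add_distrib]
            refine Finset.sum_congr rfl fun e _ => ?_
            simp only [Pi.add_apply, Prod.fst_add, Prod.snd_add, map_add]
            ring
          map_smul' := fun a z => by
            rw [smul_eq_mul, Finset.mul_sum]
            refine Finset.sum_congr rfl fun e _ => ?_
            simp only [Pi.smul_apply, Prod.smul_fst, Prod.smul_snd, smul_eq_mul, map_mul]
            ring }
      obtain ⟨y, hy, h1⟩ := exists_form_eq hrad l
      have hflux := flux_eq_of_form_eq (α := fun e => c (H'.src e))
        (β := fun e => c (H'.tgt e)) h1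
      have hyM : y ∈ M := by
        refine ⟨fun z hz => ?_, hy⟩
        rw [h1 z (contSpace_mono (empty_subset _) hz)]
        change ∑ e, ((starRingEnd ℂ) (z e).2 * c (H'.tgt e) -
            (starRingEnd ℂ) (z e).1 * c (H'.src e)) = 0
        rw [H'.sum_ends (fun e => (starRingEnd ℂ) (z e).1 * c (H'.src e))
          (fun e => (starRingEnd ℂ) (z e).2 * c (H'.tgt e)) (R.mapVert B)]
        · refine Finset.sum_eq_zero fun x hx => ?_
          obtain ⟨v, hv, rfl⟩ := R.exists_of_mem_mapVert hx
          obtain ⟨⟨e₁, h1⟩, e₂, h2⟩ := htwo v hv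
          have ht := R.tgt_iff (hnew v hv) h1
          have hsr := R.src_iff (hnew v hv) h2
          obtain ⟨a, ha, ha'⟩ := hz (R.vert v) (by simp)
          rw [sum_filter_eq_of_iff ht, sum_filter_eq_of_iff hsr, ha _ ((hsr _).2 rfl),
            ha' _ ((ht _).2 rfl), (ht _).2 rfl, (hsr _).2 rfl, sub_self]
        · intro x hx
          rw [Finset.sum_eq_zero, Finset.sum_eq_zero]
          · intro e he
            rw [(Finset.mem_filter.1 he).2, hc0 x hx, mul_zero]
          · intro e he
            rw [(Finset.mem_filter.1 he).2, hc0 x hx, mul_zero]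
      refine ⟨φ.symm ⟨_, hyM⟩, ?_⟩
      funext b
      obtain ⟨⟨e₁, h1⟩, -⟩ := htwo b b.2
      have ht := (R.tgt_iff (hnew b b.2) h1 _).2 rfl
      rw [hdata _ b e₁ ((h1 e₁).2 rfl), ← hφ, LinearEquiv.apply_symm_apply,
        hflux.2 _ (by rw [ht]; exact R.vert_mem_mapVert.2 b.2), ht, hc]
      field_simp
  have hform : ∀ u v : H.robinSolutions s (k ^ 2) B, H'.edgeForm k σ (φ u) (φ v) =
      -∑ b, (starRingEnd ℂ) (H.robinData s (k ^ 2) B u b) *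
        H.robinDualData s (k ^ 2) B v b := by
    intro u v
    have hu := mem_robinSolutions_iff.1 u.2
    have hv := mem_robinSolutions_iff.1 v.2
    -- Symmetry puts the common flux on `u` and the jump of the values on `v`, as in the Robin
    -- pairing.
    rw [hφ, hφ, ← (H'.edgeForm_isSymm k σ).eq, R.edgeForm_ends hk hs hnew hσ0 hv.1 hu.1, map_sum,
      ← Finset.sum_neg_distrib]
    refine Finset.sum_congr rfl fun b _ => ?_
    obtain ⟨⟨e₁, h1⟩, e₂, h2⟩ := htwo b b.2
    have h3 := hu.2 b b.2
    have h4 := hv.2 b b.2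
    have h5 : (Real.sin (pruferAngle (s : OnePoint ℝ)) : ℂ) ^ 2 * (1 + s ^ 2) = 1 := by
      exact_mod_cast sin_pruferAngle_sq s
    change _ = -((starRingEnd ℂ) (H.sumIn (robinTrace s) b u.1) *
      (H.sumIn (robinDualTrace s) b - H.sumOut (robinDualTrace s) b) v.1)
    rw [LinearMap.sub_apply]
    rw [sumIn_apply_of_iff _ h1, sumOut_apply_of_iff _ h2, robinTrace_coe,
      robinTrace_coe, mul_right_inj' (neg_ne_zero.2 hsin)] at h3 h4
    rw [sumIn_apply_of_iff _ h1, sumIn_apply_of_iff _ h1, sumOut_apply_of_iff _ h2,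
      robinTrace_coe, robinDualTrace_coe, robinDualTrace_coe, sum_filter_eq_of_iff h1,
      sum_filter_eq_of_iff h2, hσ1 _ b.2, ← h3]
    -- Since the fluxes agree, the derivative jumps by `s` times the jump of the value. So the dual
    -- trace jumps by `sin α (1 + s²)` times it, and `sin² α (1 + s²) = 1` absorbs the factors.
    have h6 : der e₁ (endPt e₁) v.1 = der e₂ (startPt e₂) v.1 +
        s * (val e₁ (endPt e₁) v.1 - val e₂ (startPt e₂) v.1) := by linear_combination h4
    rw [h6]
    simp only [map_sub, map_mul, map_neg, Complex.conj_conj, Complex.conj_ofReal]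
    linear_combination (-(val e₁ (endPt e₁) v.1 - val e₂ (startPt e₂) v.1) *
      ((starRingEnd ℂ) (der e₁ (endPt e₁) u.1) -
        s * (starRingEnd ℂ) (val e₁ (endPt e₁) u.1))) * h5
  refine ⟨hbij, ?_⟩
  refine posIndex_of_data (H'.edgeForm_isSymm k σ) M φ (H.robinMap s (k ^ 2) B)
    (H.robinData s (k ^ 2) B) hbij fun u v => ?_
  rw [robinMap_robinData hbij, hform]

end Refinement

namespace MetricGraph

/-! ### Combinatorics of subdivided edges. -/

section Pieces

variable {V E : Type*} {G : MetricGraph V E}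

theorem pt_congr {p q : Σ e, Icc (0 : ℝ) (G.len e)} (h1 : p.1 = q.1)
    (h2 : (p.2 : ℝ) = q.2) : G.pt p = G.pt q := by
  obtain ⟨e, x⟩ := p
  obtain ⟨e', y⟩ := q
  obtain rfl : e = e' := h1
  obtain rfl : x = y := Subtype.ext h2
  rfl

theorem pt_of_mem_Ioo (e : E) {x : ℝ} (hx : x ∈ Ioo 0 (G.len e)) :
    G.pt ⟨e, x, hx.1.le, hx.2.le⟩ = .inner e x hx := by
  simp [pt, hx.1.ne', hx.2.ne]

theorem pt_zero (p : Σ e, Icc (0 : ℝ) (G.len e)) (h : (p.2 : ℝ) = 0) :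
    G.pt p = .vertex (G.src p.1) := by
  simp [pt, h]

theorem pt_len (p : Σ e, Icc (0 : ℝ) (G.len e)) (h : (p.2 : ℝ) = G.len p.1) :
    G.pt p = .vertex (G.tgt p.1) := by
  simp [pt, h, (G.len_pos p.1).ne']

theorem eq_of_pt_eq_inner {p : Σ e, Icc (0 : ℝ) (G.len e)} {e : E} {x : ℝ}
    {hx : x ∈ Ioo 0 (G.len e)} (h : G.pt p = .inner e x hx) : p.1 = e ∧ (p.2 : ℝ) = x := by
  rw [pt] at h
  split_ifs at h
  injection h with h1 h2
  exact ⟨h1, h2⟩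

theorem eq_of_pt_eq_vertex {p : Σ e, Icc (0 : ℝ) (G.len e)} {v : V} (h : G.pt p = .vertex v) :
    ((p.2 : ℝ) = 0 ∧ G.src p.1 = v) ∨ ((p.2 : ℝ) = G.len p.1 ∧ G.tgt p.1 = v) := by
  rw [pt] at h
  split_ifs at h with h0 h1
  · injection h with h
    exact Or.inl ⟨h0, h⟩
  · injection h with h
    exact Or.inr ⟨h1, h⟩

theorem eq_of_pt_eq {p q : Σ e, Icc (0 : ℝ) (G.len e)} (h0 : (p.2 : ℝ) ≠ 0)
    (h1 : (p.2 : ℝ) ≠ G.len p.1) (h : G.pt q = G.pt p) : q.1 = p.1 ∧ (q.2 : ℝ) = p.2 := by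
  have : G.pt p = .inner p.1 p.2 ⟨lt_of_le_of_ne p.2.2.1 (Ne.symm h0),
      lt_of_le_of_ne p.2.2.2 h1⟩ := pt_of_mem_Ioo _ _
  exact eq_of_pt_eq_inner (h.trans this)

theorem mem_nodes_iff {B : Finset G.Point} {e : E} {x : ℝ} :
    x ∈ nodes B e ↔ x = 0 ∨ x = G.len e ∨ ∃ hx : x ∈ Ioo 0 (G.len e), .inner e x hx ∈ B := by
  rw [nodes, Finset.mem_insert, Finset.mem_insert, cuts, Finset.mem_biUnion]
  refine or_congr_right (or_congr_right ⟨?_, ?_⟩)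
  · rintro ⟨p, hp, h⟩
    cases p with
    | vertex v => simp at h
    | inner e' y hy =>
      by_cases he : e' = e
      · subst he
        simp only [if_true, Finset.mem_singleton] at h
        subst h
        exact ⟨hy, hp⟩
      · simp [he] at h
  · rintro ⟨hx, h⟩
    exact ⟨_, h, by simp⟩

theorem zero_mem_nodes (B : Finset G.Point) (e : E) : 0 ∈ nodes B e :=
  mem_nodes_iff.2 (Or.inl rfl)

theorem len_mem_nodes (B : Finset G.Point) (e : E) : G.len e ∈ nodes B e :=
  mem_nodes_iff.2 (Or.inr (Or.inl rfl))

theorem nodes_mono {B B' : Finset G.Point} (h : B ⊆ B') (e : E) : nodes B e ⊆ nodes B' e := by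
  intro x hx
  rw [mem_nodes_iff] at hx ⊢
  exact hx.imp id (Or.imp id fun ⟨h1, h2⟩ => ⟨h1, h h2⟩)

namespace Piece

variable {B B' : Finset G.Point}

/-- The initial node of a piece. -/
def lo (p : Piece B) : ℝ := p.2.1.1

/-- The final node of a piece. -/
def hi (p : Piece B) : ℝ := p.2.1.2

theorem lo_mem_nodes (p : Piece B) : p.lo ∈ nodes B p.1 := p.2.1.1.2

theorem hi_mem_nodes (p : Piece B) : p.hi ∈ nodes B p.1 := p.2.1.2.2

theorem lo_mem (p : Piece B) : p.lo ∈ Icc 0 (G.len p.1) := mem_Icc_of_mem_nodes p.lo_mem_nodes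

theorem hi_mem (p : Piece B) : p.hi ∈ Icc 0 (G.len p.1) := mem_Icc_of_mem_nodes p.hi_mem_nodes

theorem lo_lt_hi (p : Piece B) : p.lo < p.hi := p.2.2.1

theorem not_between (p : Piece B) {x : ℝ} (hx : x ∈ nodes B p.1) : ¬ (p.lo < x ∧ x < p.hi) :=
  p.2.2.2 x hx

theorem src_eq (p : Piece B) : (subdivide B).src p = G.pt ⟨p.1, p.lo, p.lo_mem⟩ := rfl

theorem tgt_eq (p : Piece B) : (subdivide B).tgt p = G.pt ⟨p.1, p.hi, p.hi_mem⟩ := rfl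

theorem len_eq (p : Piece B) : (subdivide B).len p = p.hi - p.lo := rfl

theorem ext {p q : Piece B} (h : p.1 = q.1) (h1 : p.lo = q.lo) (h2 : p.hi = q.hi) : p = q := by
  obtain ⟨e, ⟨⟨a, b⟩, h3⟩⟩ := p
  obtain ⟨e', ⟨⟨a', b'⟩, h4⟩⟩ := q
  obtain rfl : e = e' := h
  obtain rfl : a = a' := Subtype.ext h1
  obtain rfl : b = b' := Subtype.ext h2
  rfl

theorem hi_le_of_lt {p : Piece B} {x : ℝ} (hx : x ∈ nodes B p.1) (h : p.lo < x) : p.hi ≤ x :=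
  not_lt.1 fun h' => p.not_between hx ⟨h, h'⟩

theorem le_lo_of_lt {p : Piece B} {x : ℝ} (hx : x ∈ nodes B p.1) (h : x < p.hi) : x ≤ p.lo :=
  not_lt.1 fun h' => p.not_between hx ⟨h', h⟩

/-- A piece contains no node in its interior, so two pieces of one edge that overlap have the same
ends. Uniqueness from an initial or a final node is a special case. -/
theorem eq_of_overlap {p q : Piece B} (h : p.1 = q.1) (h1 : p.lo < q.hi) (h2 : q.lo < p.hi) :
    p = q := by
  have ap := h ▸ p.lo_mem_nodes
  have bp := h ▸ p.hi_mem_nodes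
  have aq := h ▸ q.lo_mem_nodes
  have bq := h ▸ q.hi_mem_nodes
  exact ext h (le_antisymm (le_lo_of_lt ap h1) (le_lo_of_lt aq h2))
    (le_antisymm (hi_le_of_lt bq h1) (hi_le_of_lt bp h2))

theorem eq_of_lo_eq {p q : Piece B} (h : p.1 = q.1) (h1 : p.lo = q.lo) : p = q :=
  eq_of_overlap h (h1 ▸ q.lo_lt_hi) (h1 ▸ p.lo_lt_hi)

theorem eq_of_hi_eq {p q : Piece B} (h : p.1 = q.1) (h1 : p.hi = q.hi) : p = q :=
  eq_of_overlap h (h1 ▸ p.lo_lt_hi) (h1 ▸ q.lo_lt_hi)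

theorem exists_lo_le_lt (B : Finset G.Point) {e : E} {x : ℝ} (h0 : 0 ≤ x) (h1 : x < G.len e) :
    ∃ p : Piece B, p.1 = e ∧ p.lo ≤ x ∧ x < p.hi := by
  have hA : ((nodes B e).filter fun y => y ≤ x).Nonempty :=
    ⟨0, Finset.mem_filter.2 ⟨zero_mem_nodes B e, h0⟩⟩
  have hB : ((nodes B e).filter fun y => x < y).Nonempty :=
    ⟨_, Finset.mem_filter.2 ⟨len_mem_nodes B e, h1⟩⟩
  obtain ⟨a, ha, ha'⟩ := Finset.exists_max_image _ id hA
  obtain ⟨b, hb, hb'⟩ := Finset.exists_min_image _ id hB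
  rw [Finset.mem_filter] at ha hb
  refine ⟨⟨e, ⟨⟨a, ha.1⟩, ⟨b, hb.1⟩⟩, ha.2.trans_lt hb.2, fun y hy hxy => ?_⟩, rfl, ha.2, hb.2⟩
  rcases le_or_gt y x with h | h
  · exact (ha' y (Finset.mem_filter.2 ⟨hy, h⟩)).not_gt hxy.1
  · exact (hb' y (Finset.mem_filter.2 ⟨hy, h⟩)).not_gt hxy.2

theorem exists_lo_eq {e : E} {x : ℝ} (hx : x ∈ nodes B e) (h1 : x ≠ G.len e) :
    ∃ p : Piece B, p.1 = e ∧ p.lo = x := by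
  have hx' := mem_Icc_of_mem_nodes hx
  obtain ⟨p, rfl, h2, h3⟩ := exists_lo_le_lt B hx'.1 (lt_of_le_of_ne hx'.2 h1)
  exact ⟨p, rfl, le_antisymm h2 (le_lo_of_lt hx h3)⟩

theorem exists_lo_lt_le (B : Finset G.Point) {e : E} {x : ℝ} (h0 : 0 < x) (h1 : x ≤ G.len e) :
    ∃ p : Piece B, p.1 = e ∧ p.lo < x ∧ x ≤ p.hi := by
  have hA : ((nodes B e).filter fun y => y < x).Nonempty :=
    ⟨0, Finset.mem_filter.2 ⟨zero_mem_nodes B e, h0⟩⟩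
  have hB : ((nodes B e).filter fun y => x ≤ y).Nonempty :=
    ⟨_, Finset.mem_filter.2 ⟨len_mem_nodes B e, h1⟩⟩
  obtain ⟨a, ha, ha'⟩ := Finset.exists_max_image _ id hA
  obtain ⟨b, hb, hb'⟩ := Finset.exists_min_image _ id hB
  rw [Finset.mem_filter] at ha hb
  refine ⟨⟨e, ⟨⟨a, ha.1⟩, ⟨b, hb.1⟩⟩, ha.2.trans_le hb.2, fun y hy hxy => ?_⟩, rfl, ha.2, hb.2⟩
  rcases lt_or_ge y x with h | h
  · exact (ha' y (Finset.mem_filter.2 ⟨hy, h⟩)).not_gt hxy.1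
  · exact (hb' y (Finset.mem_filter.2 ⟨hy, h⟩)).not_gt hxy.2

theorem exists_hi_eq {e : E} {x : ℝ} (hx : x ∈ nodes B e) (h0 : x ≠ 0) :
    ∃ p : Piece B, p.1 = e ∧ p.hi = x := by
  have hx' := mem_Icc_of_mem_nodes hx
  obtain ⟨p, rfl, h2, h3⟩ := exists_lo_lt_le B (lt_of_le_of_ne hx'.1 (Ne.symm h0)) hx'.2
  exact ⟨p, rfl, le_antisymm (hi_le_of_lt hx h2) h3⟩

theorem exists_next {p : Piece B} (h : p.hi ≠ G.len p.1) :
    ∃ q : Piece B, q.1 = p.1 ∧ q.lo = p.hi := exists_lo_eq p.hi_mem_nodes h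

theorem exists_prev {p : Piece B} (h : p.lo ≠ 0) :
    ∃ q : Piece B, q.1 = p.1 ∧ q.hi = p.lo := exists_hi_eq p.lo_mem_nodes h

/-- A function on the pieces of an edge that does not change from a piece to the next one is
constant. -/
theorem eq_of_consecutive {α : Type*} (g : Piece B → α) {p q : Piece B} (hpq : p.1 = q.1)
    (hle : p.lo ≤ q.lo) (h : ∀ r r' : Piece B, r.1 = r'.1 → r'.1 = q.1 → r.hi = r'.lo →
      p.lo ≤ r.lo → r'.lo ≤ q.lo → g r = g r') : g p = g q := by
  -- Induction on the number of nodes after the start of `p` up to the start of `q`; stepping back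
  -- from `q` to its predecessor removes one.
  obtain ⟨m, hm⟩ : ∃ m, ((nodes B q.1).filter fun x => p.lo < x ∧ x ≤ q.lo).card = m := ⟨_, rfl⟩
  induction m using Nat.strong_induction_on generalizing q with
  | _ m ih =>
    rcases hle.eq_or_lt with h0 | hlt
    · rw [eq_of_lo_eq hpq h0]
    · obtain ⟨r, hr, hrq⟩ := exists_prev (p := q) (p.lo_mem.1.trans_lt hlt).ne'
      have hpr : p.lo ≤ r.lo :=
        le_lo_of_lt (by rw [hr, ← hpq]; exact p.lo_mem_nodes) (by rw [hrq]; exact hlt)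
      have hrq' : r.lo < q.lo := hrq ▸ r.lo_lt_hi
      rw [← h r q hr rfl hrq hpr le_rfl]
      refine ih _ ?_ (hpq.trans hr.symm) hpr (fun s s' h1 h2 h3 h4 h5 =>
        h s s' h1 (h2.trans hr) h3 h4 (h5.trans hrq'.le)) rfl
      rw [← hm, hr]
      refine Finset.card_lt_card (Finset.ssubset_iff_of_subset ?_ |>.2 ⟨q.lo, ?_, ?_⟩)
      · intro x hx
        rw [Finset.mem_filter] at hx ⊢
        exact ⟨hx.1, hx.2.1, hx.2.2.trans hrq'.le⟩
      · exact Finset.mem_filter.2 ⟨q.lo_mem_nodes, hlt, le_rfl⟩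
      · rw [Finset.mem_filter]
        exact fun hx => (hx.2.2.trans_lt hrq').false

theorem exists_first (B : Finset G.Point) (e : E) : ∃ p : Piece B, p.1 = e ∧ p.lo = 0 :=
  exists_lo_eq (zero_mem_nodes B e) (G.len_pos e).ne

theorem exists_last (B : Finset G.Point) (e : E) : ∃ p : Piece B, p.1 = e ∧ p.hi = G.len e :=
  exists_hi_eq (len_mem_nodes B e) (G.len_pos e).ne'

theorem eq_of_src_eq {p q : Piece B} (h0 : p.lo ≠ 0)
    (h : (subdivide B).src q = (subdivide B).src p) : q = p := by
  have h1 : p.lo ≠ G.len p.1 := (p.lo_lt_hi.trans_le p.hi_mem.2).ne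
  have := eq_of_pt_eq (p := ⟨p.1, p.lo, p.lo_mem⟩) h0 h1 h
  exact eq_of_lo_eq this.1 this.2

theorem eq_of_tgt_eq {p q : Piece B} (h1 : p.hi ≠ G.len p.1)
    (h : (subdivide B).tgt q = (subdivide B).tgt p) : q = p := by
  have h0 : p.hi ≠ 0 := (p.lo_mem.1.trans_lt p.lo_lt_hi).ne'
  have := eq_of_pt_eq (p := ⟨p.1, p.hi, p.hi_mem⟩) h0 h1 h
  exact eq_of_hi_eq this.1 this.2

theorem tgt_eq_src {p q : Piece B} (h : p.1 = q.1) (h1 : p.hi = q.lo) :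
    (subdivide B).tgt p = (subdivide B).src q := pt_congr h h1

end Piece

theorem vertex_injective : Function.Injective (Point.vertex : V → G.Point) :=
  fun _ _ h => by injection h

/-- `subdivide B` as a refinement of `G`. -/
noncomputable def subdivideRefinement (G : MetricGraph V E) (B : Finset G.Point) :
    Refinement G (subdivide B) where
  proj p := p.1
  off p := p.lo
  vert := Point.vertex
  first e := (Piece.exists_first B e).choose
  last e := (Piece.exists_last B e).choose
  vert_inj := vertex_injective
  off_nonneg p := p.lo_mem.1
  off_add_le p := by
    rw [Piece.len_eq, add_sub_cancel]
    exact p.hi_mem.2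
  proj_first e := (Piece.exists_first B e).choose_spec.1
  off_first e := (Piece.exists_first B e).choose_spec.2
  eq_first p h := by
    have := (Piece.exists_first B p.1).choose_spec
    exact Piece.eq_of_lo_eq this.1.symm (h.trans this.2.symm)
  proj_last e := (Piece.exists_last B e).choose_spec.1
  off_last e := by
    rw [Piece.len_eq, add_sub_cancel]
    exact (Piece.exists_last B e).choose_spec.2
  eq_last p h := by
    rw [Piece.len_eq, add_sub_cancel] at h
    have := (Piece.exists_last B p.1).choose_spec
    exact Piece.eq_of_hi_eq this.1.symm (h.trans this.2.symm)
  src_first e := by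
    have := (Piece.exists_first B e).choose_spec
    rw [Piece.src_eq, pt_zero _ this.2, this.1]
  tgt_last e := by
    have := (Piece.exists_last B e).choose_spec
    rw [Piece.tgt_eq, pt_len _ (this.2.trans (congrArg G.len this.1.symm)), this.1]
  exists_next p h := by
    rw [Piece.len_eq, add_sub_cancel] at h ⊢
    obtain ⟨q, h1, h2⟩ := Piece.exists_next h
    exact ⟨q, h1.symm, h2⟩
  exists_prev p h := by
    obtain ⟨q, h1, h2⟩ := Piece.exists_prev h
    exact ⟨q, h1, by rw [Piece.len_eq, add_sub_cancel, h2]⟩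
  tgt_eq_src p q h h1 := by
    rw [Piece.len_eq, add_sub_cancel] at h1
    exact Piece.tgt_eq_src h h1.symm
  src_unique p h q hq := Piece.eq_of_src_eq h hq
  tgt_unique p h q hq := by
    rw [Piece.len_eq, add_sub_cancel] at h
    exact Piece.eq_of_tgt_eq h hq
  const g h p q hpq := by
    have key : ∀ p q : Piece B, p.1 = q.1 → p.lo ≤ q.lo → g p = g q := fun p q hpq hle =>
      Piece.eq_of_consecutive g hpq hle fun r r' h1 _ h2 _ _ =>
        h r r' h1 (by rw [Piece.len_eq, add_sub_cancel, h2])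
    rcases le_total p.lo q.lo with hle | hle
    · exact key p q hpq hle
    · exact (key q p hpq.symm hle).symm

theorem Piece.exists_coarse {B B' : Finset G.Point} (h : B ⊆ B') (p : Piece B') :
    ∃ q : Piece B, q.1 = p.1 ∧ q.lo ≤ p.lo ∧ p.hi ≤ q.hi := by
  obtain ⟨q, h1, h2, h3⟩ := Piece.exists_lo_le_lt B p.lo_mem.1
    (p.lo_lt_hi.trans_le p.hi_mem.2)
  exact ⟨q, h1, h2, Piece.hi_le_of_lt (nodes_mono h _ (h1 ▸ q.hi_mem_nodes)) h3⟩

/-- The piece of the coarser subdivision that contains a piece of the finer one. -/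
noncomputable def Piece.coarse {B B' : Finset G.Point} (h : B ⊆ B') (p : Piece B') : Piece B :=
  (p.exists_coarse h).choose

theorem Piece.coarse_spec {B B' : Finset G.Point} (h : B ⊆ B') (p : Piece B') :
    (p.coarse h).1 = p.1 ∧ (p.coarse h).lo ≤ p.lo ∧ p.hi ≤ (p.coarse h).hi :=
  (p.exists_coarse h).choose_spec

theorem Piece.coarse_eq {B B' : Finset G.Point} (h : B ⊆ B') {p : Piece B'} {q : Piece B}
    (h1 : q.1 = p.1) (h2 : q.lo < p.hi) (h3 : p.lo < q.hi) : p.coarse h = q := by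
  have := p.coarse_spec h
  exact Piece.eq_of_overlap (this.1.trans h1.symm) (this.2.1.trans_lt h3)
    (h2.trans_le this.2.2)

theorem Piece.exists_first_fine {B B' : Finset G.Point} (h : B ⊆ B') (q : Piece B) :
    ∃ p : Piece B', p.1 = q.1 ∧ p.lo = q.lo :=
  Piece.exists_lo_eq (nodes_mono h _ q.lo_mem_nodes) (q.lo_lt_hi.trans_le q.hi_mem.2).ne

theorem Piece.exists_last_fine {B B' : Finset G.Point} (h : B ⊆ B') (q : Piece B) :
    ∃ p : Piece B', p.1 = q.1 ∧ p.hi = q.hi :=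
  Piece.exists_hi_eq (nodes_mono h _ q.hi_mem_nodes) (q.lo_mem.1.trans_lt q.lo_lt_hi).ne'

theorem Piece.coarse_first {B B' : Finset G.Point} (h : B ⊆ B') {q : Piece B} {p : Piece B'}
    (h1 : p.1 = q.1) (h2 : p.lo = q.lo) : p.coarse h = q :=
  Piece.coarse_eq h h1.symm (h2 ▸ p.lo_lt_hi) (h2 ▸ q.lo_lt_hi)

theorem Piece.coarse_last {B B' : Finset G.Point} (h : B ⊆ B') {q : Piece B} {p : Piece B'}
    (h1 : p.1 = q.1) (h2 : p.hi = q.hi) : p.coarse h = q :=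
  Piece.coarse_eq h h1.symm (h2 ▸ q.lo_lt_hi) (h2 ▸ p.lo_lt_hi)

/-- `subdivide B'` as a refinement of `subdivide B` for `B ⊆ B'`. -/
noncomputable def fineRefinement {B B' : Finset G.Point} (hB : B ⊆ B') :
    Refinement (subdivide B) (subdivide B') where
  proj p := p.coarse hB
  off p := p.lo - (p.coarse hB).lo
  vert := id
  first q := (q.exists_first_fine hB).choose
  last q := (q.exists_last_fine hB).choose
  vert_inj := Function.injective_id
  off_nonneg p := sub_nonneg.2 (p.coarse_spec hB).2.1
  off_add_le p := by
    have := p.coarse_spec hB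
    rw [Piece.len_eq, Piece.len_eq]
    linarith [this.2.2]
  proj_first q := by
    have := (q.exists_first_fine hB).choose_spec
    exact Piece.coarse_first hB this.1 this.2
  off_first q := by
    have := (q.exists_first_fine hB).choose_spec
    rw [Piece.coarse_first hB this.1 this.2, this.2, sub_self]
  eq_first p h := by
    have := ((p.coarse hB).exists_first_fine hB).choose_spec
    exact Piece.eq_of_lo_eq ((p.coarse_spec hB).1.symm.trans this.1.symm)
      ((sub_eq_zero.1 h).trans this.2.symm)
  proj_last q := by
    have := (q.exists_last_fine hB).choose_spec
    exact Piece.coarse_last hB this.1 this.2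
  off_last q := by
    have := (q.exists_last_fine hB).choose_spec
    rw [Piece.coarse_last hB this.1 this.2, Piece.len_eq, Piece.len_eq, this.2]
    ring
  eq_last p h := by
    have := ((p.coarse hB).exists_last_fine hB).choose_spec
    rw [Piece.len_eq, Piece.len_eq] at h
    refine Piece.eq_of_hi_eq ((p.coarse_spec hB).1.symm.trans this.1.symm) ?_
    rw [this.2]
    linarith
  src_first q := by
    have := (q.exists_first_fine hB).choose_spec
    exact pt_congr this.1 this.2
  tgt_last q := by
    have := (q.exists_last_fine hB).choose_spec
    exact pt_congr this.1 this.2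
  exists_next p h := by
    rw [Piece.len_eq, Piece.len_eq] at h
    have hp := p.coarse_spec hB
    have hlt : p.hi < (p.coarse hB).hi := lt_of_le_of_ne hp.2.2 fun h' => h (by linarith)
    obtain ⟨q, h1, h2⟩ := Piece.exists_next (p := p)
      (hlt.trans_le (hp.1 ▸ (p.coarse hB).hi_mem.2)).ne
    have hq : q.coarse hB = p.coarse hB := by
      refine Piece.coarse_eq hB (hp.1.trans h1.symm) ?_ (h2 ▸ hlt)
      have := q.lo_lt_hi
      have := p.lo_lt_hi
      linarith [hp.2.1]
    refine ⟨q, hq.symm, ?_⟩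
    rw [hq, h2, Piece.len_eq]
    ring
  exists_prev p h := by
    have hp := p.coarse_spec hB
    have hlt : (p.coarse hB).lo < p.lo := lt_of_le_of_ne hp.2.1 fun h' => h (by linarith)
    obtain ⟨q, h1, h2⟩ := Piece.exists_prev (p := p)
      ((p.coarse hB).lo_mem.1.trans_lt hlt).ne'
    have hq : q.coarse hB = p.coarse hB := by
      refine Piece.coarse_eq hB (hp.1.trans h1.symm) (h2 ▸ hlt) ?_
      have := q.lo_lt_hi
      have := p.lo_lt_hi
      linarith [hp.2.2]
    refine ⟨q, hq, ?_⟩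
    rw [hq, Piece.len_eq, h2]
    ring
  tgt_eq_src p q h h1 := by
    rw [Piece.len_eq, h] at h1
    refine Piece.tgt_eq_src ?_ (by linarith)
    rw [← (p.coarse_spec hB).1, h, (q.coarse_spec hB).1]
  src_unique p h q hq := by
    have hp := p.coarse_spec hB
    have hlt : (p.coarse hB).lo < p.lo := lt_of_le_of_ne hp.2.1 fun h' => h (by linarith)
    exact Piece.eq_of_src_eq ((p.coarse hB).lo_mem.1.trans_lt hlt).ne' hq
  tgt_unique p h q hq := by
    rw [Piece.len_eq, Piece.len_eq] at h
    have hp := p.coarse_spec hB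
    have hlt : p.hi < (p.coarse hB).hi := lt_of_le_of_ne hp.2.2 fun h' => h (by linarith)
    exact Piece.eq_of_tgt_eq (hlt.trans_le (hp.1 ▸ (p.coarse hB).hi_mem.2)).ne hq
  const g h p q hpq := by
    have key : ∀ p q : Piece B', p.coarse hB = q.coarse hB → p.lo ≤ q.lo → g p = g q := by
      intro p q hpq hle
      have hp := p.coarse_spec hB
      have hq := q.coarse_spec hB
      refine Piece.eq_of_consecutive g (hp.1.symm.trans (hpq ▸ hq.1)) hle
        fun r r' h1 h2 h3 h4 h5 => ?_
      have hr := r.lo_lt_hi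
      have hr' := r'.lo_lt_hi
      have hql := q.lo_lt_hi
      rw [hpq] at hp
      have e1 : r.coarse hB = q.coarse hB :=
        Piece.coarse_eq hB (hq.1.trans (h1.trans h2).symm) (by linarith [hp.2.1])
          (by linarith [hq.2.2])
      have e2 : r'.coarse hB = q.coarse hB :=
        Piece.coarse_eq hB (hq.1.trans h2.symm) (by linarith [hp.2.1]) (by linarith [hq.2.2])
      refine h r r' (e1.trans e2.symm) ?_
      rw [e1, e2, Piece.len_eq, h3]
      ring
    rcases le_total p.lo q.lo with hle | hle
    · exact key p q hpq hle
    · exact (key q p hpq.symm hle).symm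

theorem fineRefinement_mapVert {B B' : Finset G.Point} (hB : B ⊆ B') (S : Finset G.Point) :
    (fineRefinement hB).mapVert S = S := by
  ext x
  exact (fineRefinement hB).vert_mem_mapVert (v := x)

/-- An inserted vertex lies strictly inside a piece of the coarse subdivision, where there is no
point of `B`. -/
theorem fineRefinement_not_isNew {B B' : Finset G.Point} (hB : B ⊆ B') :
    ∀ v ∈ B, ¬ (fineRefinement hB).IsNew ((fineRefinement hB).vert v) := by
  rintro v hv ⟨p, h0, h⟩
  have hp := p.coarse_spec hB
  have hlt : (p.coarse hB).lo < p.lo := lt_of_le_of_ne hp.2.1 fun h' => h0 (sub_eq_zero.2 h'.symm)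
  have hlt' : p.lo < (p.coarse hB).hi := p.lo_lt_hi.trans_le hp.2.2
  have hx : p.lo ∈ Ioo 0 (G.len p.1) :=
    ⟨(p.coarse hB).lo_mem.1.trans_lt hlt, p.lo_lt_hi.trans_le p.hi_mem.2⟩
  rw [Piece.src_eq, pt_of_mem_Ioo _ hx] at h
  refine (p.coarse hB).not_between (x := p.lo) ?_ ⟨hlt, hlt'⟩
  rw [hp.1]
  exact mem_nodes_iff.2 (Or.inr (Or.inr ⟨hx, h ▸ hv⟩))

/-- At a vertex of degree two the orientation convention gives an ingoing and an outgoing end, and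
the degree leaves no further one. At an inner point the two adjacent pieces play this role. -/
theorem subdivide_twoSided [Fintype E] (hG : G.Coherent) {B : Finset G.Point}
    (hB : ∀ p ∈ B, G.degree p = 2) : (subdivide B).TwoSided B := by
  intro v hv
  cases v with
  | inner e x hx =>
    have hx' : x ∈ nodes B e := mem_nodes_iff.2 (Or.inr (Or.inr ⟨hx, hv⟩))
    obtain ⟨p, h1, h2⟩ := Piece.exists_hi_eq hx' hx.1.ne'
    obtain ⟨q, h3, h4⟩ := Piece.exists_lo_eq hx' hx.2.ne
    refine ⟨⟨p, fun r => ⟨fun h => ?_, ?_⟩⟩, ⟨q, fun r => ⟨fun h => ?_, ?_⟩⟩⟩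
    · have := eq_of_pt_eq_inner h
      exact Piece.eq_of_hi_eq (this.1.trans h1.symm) (this.2.trans h2.symm)
    · rintro rfl
      rw [← pt_of_mem_Ioo]
      exact pt_congr h1 h2
    · have := eq_of_pt_eq_inner h
      exact Piece.eq_of_lo_eq (this.1.trans h3.symm) (this.2.trans h4.symm)
    · rintro rfl
      rw [← pt_of_mem_Ioo]
      exact pt_congr h3 h4
  | vertex v =>
    have hdeg : G.vertexDegree v = 2 := hB _ hv
    obtain ⟨⟨e₂, he₂⟩, e₁, he₁⟩ := hG v hdeg
    have c1 : 0 < (Finset.univ.filter fun e => G.src e = v).card :=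
      Finset.card_pos.2 ⟨e₂, by simp [he₂]⟩
    have c2 : 0 < (Finset.univ.filter fun e => G.tgt e = v).card :=
      Finset.card_pos.2 ⟨e₁, by simp [he₁]⟩
    rw [vertexDegree] at hdeg
    have u2 : ∀ e, G.src e = v → e = e₂ := fun e he =>
      Finset.card_le_one.1 (by omega : (Finset.univ.filter fun e => G.src e = v).card ≤ 1) e
        (by simp [he]) e₂ (by simp [he₂])
    have u1 : ∀ e, G.tgt e = v → e = e₁ := fun e he =>
      Finset.card_le_one.1 (by omega : (Finset.univ.filter fun e => G.tgt e = v).card ≤ 1) e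
        (by simp [he]) e₁ (by simp [he₁])
    obtain ⟨p, h1, h2⟩ := Piece.exists_last B e₁
    obtain ⟨q, h3, h4⟩ := Piece.exists_first B e₂
    refine ⟨⟨p, fun r => ⟨fun h => ?_, ?_⟩⟩, ⟨q, fun r => ⟨fun h => ?_, ?_⟩⟩⟩
    · rcases eq_of_pt_eq_vertex h with ⟨h5, -⟩ | ⟨h5, h6⟩
      · exact absurd h5 (r.lo_mem.1.trans_lt r.lo_lt_hi).ne'
      · have := u1 _ h6
        refine Piece.eq_of_hi_eq (this.trans h1.symm) ?_
        rw [h2, ← this]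
        exact h5
    · rintro rfl
      rw [Piece.tgt_eq, pt_len _ (h2.trans (congrArg G.len h1.symm)), h1, he₁]
    · rcases eq_of_pt_eq_vertex h with ⟨h5, h6⟩ | ⟨h5, -⟩
      · exact Piece.eq_of_lo_eq ((u2 _ h6).trans h3.symm) (h5.trans h4.symm)
      · exact absurd h5 (r.lo_lt_hi.trans_le r.hi_mem.2).ne
    · rintro rfl
      rw [Piece.src_eq, pt_zero _ h4, h3, he₂]

end Pieces

end MetricGraph

namespace MetricGraph

/-! ### Locally constant functions on the edges. -/

section Links

variable {V E : Type*} (G : MetricGraph V E)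

/-- The edge `e` ends or starts at the vertex `x`. -/
def Inc (e : E) (x : V) : Prop := G.src e = x ∨ G.tgt e = x

/-- The edges `p` and `q` have a common vertex outside `K`. -/
def Link (K : Set V) (p q : E) : Prop := ∃ x ∉ K, G.Inc p x ∧ G.Inc q x

/-- The functions on the edges that agree on edges with a common vertex outside `K`. -/
def linkSpace (K : Set V) : Submodule ℂ (E → ℂ) where
  carrier := {g | ∀ p q, G.Link K p q → g p = g q}
  add_mem' hf hg p q h := by rw [Pi.add_apply, Pi.add_apply, hf p q h, hg p q h]
  zero_mem' _ _ _ := rfl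
  smul_mem' a f hf p q h := by rw [Pi.smul_apply, Pi.smul_apply, hf p q h]

variable {G}

theorem linkSpace_mono {K K' : Set V} (h : K ⊆ K') : G.linkSpace K ≤ G.linkSpace K' :=
  fun _ hg p q ⟨x, hx, hxp⟩ => hg p q ⟨x, fun hxK => hx (h hxK), hxp⟩

/-- A function of the classes of linked edges is the same as an element of `linkSpace`. -/
def linkEquiv (K : Set V) : (Quot (G.Link K) → ℂ) ≃ₗ[ℂ] G.linkSpace K where
  toFun g := ⟨fun p => g (Quot.mk _ p), fun _ _ h => congrArg g (Quot.sound h)⟩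
  map_add' _ _ := rfl
  map_smul' _ _ := rfl
  invFun g := Quot.lift g.1 g.2
  left_inv g := by
    funext p
    induction p using Quot.ind
    rfl
  right_inv _ := rfl

/-- Replacing a number of components by a dimension makes it comparable with radicals and indices.
-/
theorem finrank_linkSpace [Finite E] (K : Set V) :
    Module.finrank ℂ (G.linkSpace K) = Nat.card (Quot (G.Link K)) := by
  have : Finite (Quot (G.Link K)) := Quot.finite _
  have := Fintype.ofFinite (Quot (G.Link K))
  rw [← (linkEquiv K).finrank_eq, Module.finrank_fintype_fun_eq_card, Nat.card_eq_fintype_card]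

end Links

/-! ### Connected components of the graph without finitely or infinitely many points. -/

section Domains

variable {V E : Type*} {G : MetricGraph V E}

theorem continuous_pt : Continuous G.pt := continuous_coinduced_rng

theorem isClosed_point_iff {Z : Set G.Point} :
    IsClosed Z ↔ ∀ e, IsClosed {t : Icc (0 : ℝ) (G.len e) | G.pt ⟨e, t⟩ ∈ Z} := by
  rw [isClosed_coinduced, isClosed_sigma_iff]
  rfl

/-- Every vertex of a connected metric graph with an edge is the end of an edge. -/
theorem exists_edge_of_connected [ConnectedSpace G.Point] [Nonempty E] (v : V) :
    ∃ p, G.pt p = .vertex v := by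
  by_contra! h
  have h1 : IsClopen {Point.vertex (G := G) v} := by
    constructor
    · rw [isClosed_point_iff]
      intro e
      simp [h]
    · rw [← isClosed_compl_iff, isClosed_point_iff]
      intro e
      simp [h]
  obtain ⟨e⟩ := ‹Nonempty E›
  have hm : G.len e / 2 ∈ Ioo 0 (G.len e) := ⟨half_pos (G.len_pos e), half_lt_self (G.len_pos e)⟩
  rcases isClopen_iff.1 h1 with h2 | h2
  · exact singleton_ne_empty _ h2
  · have : Point.inner e _ hm ∈ ({Point.vertex (G := G) v} : Set G.Point) := h2 ▸ mem_univ _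
    cases this

theorem pt_surjective [ConnectedSpace G.Point] [Nonempty E] : Function.Surjective G.pt := by
  rintro (v | ⟨e, x, hx⟩)
  · exact exists_edge_of_connected v
  · exact ⟨_, pt_of_mem_Ioo e hx⟩

namespace Piece

variable {B : Finset G.Point}

/-- The points of a piece. -/
def body (p : Piece B) : Set G.Point :=
  {x | ∃ t : Icc (0 : ℝ) (G.len p.1), (t : ℝ) ∈ Icc p.lo p.hi ∧ G.pt ⟨p.1, t⟩ = x}

/-- In every edge the preimage is the interval of the piece, if it lies there, together with some of
the two end points of the edge, which the gluing may add. -/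
theorem isClosed_body (p : Piece B) : IsClosed p.body := by
  rw [isClosed_point_iff]
  intro e
  set T := {t : Icc (0 : ℝ) (G.len e) | G.pt ⟨e, t⟩ ∈ p.body}
  have h1 : T = (T ∩ {startPt e, endPt e}) ∪
      {t | e = p.1 ∧ (t : ℝ) ∈ Icc p.lo p.hi} := by
    ext t
    constructor
    · intro ht
      by_cases h0 : (t : ℝ) = 0
      · exact Or.inl ⟨ht, Or.inl (Subtype.ext h0)⟩
      by_cases h1 : (t : ℝ) = G.len e
      · exact Or.inl ⟨ht, Or.inr (Subtype.ext h1)⟩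
      obtain ⟨s, hs, hst⟩ := ht
      have := eq_of_pt_eq (p := ⟨e, t⟩) h0 h1 hst
      exact Or.inr ⟨this.1.symm, this.2 ▸ hs⟩
    · rintro (ht | ⟨rfl, ht⟩)
      · exact ht.1
      · exact ⟨t, ht, rfl⟩
  rw [h1]
  refine (Set.Finite.isClosed ?_).union ?_
  · exact (Set.toFinite {startPt e, endPt e}).subset inter_subset_right
  · by_cases h : e = p.1
    · simp only [h, true_and]
      exact isClosed_Icc.preimage continuous_subtype_val
    · simp [h]

theorem eq_or_inc {p q : Piece B} {x : G.Point} (hp : x ∈ p.body) (hq : x ∈ q.body) :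
    q = p ∨ (subdivide B).Inc p x := by
  obtain ⟨t, ht, rfl⟩ := hp
  obtain ⟨s, hs, hst⟩ := hq
  rcases ht.1.eq_or_lt with h0 | h0
  · exact Or.inr (Or.inl (pt_congr rfl h0))
  rcases ht.2.eq_or_lt with h1 | h1
  · exact Or.inr (Or.inr (pt_congr rfl h1.symm))
  have := eq_of_pt_eq (p := ⟨p.1, t⟩) (p.lo_mem.1.trans_lt h0).ne' (h1.trans_le p.hi_mem.2).ne hst
  simp only at this
  exact Or.inl (eq_of_overlap this.1 (by linarith [hs.1]) (by linarith [hs.2]))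

theorem mem_body_of_inc {p : Piece B} {x : G.Point} (h : (subdivide B).Inc p x) : x ∈ p.body := by
  rcases h with rfl | rfl
  · exact ⟨⟨p.lo, p.lo_mem⟩, ⟨le_rfl, p.lo_lt_hi.le⟩, rfl⟩
  · exact ⟨⟨p.hi, p.hi_mem⟩, ⟨p.lo_lt_hi.le, le_rfl⟩, rfl⟩

theorem exists_mem_body [ConnectedSpace G.Point] [Nonempty E] (B : Finset G.Point) (x : G.Point) :
    ∃ p : Piece B, x ∈ p.body := by
  obtain ⟨⟨e, t⟩, rfl⟩ := pt_surjective x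
  rcases t.2.2.eq_or_lt with h | h
  · obtain ⟨p, rfl, h1, h2⟩ := exists_lo_lt_le B (G.len_pos e) le_rfl
    exact ⟨p, t, ⟨h1.le.trans h.ge, h.le.trans h2⟩, rfl⟩
  · obtain ⟨p, rfl, h1, h2⟩ := exists_lo_le_lt B t.2.1 h
    exact ⟨p, t, ⟨h1, h2.le⟩, rfl⟩

variable {S : Set G.Point} (hS : ∀ e x hx, Point.inner e x hx ∈ S → Point.inner e x hx ∈ B)

include hS in
theorem pt_notMem (p : Piece B) {t : ℝ} (ht : t ∈ Ioo p.lo p.hi) (h : t ∈ Icc 0 (G.len p.1)) :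
    G.pt ⟨p.1, t, h⟩ ∉ S := by
  have hx : t ∈ Ioo 0 (G.len p.1) := ⟨p.lo_mem.1.trans_lt ht.1, ht.2.trans_le p.hi_mem.2⟩
  rw [pt_of_mem_Ioo p.1 hx]
  exact fun hmem => p.not_between (mem_nodes_iff.2 (Or.inr (Or.inr ⟨hx, hS _ _ _ hmem⟩))) ht

-- `S` can meet a piece only at its two ends, so the remaining parameters form an order-connected
-- set.
include hS in
theorem isPreconnected_body_diff (p : Piece B) : IsPreconnected (p.body \ S) := by
  have hle := (G.len_pos p.1).le
  have hpr : ∀ t, (h : t ∈ Icc 0 (G.len p.1)) → projIcc 0 (G.len p.1) hle t = ⟨t, h⟩ :=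
    fun t h => projIcc_of_mem hle h
  have hsub : ∀ t ∈ Icc p.lo p.hi, t ∈ Icc 0 (G.len p.1) := fun t ht =>
    ⟨p.lo_mem.1.trans ht.1, ht.2.trans p.hi_mem.2⟩
  have h1 : p.body \ S = (fun t : ℝ => G.pt ⟨p.1, projIcc 0 (G.len p.1) hle t⟩) ''
      {t | t ∈ Icc p.lo p.hi ∧ G.pt ⟨p.1, projIcc 0 (G.len p.1) hle t⟩ ∉ S} := by
    ext x
    constructor
    · rintro ⟨⟨t, ht, rfl⟩, hxS⟩
      exact ⟨t, ⟨ht, by rwa [hpr t t.2]⟩, by simp only [hpr t t.2]⟩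
    · rintro ⟨t, ⟨ht, htS⟩, rfl⟩
      exact ⟨⟨⟨t, hsub t ht⟩, ht, by simp only [hpr t (hsub t ht)]⟩, htS⟩
  rw [h1]
  refine IsPreconnected.image ?_ _ (Continuous.continuousOn ?_)
  · rw [isPreconnected_iff_ordConnected]
    refine ⟨fun a ha b hb t ht => ?_⟩
    rcases ht.1.eq_or_lt with rfl | h2
    · exact ha
    rcases ht.2.eq_or_lt with rfl | h3
    · exact hb
    have ht' : t ∈ Ioo p.lo p.hi := ⟨ha.1.1.trans_lt h2, h3.trans_le hb.1.2⟩
    refine ⟨⟨ht'.1.le, ht'.2.le⟩, ?_⟩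
    rw [hpr t (hsub t ⟨ht'.1.le, ht'.2.le⟩)]
    exact p.pt_notMem hS ht' _
  · exact continuous_pt.comp (continuous_sigmaMk.comp continuous_projIcc)

include hS in
theorem nonempty_body_diff (p : Piece B) : ∃ x : (Sᶜ : Set G.Point), (x : G.Point) ∈ p.body := by
  have hlt := p.lo_lt_hi
  have ht : (p.lo + p.hi) / 2 ∈ Ioo p.lo p.hi := ⟨by linarith, by linarith⟩
  have h : (p.lo + p.hi) / 2 ∈ Icc 0 (G.len p.1) :=
    ⟨p.lo_mem.1.trans ht.1.le, ht.2.le.trans p.hi_mem.2⟩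
  exact ⟨⟨_, p.pt_notMem hS ht h⟩, ⟨_, h⟩, ⟨ht.1.le, ht.2.le⟩, rfl⟩

include hS in
theorem coe_eq_coe (p : Piece B) {x y : (Sᶜ : Set G.Point)} (hx : (x : G.Point) ∈ p.body)
    (hy : (y : G.Point) ∈ p.body) :
    (x : ConnectedComponents (Sᶜ : Set G.Point)) = y := by
  have h : IsPreconnected {z : (Sᶜ : Set G.Point) | (z : G.Point) ∈ p.body} := by
    rw [← Topology.IsInducing.subtypeVal.isPreconnected_image]
    have : Subtype.val '' {z : (Sᶜ : Set G.Point) | (z : G.Point) ∈ p.body} = p.body \ S := by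
      ext z
      constructor
      · rintro ⟨z, hz, rfl⟩
        exact ⟨hz, z.2⟩
      · exact fun hz => ⟨⟨z, hz.2⟩, hz.1, rfl⟩
    rw [this]
    exact p.isPreconnected_body_diff hS
  exact ConnectedComponents.coe_eq_coe'.2 (h.subset_connectedComponent hy hx)

end Piece

/-- The connected components of the graph without the points of `S` are counted by the locally
constant functions on the pieces. -/
theorem card_connectedComponents [Finite E] [ConnectedSpace G.Point] [Nonempty E]
    {B : Finset G.Point} {S : Set G.Point}
    (hS : ∀ e x hx, Point.inner e x hx ∈ S → Point.inner e x hx ∈ B) :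
    Nat.card (ConnectedComponents (Sᶜ : Set G.Point)) =
      Module.finrank ℂ ((subdivide B).linkSpace S) := by
  have := Fintype.ofFinite E
  rw [finrank_linkSpace]
  choose pc hpc using Piece.exists_mem_body (G := G) B
  choose rep hrep using fun p : Piece B => p.nonempty_body_diff hS
  let : TopologicalSpace (Quot ((subdivide B).Link S)) := ⊥
  have : DiscreteTopology (Quot ((subdivide B).Link S)) := ⟨rfl⟩
  have : Finite (Quot ((subdivide B).Link S)) := Quot.finite _
  let c : (Sᶜ : Set G.Point) → Quot ((subdivide B).Link S) := fun x => Quot.mk _ (pc x)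
  have hc : ∀ (x : (Sᶜ : Set G.Point)) p, (x : G.Point) ∈ p.body → c x = Quot.mk _ p := by
    intro x p hp
    rcases Piece.eq_or_inc (hpc x) hp with h | h
    · rw [h]
    rcases Piece.eq_or_inc hp (hpc x) with h' | h'
    · exact congrArg _ h'
    exact Quot.sound ⟨x, x.2, h, h'⟩
  have hcont : Continuous c := by
    -- Preimages under the class map are finite unions of closed pieces, so the map to the discrete
    -- space of classes is continuous and separates the components.
    refine continuous_iff_isClosed.2 fun K _ => ?_
    have : c ⁻¹' K = Subtype.val ⁻¹' ⋃ p ∈ {p : Piece B | Quot.mk _ p ∈ K}, p.body := by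
      ext x
      simp only [mem_preimage, mem_iUnion, mem_ofPred_eq, exists_prop]
      constructor
      · exact fun hx => ⟨pc x, hx, hpc x⟩
      · rintro ⟨p, hp, hx⟩
        rwa [hc x p hx]
    rw [this]
    exact ((Set.toFinite _).isClosed_biUnion fun p _ => p.isClosed_body).preimage
      continuous_subtype_val
  refine Nat.card_congr
    { toFun := hcont.connectedComponentsLift
      invFun := Quot.lift (fun p => (rep p : ConnectedComponents (Sᶜ : Set G.Point))) ?_
      left_inv := ?_
      right_inv := ?_ }
  · rintro p q ⟨x, hx, h1, h2⟩
    exact (p.coe_eq_coe hS (y := ⟨x, hx⟩) (hrep p) (Piece.mem_body_of_inc h1)).trans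
      (q.coe_eq_coe hS (Piece.mem_body_of_inc h2) (hrep q))
  · intro x
    obtain ⟨x, rfl⟩ := ConnectedComponents.surjective_coe x
    rw [hcont.connectedComponentsLift_apply_coe]
    exact (pc x).coe_eq_coe hS (hrep _) (hpc x)
  · intro p
    induction p using Quot.ind with
    | mk p =>
    change hcont.connectedComponentsLift (rep p) = _
    rw [hcont.connectedComponentsLift_apply_coe]
    exact hc _ _ (hrep p)

end Domains

end MetricGraph

/-! ### Elementary bounds for the index. -/

section IndexBounds

open Module

variable {A : Type*} [AddCommGroup A] [Module ℂ A] [FiniteDimensional ℂ A]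
  {Q Q' : A →ₗ⋆[ℂ] A →ₗ[ℂ] ℂ} {Y : Submodule ℂ A}

theorem negIndex_eq_zero_of_nonneg (h : ∀ x ∈ Y, 0 ≤ (Q x x).re) : negIndex Q Y = 0 := by
  have := negIndex_add_finrank_le (le_refl Y) h
  omega

/-- The `n` linear conditions are injective on a negative definite subspace. -/
theorem negIndex_le_of_ker_nonneg {n : ℕ} (L : Y →ₗ[ℂ] (Fin n → ℂ))
    (h : ∀ x : Y, L x = 0 → 0 ≤ (Q x x).re) : negIndex Q Y ≤ n := by
  obtain ⟨N, hN, hd, hneg⟩ := exists_finrank_eq_negIndex Q Y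
  have hinj : Function.Injective (L ∘ₗ Submodule.inclusion hN) := by
    refine (injective_iff_map_eq_zero _).2 fun x hx => ?_
    by_contra h0
    have h1 := h (Submodule.inclusion hN x) hx
    exact h1.not_gt (hneg x x.2 fun h2 => h0 (Subtype.ext h2))
  have := LinearMap.finrank_le_finrank_of_injective hinj
  rw [← hd]
  simpa using this

omit [FiniteDimensional ℂ A] in
theorem negIndex_congr (h : ∀ x ∈ Y, Q x x = Q' x x) : negIndex Q Y = negIndex Q' Y := by
  have h1 : ∀ N ≤ Y, NegDefOn Q N ↔ NegDefOn Q' N := fun N hN =>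
    forall₂_congr fun x hx => by rw [h x (hN hx)]
  unfold negIndex
  congr 1
  ext d
  exact exists_congr fun N => and_congr_right fun hN => and_congr_right fun _ => h1 N hN

end IndexBounds

namespace MetricGraph

/-! ### Picone's identity and the index at the eigenvalue. -/

section Picone

open Module Filter Topology

variable {V E : Type*} {G : MetricGraph V E} {k : ℝ}

/-- The end values `f₀`, `f₁` and slopes `a₀`, `a₁` of a real solution of `-u'' = k² u` with
Neumann–Kirchhoff conditions that does not change its sign on any edge. -/
structure SignedSolution [Fintype E] (G : MetricGraph V E) (k : ℝ) (f₀ f₁ a₀ a₁ : E → ℝ) : Prop where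
  slopeStart_eq : ∀ e, coB k (G.len e) * f₁ e - coA k (G.len e) * f₀ e = a₀ e
  slopeEnd_eq : ∀ e, coA k (G.len e) * f₁ e - coB k (G.len e) * f₀ e = a₁ e
  sign : ∀ e, 0 ≤ f₀ e * f₁ e
  start_ne : ∀ e, f₀ e = 0 → a₀ e ≠ 0
  cont : ∀ x, ∃ c, (∀ e, G.src e = x → f₀ e = c) ∧ ∀ e, G.tgt e = x → f₁ e = c
  balance : ∀ x, ∑ e ∈ Finset.univ.filter (fun e => G.src e = x), a₀ e =
    ∑ e ∈ Finset.univ.filter (fun e => G.tgt e = x), a₁ e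

/-- The end values of `g f` for a function `g` that is constant on every edge. -/
noncomputable def mulEnds (f₀ f₁ : E → ℝ) : (E → ℂ) →ₗ[ℂ] (E → ℂ × ℂ) where
  toFun g e := (g e * f₀ e, g e * f₁ e)
  map_add' g h := by
    funext e
    simp [add_mul]
  map_smul' a g := by
    funext e
    simp [mul_assoc]

theorem mulEnds_apply (f₀ f₁ : E → ℝ) (g : E → ℂ) (e : E) :
    mulEnds f₀ f₁ g e = (g e * f₀ e, g e * f₁ e) := rfl

theorem eq_mul_of_mem_vanishOn {f₀ f₁ : E → ℝ} {N : Finset V}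
    (hN : ∀ e, G.src e ∈ N ↔ f₀ e = 0) (hN' : ∀ e, G.tgt e ∈ N ↔ f₁ e = 0) {w : E → ℂ × ℂ} (hw : w ∈ G.vanishOn N) :
    w = fun e => ((w e).1 / f₀ e * f₀ e, (w e).2 / f₁ e * f₁ e) := by
  funext e
  refine Prod.ext ?_ ?_
  · by_cases h0 : f₀ e = 0
    · simp [hw.1 e ((hN e).2 h0)]
    · exact (div_mul_cancel₀ _ (Complex.ofReal_ne_zero.2 h0)).symm
  · by_cases h0 : f₁ e = 0
    · simp [hw.2 e ((hN' e).2 h0)]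
    · exact (div_mul_cancel₀ _ (Complex.ofReal_ne_zero.2 h0)).symm

theorem mulEnds_mem_vanishOn {f₀ f₁ : E → ℝ} {N : Finset V}
    (hN : ∀ e, G.src e ∈ N ↔ f₀ e = 0) (hN' : ∀ e, G.tgt e ∈ N ↔ f₁ e = 0) (g : E → ℂ) : mulEnds f₀ f₁ g ∈ G.vanishOn N := by
  constructor
  · intro e he
    rw [mulEnds_apply, (hN e).1 he]; simp
  · intro e he
    rw [mulEnds_apply, (hN' e).1 he]; simp

theorem slope_mulEnds {f₀ f₁ a₀ a₁ : E → ℝ} (g : E → ℂ) (h : ∀ e, coB k (G.len e) * f₁ e - coA k (G.len e) * f₀ e = a₀ e)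
    (h' : ∀ e, coA k (G.len e) * f₁ e - coB k (G.len e) * f₀ e = a₁ e) (e : E) :
    G.slopeStart k e (mulEnds f₀ f₁ g) = g e * a₀ e ∧
      G.slopeEnd k e (mulEnds f₀ f₁ g) = g e * a₁ e := by
  rw [slopeStart_apply, slopeEnd_apply, mulEnds_apply, ← h, ← h']
  push_cast
  exact ⟨by ring, by ring⟩

variable [Fintype E]

namespace SignedSolution

variable {f₀ f₁ a₀ a₁ : E → ℝ} (h : G.SignedSolution k f₀ f₁ a₀ a₁)
  {σ : V → ℝ} {B N : Finset V}

include h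

theorem end_ne_zero {e : E} (h0 : f₀ e = 0) : f₁ e ≠ 0 := by
  intro h1
  apply h.start_ne e h0
  rw [← h.slopeStart_eq e, h0, h1]
  ring

theorem mulEnds_injective : Function.Injective (mulEnds f₀ f₁ : (E → ℂ) →ₗ[ℂ] _) := by
  refine (injective_iff_map_eq_zero _).2 fun g hg => ?_
  funext e
  have h1 := congrFun hg e
  rw [mulEnds_apply, Pi.zero_apply, Prod.mk_eq_zero] at h1
  by_cases h0 : f₀ e = 0
  · exact (mul_eq_zero.1 h1.2).resolve_right (Complex.ofReal_ne_zero.2 (h.end_ne_zero h0))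
  · exact (mul_eq_zero.1 h1.1).resolve_right (Complex.ofReal_ne_zero.2 h0)

/-- A discrete version of Picone's identity. -/
theorem picone (u v : E → ℂ) :
    (G.edgeForm k σ (fun e => (u e * f₀ e, v e * f₁ e)) (fun e => (u e * f₀ e, v e * f₁ e))).re =
      ∑ e, coB k (G.len e) * (f₀ e * f₁ e) * ‖u e - v e‖ ^ 2 +
      ∑ e, ((a₁ e - σ (G.tgt e) * f₁ e) * f₁ e * ‖v e‖ ^ 2 -
        (a₀ e - σ (G.src e) * f₀ e) * f₀ e * ‖u e‖ ^ 2) := by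
  rw [edgeForm_self_re, ← Finset.sum_add_distrib]
  refine Finset.sum_congr rfl fun e _ => ?_
  rw [← h.slopeStart_eq e, ← h.slopeEnd_eq e]
  simp only [← Complex.normSq_eq_norm_sq, Complex.normSq_apply, Complex.add_re, Complex.add_im,
    Complex.sub_re, Complex.sub_im, Complex.re_mul_ofReal, Complex.im_mul_ofReal]
  ring

/-- The boundary terms of Picone's identity vanish vertex by vertex: either the multiplier is common
wherever `f` is nonzero and the Kirchhoff balance of `f` applies, or `f` satisfies the Robin
condition and every single term is zero. -/
theorem form_eq_sum (u v : E → ℂ)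
    (huv : ∀ x, (σ x = 0 ∧ ∃ c, (∀ e, G.src e = x → f₀ e = 0 ∨ u e = c) ∧
        ∀ e, G.tgt e = x → f₁ e = 0 ∨ v e = c) ∨
      ((∀ e, G.src e = x → a₀ e = σ x * f₀ e) ∧ ∀ e, G.tgt e = x → a₁ e = σ x * f₁ e)) :
    (G.edgeForm k σ (fun e => (u e * f₀ e, v e * f₁ e)) (fun e => (u e * f₀ e, v e * f₁ e))).re =
      ∑ e, coB k (G.len e) * (f₀ e * f₁ e) * ‖u e - v e‖ ^ 2 := by
  rw [h.picone, add_eq_left, G.sum_ends _ _ ∅, Finset.sum_empty]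
  intro x _
  rcases huv x with ⟨hσ, c, hc, hc'⟩ | ⟨hc, hc'⟩
  · obtain ⟨d, hd, hd'⟩ := h.cont x
    trans d * ‖c‖ ^ 2 * ∑ e ∈ Finset.univ.filter (fun e => G.src e = x), a₀ e
    · rw [Finset.mul_sum]
      refine Finset.sum_congr rfl fun e he => ?_
      have he := (Finset.mem_filter.1 he).2
      rw [he, hσ]
      rcases hc e he with h0 | h0
      · rw [← hd e he, h0]; ring
      · rw [← hd e he, h0]; ring
    · rw [h.balance x, Finset.mul_sum]
      refine Finset.sum_congr rfl fun e he => ?_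
      have he := (Finset.mem_filter.1 he).2
      rw [he, hσ]
      rcases hc' e he with h0 | h0
      · rw [← hd' e he, h0]; ring
      · rw [← hd' e he, h0]; ring
  · rw [Finset.sum_eq_zero, Finset.sum_eq_zero]
    · intro e he
      have he := (Finset.mem_filter.1 he).2
      rw [he, hc' e he]; ring
    · intro e he
      have he := (Finset.mem_filter.1 he).2
      rw [he, hc e he]; ring

variable (hσ : ∀ x ∉ B, σ x = 0)
  (hB : ∀ e, G.src e ∈ B → a₀ e = σ (G.src e) * f₀ e)
  (hB' : ∀ e, G.tgt e ∈ B → a₁ e = σ (G.tgt e) * f₁ e)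
  (hN : ∀ e, G.src e ∈ N ↔ f₀ e = 0) (hN' : ∀ e, G.tgt e ∈ N ↔ f₁ e = 0)

include hσ hB hB' hN hN'

theorem form_eq_sum_of_mem {w : E → ℂ × ℂ} (hw : w ∈ G.contSpace B ⊓ G.vanishOn N) :
    (G.edgeForm k σ w w).re = ∑ e, coB k (G.len e) * (f₀ e * f₁ e) *
      ‖(w e).1 / f₀ e - (w e).2 / f₁ e‖ ^ 2 := by
  -- At a zero of `f` the quotient is a division by zero. This is harmless, because `w` vanishes
  -- there too and the coefficient `f₀ f₁` removes the term.
  conv_lhs => rw [eq_mul_of_mem_vanishOn hN hN' hw.2]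
  refine h.form_eq_sum _ _ fun x => ?_
  by_cases hx : x ∈ B
  · exact Or.inr ⟨fun e he => by rw [hB e (he ▸ hx), he], fun e he => by rw [hB' e (he ▸ hx), he]⟩
  · obtain ⟨a, ha, ha'⟩ := hw.1 x hx
    obtain ⟨c, hc, hc'⟩ := h.cont x
    refine Or.inl ⟨hσ x hx, a / c, fun e he => Or.inr ?_, fun e he => Or.inr ?_⟩
    · rw [ha e he, hc e he]
    · rw [ha' e he, hc' e he]

variable (hk : 0 ≤ k) (hs : ∀ e, k * G.len e < Real.pi)
include hk hs

theorem form_nonneg {w : E → ℂ × ℂ} (hw : w ∈ G.contSpace B ⊓ G.vanishOn N) :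
    0 ≤ (G.edgeForm k σ w w).re := by
  rw [h.form_eq_sum_of_mem hσ hB hB' hN hN' hw]
  exact Finset.sum_nonneg fun e _ => mul_nonneg
    (mul_nonneg (coB_pos hk (G.len_pos e) (hs e)).le (h.sign e)) (sq_nonneg _)

theorem negIndex_vanishOn_eq_zero :
    negIndex (G.edgeForm k σ) (G.contSpace B ⊓ G.vanishOn N) = 0 :=
  negIndex_eq_zero_of_nonneg fun _ hw => h.form_nonneg hσ hB hB' hN hN' hk hs hw

/-- One condition for each nodal point, the vanishing of one incoming value, leads into `vanishOn
N`: points of `N` are not in `B`, so functions are continuous there. On that subspace the form is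
nonnegative. -/
theorem negIndex_contSpace_le (hNB : ∀ x ∈ N, x ∉ B) (hex : ∀ x ∈ N, ∃ e, G.tgt e = x) :
    negIndex (G.edgeForm k σ) (G.contSpace B) ≤ N.card := by
  choose η' hη' using hex
  let η : N → E := fun x => η' x x.2
  have hη : ∀ x : N, G.tgt (η x) = x := fun x => hη' x x.2
  let L : G.contSpace B →ₗ[ℂ] (Fin N.card → ℂ) := LinearMap.pi fun i =>
    LinearMap.snd ℂ ℂ ℂ ∘ₗ LinearMap.proj (η (N.equivFin.symm i)) ∘ₗ (G.contSpace B).subtype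
  refine negIndex_le_of_ker_nonneg L fun w hw => ?_
  refine h.form_nonneg hσ hB hB' hN hN' hk hs ⟨w.2, ?_⟩
  have key : ∀ x, (w.1 (η x)).2 = 0 := by
    intro x
    have := congrFun hw (N.equivFin x)
    simpa [L] using this
  constructor
  · intro e he
    obtain ⟨a, ha, ha'⟩ := w.2 _ (hNB _ he)
    rw [ha e rfl, ← ha' _ (hη ⟨_, he⟩), key]
  · intro e he
    obtain ⟨a, ha, ha'⟩ := w.2 _ (hNB _ he)
    rw [ha' e rfl, ← ha' _ (hη ⟨_, he⟩), key]

omit hσ hB hB' hk hs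

theorem mulEnds_mem_contSpace {K : Set V} {g : E → ℂ} (hg : g ∈ G.linkSpace (K ∪ N)) :
    mulEnds f₀ f₁ g ∈ G.contSpace K := by
  intro x hx
  obtain ⟨c, hc, hc'⟩ := h.cont x
  by_cases hxN : x ∈ N
  · refine ⟨0, fun e he => ?_, fun e he => ?_⟩
    · rw [mulEnds_apply, (hN e).1 (he ▸ hxN)]; simp
    · rw [mulEnds_apply, (hN' e).1 (he ▸ hxN)]; simp
  · have hx' : x ∉ K ∪ (N : Set V) := fun h => h.elim hx hxN
    by_cases hex : ∃ e, G.Inc e x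
    · obtain ⟨e₀, he₀⟩ := hex
      refine ⟨g e₀ * c, fun e he => ?_, fun e he => ?_⟩
      · rw [mulEnds_apply, hc e he, hg e e₀ ⟨x, hx', Or.inl he, he₀⟩]
      · rw [mulEnds_apply, hc' e he, hg e e₀ ⟨x, hx', Or.inr he, he₀⟩]
    · exact ⟨0, fun e he => absurd ⟨e, Or.inl he⟩ hex, fun e he => absurd ⟨e, Or.inr he⟩ hex⟩

include hσ hB hB'

/-- A multiple of `f` that is constant on every edge has equal quotients at both ends, so the Picone
sum is zero. At zeros of `f` the multiplier may jump. -/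
theorem form_mulEnds {g : E → ℂ} (hg : g ∈ G.linkSpace ((B : Set V) ∪ N)) :
    (G.edgeForm k σ (mulEnds f₀ f₁ g) (mulEnds f₀ f₁ g)).re = 0 := by
  have := h.form_eq_sum (σ := σ) g g fun x => ?_
  · refine Eq.trans this (Finset.sum_eq_zero fun e _ => ?_)
    rw [sub_self, norm_zero]
    ring
  by_cases hx : x ∈ B
  · exact Or.inr ⟨fun e he => by rw [hB e (he ▸ hx), he], fun e he => by rw [hB' e (he ▸ hx), he]⟩
  · refine Or.inl ⟨hσ x hx, ?_⟩
    by_cases hxN : x ∈ N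
    · exact ⟨0, fun e he => Or.inl ((hN e).1 (he ▸ hxN)), fun e he => Or.inl ((hN' e).1 (he ▸ hxN))⟩
    · have hx' : x ∉ (B : Set V) ∪ (N : Set V) := fun h => h.elim hx hxN
      by_cases hex : ∃ e, G.Inc e x
      · obtain ⟨e₀, he₀⟩ := hex
        exact ⟨g e₀, fun e he => Or.inr (hg e e₀ ⟨x, hx', Or.inl he, he₀⟩),
          fun e he => Or.inr (hg e e₀ ⟨x, hx', Or.inr he, he₀⟩)⟩
      · exact ⟨0, fun e he => absurd ⟨e, Or.inl he⟩ hex, fun e he => absurd ⟨e, Or.inr he⟩ hex⟩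

omit hσ hB hB' hN hN'

/-- A function with `w.1 f₁ = w.2 f₀` on every edge is a multiple of `f` on every edge. -/
theorem exists_mulEnds_eq {w : E → ℂ × ℂ} (hw : ∀ e, (w e).1 * f₁ e = (w e).2 * f₀ e) :
    ∃ g, mulEnds f₀ f₁ g = w := by
  refine ⟨fun e => if f₀ e = 0 then (w e).2 / f₁ e else (w e).1 / f₀ e, ?_⟩
  funext e
  rw [mulEnds_apply]
  by_cases h0 : f₀ e = 0
  · have h1 := Complex.ofReal_ne_zero.2 (h.end_ne_zero h0)
    have h2 := hw e
    rw [h0, Complex.ofReal_zero, mul_zero] at h2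
    refine Prod.ext ?_ ?_
    · simp [h0, (mul_eq_zero.1 h2).resolve_right h1]
    · simp [h0, div_mul_cancel₀ _ h1]
  · have h1 := Complex.ofReal_ne_zero.2 h0
    refine Prod.ext ?_ ?_
    · simp [h0, div_mul_cancel₀ _ h1]
    · simp only [h0, if_false]
      rw [div_mul_eq_mul_div, hw e, mul_div_cancel_right₀ _ h1]

theorem eq_of_cont {g : E → ℂ} {x : V} {a : ℂ}
    (ha : ∀ e, G.src e = x → (mulEnds f₀ f₁ g e).1 = a)
    (ha' : ∀ e, G.tgt e = x → (mulEnds f₀ f₁ g e).2 = a)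
    (h0 : ∀ e, G.src e = x → f₀ e ≠ 0) (h1 : ∀ e, G.tgt e = x → f₁ e ≠ 0) {p q : E}
    (hp : G.Inc p x) (hq : G.Inc q x) : g p = g q := by
  obtain ⟨c, hc, hc'⟩ := h.cont x
  have key : ∀ e, G.Inc e x → g e * c = a ∧ c ≠ 0 := by
    rintro e (he | he)
    · exact ⟨by rw [← ha e he, mulEnds_apply, hc e he], hc e he ▸ h0 e he⟩
    · exact ⟨by rw [← ha' e he, mulEnds_apply, hc' e he], hc' e he ▸ h1 e he⟩
  exact mul_right_cancel₀ (Complex.ofReal_ne_zero.2 (key p hp).2)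
    ((key p hp).1.trans (key q hq).1.symm)

-- The form is nonnegative, so the radical consists of the isotropic vectors. By Picone these are
-- edgewise multiples of `f`, and continuity at vertices where `f ≠ 0` makes the multipliers of
-- linked edges equal.
include hN hN' hk hs in
theorem formRadical_vanishOn :
    formRadical (G.edgeForm k 0) (G.contSpace ∅ ⊓ G.vanishOn N) =
      (G.linkSpace N).map (mulEnds f₀ f₁) := by
  have hnn : ∀ w ∈ G.contSpace ∅ ⊓ G.vanishOn N, 0 ≤ (G.edgeForm k 0 w w).re := fun w hw =>
    h.form_nonneg (σ := 0) (B := ∅) (fun _ _ => rfl) (by simp) (by simp) hN hN' hk hs (by simpa using hw)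
  apply le_antisymm
  · rintro w ⟨hw, hwo⟩
    have h0 := congrArg Complex.re (hwo w hw)
    rw [h.form_eq_sum_of_mem (σ := 0) (B := ∅) (fun _ _ => rfl) (by simp) (by simp) hN hN'
      (by simpa using hw), Complex.zero_re, Finset.sum_eq_zero_iff_of_nonneg (fun e _ => mul_nonneg
        (mul_nonneg (coB_pos hk (G.len_pos e) (hs e)).le (h.sign e))
        (sq_nonneg _))] at h0
    obtain ⟨g, rfl⟩ := h.exists_mulEnds_eq (w := w) (by
      intro e
      by_cases e0 : f₀ e = 0
      · rw [hw.2.1 e ((hN e).2 e0), e0]; simp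
      by_cases e1 : f₁ e = 0
      · rw [hw.2.2 e ((hN' e).2 e1), e1]; simp
      have h1 := h0 e (Finset.mem_univ e)
      have h2 : coB k (G.len e) * (f₀ e * f₁ e) ≠ 0 :=
        mul_ne_zero (coB_pos hk (G.len_pos e) (hs e)).ne' (mul_ne_zero e0 e1)
      have h3 := (mul_eq_zero.1 h1).resolve_left h2
      rw [sq_eq_zero_iff, norm_eq_zero, sub_eq_zero,
        div_eq_div_iff (Complex.ofReal_ne_zero.2 e0) (Complex.ofReal_ne_zero.2 e1)] at h3
      exact h3)
    refine ⟨g, ?_, rfl⟩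
    rintro p q ⟨x, hx, hp, hq⟩
    obtain ⟨a, ha, ha'⟩ := hw.1 x (by simp)
    exact h.eq_of_cont ha ha' (fun e he h0 => hx (he ▸ (hN e).2 h0))
      (fun e he h0 => hx (he ▸ (hN' e).2 h0)) hp hq
  · rintro _ ⟨g, hg, rfl⟩
    have hmem : mulEnds f₀ f₁ g ∈ G.contSpace ∅ ⊓ G.vanishOn N :=
      ⟨h.mulEnds_mem_contSpace hN hN' (by simpa using hg), mulEnds_mem_vanishOn hN hN' g⟩
    refine ⟨hmem, fun z hz => form_eq_zero_of_nonneg (G.edgeForm_isSymm k 0) hnn hmem ?_ hz⟩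
    exact h.form_mulEnds (σ := 0) (B := ∅) (fun _ _ => rfl) (by simp) (by simp) hN hN'
      (by simpa using hg)

include hN hN' hk hs in
theorem finrank_formRadical_vanishOn :
    finrank ℂ (formRadical (G.edgeForm k 0) (G.contSpace ∅ ⊓ G.vanishOn N)) =
      finrank ℂ (G.linkSpace N) := by
  rw [h.formRadical_vanishOn hN hN' hk hs]
  exact (Submodule.equivMapOfInjective _ h.mulEnds_injective _).finrank_eq.symm

omit h in
include hσ in
theorem formRadical_le_kirchhoffVals :
    formRadical (G.edgeForm k σ) (G.contSpace B) ≤ G.kirchhoffVals k B := by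
  intro w hw
  rw [mem_kirchhoffVals_iff]
  refine fun x hx => ⟨hw.1 x hx, ?_⟩
  have h1 := mem_formOrth_contSpace_empty_iff.1
    (formOrth_antitone (contSpace_mono (empty_subset _)) hw.2) x
  have h2 : ∀ e ∈ Finset.univ.filter (fun e => G.src e = x),
      G.fluxStart k σ e w = G.slopeStart k e w := fun e he => by
    rw [fluxStart_apply, (Finset.mem_filter.1 he).2, hσ x hx]; simp
  have h3 : ∀ e ∈ Finset.univ.filter (fun e => G.tgt e = x),
      G.fluxEnd k σ e w = G.slopeEnd k e w := fun e he => by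
    rw [fluxEnd_apply, (Finset.mem_filter.1 he).2, hσ x hx]; simp
  rwa [Finset.sum_congr rfl h2, Finset.sum_congr rfl h3] at h1

-- Elements of this radical satisfy the Kirchhoff condition also at the nodal points. There `f' ≠
-- 0`, so equality of the derivatives excludes a jump of the multiplier, and jumps remain possible
-- only on `B`.
include hσ hN hN' in
theorem formRadical_contSpace_le (htwo : G.TwoSided N)
    (hW : ∀ w ∈ formRadical (G.edgeForm k σ) (G.contSpace B), ∀ e,
      (w e).1 * f₁ e = (w e).2 * f₀ e) :
    formRadical (G.edgeForm k σ) (G.contSpace B) ≤ (G.linkSpace B).map (mulEnds f₀ f₁) := by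
  intro w hw
  obtain ⟨g, rfl⟩ := h.exists_mulEnds_eq (hW w hw)
  refine ⟨g, ?_, rfl⟩
  rintro p q ⟨x, hx, hp, hq⟩
  obtain ⟨⟨a, ha, ha'⟩, hsum⟩ := mem_kirchhoffVals_iff.1 (formRadical_le_kirchhoffVals hσ hw) x hx
  by_cases hxN : x ∈ N
  · obtain ⟨⟨e₁, h1⟩, e₂, h2⟩ := htwo x hxN
    have hb := h.balance x
    rw [sum_filter_eq_of_iff h1, sum_filter_eq_of_iff h2] at hb hsum
    rw [(slope_mulEnds g h.slopeStart_eq h.slopeEnd_eq _).1,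
      (slope_mulEnds g h.slopeStart_eq h.slopeEnd_eq _).2, ← hb] at hsum
    have hne : (a₀ e₂ : ℂ) ≠ 0 := Complex.ofReal_ne_zero.2
      (h.start_ne _ ((hN _).1 (by rw [(h2 e₂).2 rfl]; exact hxN)))
    have h12 : g e₂ = g e₁ := mul_right_cancel₀ hne hsum
    have key : ∀ e, G.Inc e x → g e = g e₁ := by
      rintro e (he | he)
      · rw [(h2 e).1 he, h12]
      · rw [(h1 e).1 he]
    rw [key p hp, key q hq]
  · exact h.eq_of_cont ha ha' (fun e he h0 => hxN (he ▸ (hN e).2 h0))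
      (fun e he h0 => hxN (he ▸ (hN' e).2 h0)) hp hq

-- Upper bound: the index at `k` is at most the number of nodal points, and the radical adds at most
-- the dimension of `linkSpace B`. Lower bound: multiples of `f` that may jump on `B ∪ N` are
-- isotropic at `k`, hence negative for larger parameters.
include hσ hB hB' hN hN' hk hs in
theorem eventually_negIndex_contSpace (hNB : ∀ x ∈ N, x ∉ B) (htwo : G.TwoSided N)
    (hW : ∀ w ∈ formRadical (G.edgeForm k σ) (G.contSpace B), ∀ e,
      (w e).1 * f₁ e = (w e).2 * f₀ e)
    (hdim : finrank ℂ (G.linkSpace B) + N.card ≤ finrank ℂ (G.linkSpace ((B : Set V) ∪ N))) :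
    ∀ᶠ k' in 𝓝[>] k, negIndex (G.edgeForm k' σ) (G.contSpace B) =
        finrank ℂ (G.linkSpace B) + N.card ∧
      formRadical (G.edgeForm k' σ) (G.contSpace B) = ⊥ := by
  have h1 := h.negIndex_contSpace_le hσ hB hB' hN hN' hk hs hNB fun x hx => by
    obtain ⟨⟨e₁, h1⟩, -⟩ := htwo x hx
    exact ⟨e₁, (h1 e₁).2 rfl⟩
  have h2 : finrank ℂ (formRadical (G.edgeForm k σ) (G.contSpace B)) ≤
      finrank ℂ (G.linkSpace B) :=
    (Submodule.finrank_mono (h.formRadical_contSpace_le hσ hN hN' htwo hW)).trans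
      (Submodule.finrank_map_le _ _)
  filter_upwards [G.edgeForm_negIndex_eventually_right σ hk hs (G.contSpace B),
    self_mem_nhdsWithin, nhdsWithin_le_nhds (eventually_short hs)] with k' h3 hkk hs'
  refine ⟨le_antisymm (by omega) ?_, h3.2⟩
  refine hdim.trans ?_
  rw [(Submodule.equivMapOfInjective _ h.mulEnds_injective
    (G.linkSpace ((B : Set V) ∪ N))).finrank_eq]
  refine finrank_le_negIndex ?_ ?_
  · rintro _ ⟨g, hg, rfl⟩
    exact h.mulEnds_mem_contSpace hN hN' hg
  · rintro _ ⟨g, hg, rfl⟩ h0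
    rw [← h.form_mulEnds hσ hB hB' hN hN' hg]
    exact G.edgeForm_strictAnti σ hk hkk hs' h0

end SignedSolution

end Picone

end MetricGraph

/-! ### Zeros of the `s`-condition along a real solution. -/

section RealEvolution

/-- The evolution of the pair `(u, u')` of a real solution of `-u'' = k² u`. -/
noncomputable def revolve (k x : ℝ) (p : ℝ × ℝ) : ℝ × ℝ :=
  (cosSol k x * p.1 + sinSol k x * p.2, cosSol k x * p.2 - k ^ 2 * sinSol k x * p.1)

theorem revolve_add (k x y : ℝ) (p : ℝ × ℝ) :
    revolve k (x + y) p = revolve k x (revolve k y p) := by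
  ext
  · simp only [revolve, cosSol_add, sinSol_add]
    ring
  · simp only [revolve, cosSol_add, sinSol_add]
    ring

@[simp]
theorem revolve_zero (k : ℝ) (p : ℝ × ℝ) : revolve k 0 p = p := by
  simp [revolve]

theorem revolve_ne_zero {k x : ℝ} {p : ℝ × ℝ} (hp : p ≠ 0) : revolve k x p ≠ 0 := by
  intro h
  have h1 := revolve_add k (-x) x p
  rw [h, neg_add_cancel, revolve_zero] at h1
  apply hp
  rw [h1]
  simp [revolve]

theorem evolve_ofReal (k x : ℝ) (p : ℝ × ℝ) :
    evolve k x ((p.1 : ℂ), (p.2 : ℂ)) =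
      (((revolve k x p).1 : ℂ), ((revolve k x p).2 : ℂ)) := by
  simp [evolve, revolve]

theorem continuous_revolve (k : ℝ) (p : ℝ × ℝ) : Continuous fun x => revolve k x p := by
  have h1 : Continuous (cosSol k) :=
    continuous_iff_continuousAt.2 fun x => (hasDerivAt_cosSol k x).continuousAt
  have h2 : Continuous (sinSol k) :=
    continuous_iff_continuousAt.2 fun x => (hasDerivAt_sinSol k x).continuousAt
  unfold revolve
  fun_prop

/-- The defect of the `s`-condition. -/
def sDefect : OnePoint ℝ → ℝ × ℝ → ℝ
  | ∞, p => p.1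
  | (s : ℝ), p => p.2 - s * p.1

theorem sDefect_infty (p : ℝ × ℝ) : sDefect ∞ p = p.1 := rfl

theorem sDefect_coe (s : ℝ) (p : ℝ × ℝ) : sDefect (s : OnePoint ℝ) p = p.2 - s * p.1 := rfl

theorem sDefect_neg (s : OnePoint ℝ) (p : ℝ × ℝ) : sDefect s (-p) = -sDefect s p := by
  induction s using OnePoint.rec with
  | infty => rfl
  | coe s =>
    simp only [sDefect_coe, Prod.fst_neg, Prod.snd_neg]
    ring

theorem continuous_sDefect (s : OnePoint ℝ) : Continuous (sDefect s) := by
  induction s using OnePoint.rec with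
  | infty => exact continuous_fst
  | coe s => exact continuous_snd.sub (continuous_const.mul continuous_fst)

/-- Starting from a point that satisfies the `s`-condition, the defect after distance `x` is a
nonzero multiple of `sinSol k x`. For real `s` the factor contains `k² + s²`, hence the assumption
`0 < k`: for `k = s = 0` a constant satisfies the condition everywhere. -/
theorem sDefect_revolve_ne_zero {k x : ℝ} {s : OnePoint ℝ} {p : ℝ × ℝ} (hk : 0 ≤ k)
    (hs : s = ∞ ∨ 0 < k) (hp : p ≠ 0) (h0 : sDefect s p = 0) (hx : 0 < x)
    (hxk : k * x < Real.pi) : sDefect s (revolve k x p) ≠ 0 := by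
  have hS := (sinSol_pos hk hx hxk).ne'
  induction s using OnePoint.rec with
  | infty =>
    rw [sDefect_infty] at h0 ⊢
    have h1 : p.2 ≠ 0 := fun h => hp (Prod.ext h0 h)
    rw [revolve, h0, mul_zero, zero_add]
    exact mul_ne_zero hS h1
  | coe s =>
    have hk' : 0 < k := hs.resolve_left (OnePoint.coe_ne_infty s)
    rw [sDefect_coe] at h0 ⊢
    have h2 : p.2 = s * p.1 := by linarith
    have h1 : p.1 ≠ 0 := fun h => hp (Prod.ext h (by rw [h2, h, mul_zero]; rfl))
    have h3 : (revolve k x p).2 - s * (revolve k x p).1 =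
        -(sinSol k x * ((k ^ 2 + s ^ 2) * p.1)) := by
      simp only [revolve, h2]
      ring
    rw [h3]
    exact neg_ne_zero.2 (mul_ne_zero hS (mul_ne_zero (by positivity) h1))

theorem finite_sDefect_zeros {k : ℝ} {s : OnePoint ℝ} {p : ℝ × ℝ} (hk : 0 ≤ k)
    (hs : s = ∞ ∨ 0 < k) (hp : p ≠ 0) (l : ℝ) :
    {x | x ∈ Icc 0 l ∧ sDefect s (revolve k x p) = 0}.Finite := by
  -- With cells of length `1 / (k + 1)` one has `k δ ≤ 1 < π`, also for `k = 0`. So each cell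
  -- contains at most one zero.
  have hδ : 0 < 1 / (k + 1) := by positivity
  have hδk : k * (1 / (k + 1)) < Real.pi := by
    have h1 : k * (1 / (k + 1)) ≤ 1 := by
      rw [mul_one_div, div_le_one (by positivity)]
      linarith
    linarith [Real.pi_gt_three]
  refine Set.Finite.of_finite_image
    (f := fun x => ⌊x / (1 / (k + 1))⌋) ((Set.finite_Icc 0 ⌊l / (1 / (k + 1))⌋).subset ?_) ?_
  · rintro _ ⟨x, hx, rfl⟩
    exact ⟨Int.floor_nonneg.2 (div_nonneg hx.1.1 hδ.le),
      Int.floor_le_floor (div_le_div_of_nonneg_right hx.1.2 hδ.le)⟩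
  · have key : ∀ x y, sDefect s (revolve k x p) = 0 → sDefect s (revolve k y p) = 0 →
        ⌊x / (1 / (k + 1))⌋ = ⌊y / (1 / (k + 1))⌋ → ¬ x < y := by
      intro x y hx hy hxy hlt
      have h1 := Int.abs_sub_lt_one_of_floor_eq_floor hxy
      rw [abs_sub_comm, ← sub_div, abs_of_pos (div_pos (sub_pos.2 hlt) hδ), div_lt_one hδ] at h1
      have h2 := sDefect_revolve_ne_zero hk hs (revolve_ne_zero hp) hx (sub_pos.2 hlt)
        ((mul_le_mul_of_nonneg_left h1.le hk).trans_lt hδk)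
      rw [← revolve_add, sub_add_cancel] at h2
      exact h2 hy
    intro x hx y hy hxy
    exact le_antisymm (not_lt.1 (key y x hy.2 hx.2 hxy.symm)) (not_lt.1 (key x y hx.2 hy.2 hxy))

/-- Translation by half a period `π / k` changes the sign of the solution and of its defect, so the
intermediate value theorem gives a zero. -/
theorem exists_sDefect_zero {k : ℝ} (hk : 0 < k) (s : OnePoint ℝ) (p : ℝ × ℝ) {l : ℝ}
    (hl : Real.pi < k * l) : ∃ x ∈ Ioo 0 l, sDefect s (revolve k x p) = 0 := by
  have hπ : 0 < Real.pi / k := div_pos Real.pi_pos hk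
  have hπl : Real.pi / k < l := by rwa [div_lt_iff₀ hk, mul_comm]
  have h1 : revolve k (Real.pi / k) p = -p := by
    have e1 : k * (Real.pi / k) = Real.pi := mul_div_cancel₀ _ hk.ne'
    have e2 : k * sinSol k (Real.pi / k) = 0 := by rw [mul_sinSol, e1, Real.sin_pi]
    have e3 : sinSol k (Real.pi / k) = 0 := (mul_eq_zero.1 e2).resolve_left hk.ne'
    have e4 : cosSol k (Real.pi / k) = -1 := by rw [cosSol, e1, Real.cos_pi]
    ext
    · simp [revolve, e3, e4]
    · simp [revolve, e3, e4]
  have h2 : sDefect s (revolve k (Real.pi / k) p) = -sDefect s p := by rw [h1, sDefect_neg]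
  have hc : Continuous fun x => sDefect s (revolve k x p) :=
    (continuous_sDefect s).comp (continuous_revolve k p)
  have h3 : sDefect s (revolve k 0 p) = sDefect s p := by rw [revolve_zero]
  rcases lt_trichotomy (sDefect s p) 0 with h | h | h
  · obtain ⟨x, hx, hx0⟩ := intermediate_value_Ioo hπ.le hc.continuousOn
      (show (0 : ℝ) ∈ Ioo _ _ from ⟨by rw [h3]; exact h, by rw [h2]; linarith⟩)
    exact ⟨x, ⟨hx.1, hx.2.trans hπl⟩, hx0⟩
  · exact ⟨_, ⟨hπ, hπl⟩, by rw [h2, h, neg_zero]⟩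
  · obtain ⟨x, hx, hx0⟩ := intermediate_value_Ioo' hπ.le hc.continuousOn
      (show (0 : ℝ) ∈ Ioo _ _ from ⟨by rw [h2]; linarith, by rw [h3]; exact h⟩)
    exact ⟨x, ⟨hx.1, hx.2.trans hπl⟩, hx0⟩

end RealEvolution

namespace MetricGraph

/-! ### Edge ends at a vertex, and unique continuation over the graph. -/

section Tips

variable {V E : Type*} {G : MetricGraph V E}

/-- The vertex at an end of an edge; `inl e` is the start and `inr e` is the end of `e`. -/
def tip (G : MetricGraph V E) : E ⊕ E → V := Sum.elim G.src G.tgt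

/-- The value and the derivative directed into the edge at an end of an edge. -/
noncomputable def tipState (u : G.H2) : E ⊕ E → ℂ × ℂ :=
  Sum.elim (fun e => (val e (startPt e) u, der e (startPt e) u))
    fun e => (val e (endPt e) u, -der e (endPt e) u)

theorem state_zero_eq {u : G.H2} (e : E) : tipState u (.inl e) = state u e 0 := rfl

theorem tipState_inr_eq_zero_iff {k : ℝ} {u : G.H2} (hu : u ∈ G.helmholtz (k ^ 2)) (e : E) :
    tipState u (.inr e) = 0 ↔ tipState u (.inl e) = 0 := by
  have h1 := state_eq_evolve_sub hu e (x := 0) (y := G.len e) ⟨le_rfl, (G.len_pos e).le⟩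
    ⟨(G.len_pos e).le, le_rfl⟩
  have h2 := state_eq_evolve_sub hu e (y := 0) (x := G.len e) ⟨(G.len_pos e).le, le_rfl⟩
    ⟨le_rfl, (G.len_pos e).le⟩
  have h3 : tipState u (.inr e) = 0 ↔ state u e (G.len e) = 0 := by
    change (_, -_) = (0 : ℂ × ℂ) ↔ (_, _) = (0 : ℂ × ℂ)
    rw [Prod.mk_eq_zero, Prod.mk_eq_zero, neg_eq_zero]
    rfl
  have h4 : ∀ x, evolve k x 0 = 0 := fun x => by simp [evolve]
  rw [h3, state_zero_eq]
  constructor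
  · intro h
    rw [h2, h, h4]
  · intro h
    rw [h1, h, h4]

/-- A property of edges that is inherited through common vertices holds for all edges. -/
theorem forall_edge_of_connected [Finite E] [ConnectedSpace G.Point] {P : E → Prop}
    (h : ∀ t t', G.tip t = G.tip t' → P (Sum.elim id id t) → P (Sum.elim id id t')) {e₀ : E}
    (h0 : P e₀) (e : E) : P e := by
  have : Nonempty E := ⟨e₀⟩
  have := Fintype.ofFinite E
  have h1 := card_connectedComponents (G := G) (B := ∅) (S := ∅) (by simp)
  have : PreconnectedSpace ((∅ : Set G.Point)ᶜ : Set G.Point) := by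
    rw [compl_empty]
    exact Subtype.preconnectedSpace isPreconnected_univ
  have h2 : Nat.card (ConnectedComponents ((∅ : Set G.Point)ᶜ : Set G.Point)) ≤ 1 :=
    Finite.card_le_one_iff_subsingleton.2 inferInstance
  rw [h1, finrank_le_one_iff] at h2
  obtain ⟨g₀, hg₀⟩ := h2
  obtain ⟨c, hc⟩ := hg₀ ⟨1, fun _ _ _ => rfl⟩
  -- Without cuts the pieces are whole edges. The indicator of `P` is locally constant, and
  -- connectedness makes the space of such functions one-dimensional, so it is a constant function.
  have hmem : (fun p : Piece (∅ : Finset G.Point) => if P p.1 then (1 : ℂ) else 0) ∈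
      (subdivide ∅).linkSpace ∅ := by
    have key : ∀ p : Piece (∅ : Finset G.Point), ∀ x, (subdivide ∅).Inc p x →
        ∃ t, Point.vertex (G.tip t) = x ∧ Sum.elim id id t = p.1 := by
      rintro p x (hx | hx)
      · have hlo : p.lo = 0 := by
          rcases mem_nodes_iff.1 p.lo_mem_nodes with h | h | ⟨_, h⟩
          · exact h
          · exact absurd h (p.lo_lt_hi.trans_le p.hi_mem.2).ne
          · simp at h
        exact ⟨.inl p.1, by rw [← hx, Piece.src_eq, pt_zero _ hlo]; rfl, rfl⟩
      · have hhi : p.hi = G.len p.1 := by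
          rcases mem_nodes_iff.1 p.hi_mem_nodes with h | h | ⟨_, h⟩
          · exact absurd h (p.lo_mem.1.trans_lt p.lo_lt_hi).ne'
          · exact h
          · simp at h
        exact ⟨.inr p.1, by rw [← hx, Piece.tgt_eq, pt_len _ hhi]; rfl, rfl⟩
    rintro p q ⟨x, -, hp, hq⟩
    obtain ⟨t, ht, htp⟩ := key p x hp
    obtain ⟨t', ht', htq⟩ := key q x hq
    have htt := vertex_injective (ht.trans ht'.symm)
    have hiff : P p.1 ↔ P q.1 := by
      rw [← htp, ← htq]
      exact ⟨h t t' htt, h t' t htt.symm⟩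
    simp only [hiff]
  obtain ⟨c', hc'⟩ := hg₀ ⟨_, hmem⟩
  have hc1 : ∀ p, c * g₀.1 p = 1 := fun p => congrFun (congrArg Subtype.val hc) p
  have hc2 : ∀ p, c' * g₀.1 p = if P p.1 then 1 else 0 :=
    fun p => congrFun (congrArg Subtype.val hc') p
  obtain ⟨p, hp, -⟩ := Piece.exists_first (∅ : Finset G.Point) e₀
  obtain ⟨q, hq, -⟩ := Piece.exists_first (∅ : Finset G.Point) e
  have h3 := hc2 p
  rw [hp, if_pos h0] at h3
  have hc'0 : c' ≠ 0 := fun h => by simp [h] at h3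
  have h4 := hc2 q
  by_contra hPe
  rw [hq, if_neg hPe] at h4
  have h5 := hc1 q
  rw [(mul_eq_zero.1 h4).resolve_left hc'0] at h5
  simp at h5

variable [Fintype E]

theorem sum_tips {M : Type*} [AddCommMonoid M] (φ : E ⊕ E → M) (v : V) :
    ∑ t ∈ Finset.univ.filter (fun t => G.tip t = v), φ t =
      ∑ e ∈ Finset.univ.filter (fun e => G.src e = v), φ (.inl e) +
        ∑ e ∈ Finset.univ.filter (fun e => G.tgt e = v), φ (.inr e) := by
  rw [Finset.sum_filter, Fintype.sum_sum_type, Finset.sum_filter, Finset.sum_filter]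
  rfl

theorem card_tips (v : V) :
    (Finset.univ.filter fun t => G.tip t = v).card = G.vertexDegree v := by
  rw [Finset.card_eq_sum_ones, sum_tips, vertexDegree, Finset.card_eq_sum_ones,
    Finset.card_eq_sum_ones]

theorem tipState_of_mem_kirchhoff {u : G.H2} {v : V} (hu : u ∈ G.kirchhoff v) :
    (∃ a, ∀ t, G.tip t = v → (tipState u t).1 = a) ∧
      ∑ t ∈ Finset.univ.filter (fun t => G.tip t = v), (tipState u t).2 = 0 := by
  obtain ⟨⟨a, ha, ha'⟩, hs⟩ := hu
  refine ⟨⟨a, ?_⟩, ?_⟩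
  · rintro (e | e) he
    · exact ha e he
    · exact ha' e he
  · rw [sum_tips]
    simp only [tipState, Sum.elim_inl, Sum.elim_inr, Finset.sum_neg_distrib, ← sub_eq_add_neg]
    rw [sumOut, sumIn, LinearMap.sum_apply, LinearMap.sum_apply] at hs
    exact hs

theorem eq_of_degree_one {v : V} (hv : G.vertexDegree v = 1) {t t' : E ⊕ E} (ht : G.tip t = v)
    (ht' : G.tip t' = v) : t' = t :=
  Finset.card_le_one.1 ((card_tips v).trans hv).le _ (by simp [ht']) _ (by simp [ht])

theorem tipState_of_degree_one {u : G.H2} {v : V} (hu : u ∈ G.kirchhoff v)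
    (hv : G.vertexDegree v = 1) {t : E ⊕ E} (ht : G.tip t = v) : (tipState u t).2 = 0 := by
  have h := (tipState_of_mem_kirchhoff hu).2
  rwa [sum_filter_eq_of_iff fun t' => ⟨fun h => eq_of_degree_one hv ht h, fun h => h ▸ ht⟩] at h

theorem tipState_eq_zero_of_eq {u : G.H2} {v : V} (hu : u ∈ G.kirchhoff v)
    (hv : G.vertexDegree v ≤ 2) {t t' : E ⊕ E} (ht : G.tip t = v) (ht' : G.tip t' = v)
    (h0 : tipState u t = 0) : tipState u t' = 0 := by
  obtain ⟨⟨a, ha⟩, hs⟩ := tipState_of_mem_kirchhoff hu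
  refine Prod.ext ?_ ?_
  · rw [ha t' ht', ← ha t ht, h0]
  by_cases htt : t' = t
  · rw [htt, h0]
  have hT : Finset.univ.filter (fun t => G.tip t = v) = {t', t} := by
    symm
    refine Finset.eq_of_subset_of_card_le ?_ ?_
    · intro x hx
      rcases Finset.mem_insert.1 hx with rfl | hx
      · simp [ht']
      · rw [Finset.mem_singleton.1 hx]; simp [ht]
    · rw [card_tips, Finset.card_pair htt]
      exact hv
  rw [hT, Finset.sum_pair htt, h0] at hs
  simpa using hs

/-- A generic eigenfunction does not vanish identically on any edge. -/
theorem IsGenericEigenpair.state_ne_zero [ConnectedSpace G.Point] {n : ℕ} {k : ℝ} {f : G.H2}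
    (hf : G.IsGenericEigenpair n (k ^ 2) f) (e : E) : state f e 0 ≠ 0 := by
  intro h0
  obtain ⟨hH, hK⟩ := mem_eigenspace_iff.1 hf.mem_eigenspace
  have hedge : ∀ t : E ⊕ E, tipState f t = 0 ↔ state f (Sum.elim id id t) 0 = 0 := by
    rintro (e | e)
    · rfl
    · exact tipState_inr_eq_zero_iff hH e
  have hgen : ∀ t, tipState f t = 0 → G.vertexDegree (G.tip t) ≤ 2 := by
    rintro (e | e) h
    · exact not_lt.1 fun h2 => (hf.generic_src e h2).1 (congrArg Prod.fst h)
    · exact not_lt.1 fun h2 => (hf.generic_tgt e h2).1 (congrArg Prod.fst h)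
  have hall := forall_edge_of_connected (G := G) (P := fun e => state f e 0 = 0)
    (fun t t' htt ht => by
      rw [← hedge] at ht ⊢
      exact tipState_eq_zero_of_eq (hK _) (hgen t ht) rfl htt.symm ht) h0
  exact hf.ne_zero (eq_of_state_zero_eq hH (v := 0) (Submodule.zero_mem _) fun e => by
    rw [hall e]
    symm
    exact Prod.ext rfl (map_zero (der e (startPt e))))

end Tips

/-! ### Real eigenfunctions. -/

section RealSolutions

variable {V E : Type*} {G : MetricGraph V E}

/-- The real solution of `-u'' = k² u` with initial values `d` on the edges. -/
noncomputable def realSol (G : MetricGraph V E) (k : ℝ) (d : E → ℝ × ℝ) : G.H2 :=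
  G.sol k fun e => (((d e).1 : ℂ), ((d e).2 : ℂ))

theorem state_realSol (k : ℝ) (d : E → ℝ × ℝ) (e : E) {x : ℝ} (hx : x ∈ Icc 0 (G.len e)) :
    state (G.realSol k d) e x =
      (((revolve k x (d e)).1 : ℂ), ((revolve k x (d e)).2 : ℂ)) := by
  rw [realSol, state_sol k _ e hx, evolve_ofReal]

theorem val_realSol (k : ℝ) (d : E → ℝ × ℝ) (e : E) (x : Icc (0 : ℝ) (G.len e)) :
    val e x (G.realSol k d) = ((revolve k x (d e)).1 : ℂ) :=
  congrArg Prod.fst (state_realSol k d e x.2)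

theorem der_realSol (k : ℝ) (d : E → ℝ × ℝ) (e : E) (x : Icc (0 : ℝ) (G.len e)) :
    der e x (G.realSol k d) = ((revolve k x (d e)).2 : ℂ) :=
  congrArg Prod.snd (state_realSol k d e x.2)

theorem sCondition_realSol (k : ℝ) (d : E → ℝ × ℝ) (e : E) (x : Icc (0 : ℝ) (G.len e))
    (s : OnePoint ℝ) :
    SCondition (G.realSol k d) e x s ↔ sDefect s (revolve k x (d e)) = 0 := by
  induction s using OnePoint.rec with
  | infty =>
    change val e x _ = 0 ↔ _
    rw [val_realSol, Complex.ofReal_eq_zero]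
    rfl
  | coe s =>
    change der e x _ = s * val e x _ ↔ _
    rw [val_realSol, der_realSol, ← Complex.ofReal_mul, Complex.ofReal_inj, sDefect_coe,
      sub_eq_zero]

/-- The initial values of the real part (`L = re`) or the imaginary part (`L = im`). -/
noncomputable def partData (L : ℂ →ₗ[ℝ] ℝ) (u : G.H2) (e : E) : ℝ × ℝ :=
  (L (state u e 0).1, L (state u e 0).2)

theorem revolve_partData {k : ℝ} {u : G.H2} (hu : u ∈ G.helmholtz (k ^ 2)) (L : ℂ →ₗ[ℝ] ℝ)
    (e : E) {x : ℝ} (hx : x ∈ Icc 0 (G.len e)) :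
    revolve k x (partData L u e) = (L (state u e x).1, L (state u e x).2) := by
  have hL : ∀ (r : ℝ) (z : ℂ), L (r * z) = r * L z := fun r z => by
    rw [← Complex.real_smul, map_smul, smul_eq_mul]
  rw [state_eq_evolve hu e hx]
  ext
  · simp only [revolve, evolve, partData, map_add, hL]
  · simp only [revolve, evolve, partData, map_sub]
    rw [hL, ← Complex.ofReal_pow, ← Complex.ofReal_mul, hL]

theorem sCondition_smul {a : ℂ} (ha : a ≠ 0) (u : G.H2) (e : E) (x : Icc (0 : ℝ) (G.len e))
    (s : OnePoint ℝ) : SCondition (a • u) e x s ↔ SCondition u e x s := by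
  induction s using OnePoint.rec with
  | infty =>
    change val e x _ = 0 ↔ val e x _ = 0
    rw [map_smul, smul_eq_zero_iff_right ha]
  | coe s =>
    change der e x _ = s * val e x _ ↔ der e x _ = s * val e x _
    rw [map_smul, map_smul, smul_eq_mul, smul_eq_mul, mul_left_comm, mul_right_inj' ha]

variable [Fintype E]

theorem realSol_partData_mem {k : ℝ} {u : G.H2} (hu : u ∈ G.eigenspace (k ^ 2))
    (L : ℂ →ₗ[ℝ] ℝ) : G.realSol k (partData L u) ∈ G.eigenspace (k ^ 2) := by
  rw [mem_eigenspace_iff] at hu ⊢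
  have hv : ∀ e x, val e x (G.realSol k (partData L u)) = (L (val e x u) : ℂ) := fun e x => by
    rw [val_realSol, revolve_partData hu.1 L e x.2]
    rfl
  have hd : ∀ e x, der e x (G.realSol k (partData L u)) = (L (der e x u) : ℂ) := fun e x => by
    rw [der_realSol, revolve_partData hu.1 L e x.2]
    rfl
  refine ⟨sol_mem_helmholtz k _, fun v => ?_⟩
  obtain ⟨⟨a, ha, ha'⟩, hs⟩ := hu.2 v
  refine ⟨⟨L a, fun e he => ?_, fun e he => ?_⟩, ?_⟩
  · rw [hv, ha e he]
  · rw [hv, ha' e he]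
  · rw [sumOut, sumIn, LinearMap.sum_apply, LinearMap.sum_apply] at hs ⊢
    simp only [hd]
    rw [← Complex.ofReal_sum, ← Complex.ofReal_sum, ← map_sum, ← map_sum, ← Complex.ofReal_sub,
      ← map_sub, hs, map_zero, Complex.ofReal_zero]

/-- The eigenfunction of a simple eigenvalue is a multiple of a real function. -/
theorem exists_realSol {k : ℝ} {f : G.H2} (hf : f ∈ G.eigenspace (k ^ 2)) (h0 : f ≠ 0)
    (h1 : Module.finrank ℂ (G.eigenspace (k ^ 2)) = 1) :
    ∃ (d : E → ℝ × ℝ) (a : ℂ), a ≠ 0 ∧ G.realSol k d ∈ G.eigenspace (k ^ 2) ∧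
      a • G.realSol k d = f := by
  obtain ⟨L, hL⟩ : ∃ L : ℂ →ₗ[ℝ] ℝ, G.realSol k (partData L f) ≠ 0 := by
    by_contra! h
    apply h0
    have hH := (mem_eigenspace_iff.1 hf).1
    have key : ∀ (L : ℂ →ₗ[ℝ] ℝ) e x, L (val e x f) = 0 := fun L e x => by
      have h2 := congrArg (val e x) (h L)
      rw [val_realSol, revolve_partData hH L e x.2, map_zero, Complex.ofReal_eq_zero] at h2
      exact h2
    refine H2_ext fun e x => ?_
    rw [map_zero]
    exact Complex.ext (key Complex.reLm e x) (key Complex.imLm e x)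
  have hmem := realSol_partData_mem hf L
  have hne : (⟨_, hmem⟩ : G.eigenspace (k ^ 2)) ≠ 0 := fun h => hL (congrArg Subtype.val h)
  obtain ⟨a, ha⟩ := exists_smul_eq_of_finrank_eq_one (V := G.eigenspace (k ^ 2)) h1 hne ⟨f, hf⟩
  have ha' : a • G.realSol k (partData L f) = f := congrArg Subtype.val ha
  refine ⟨_, a, ?_, hmem, ha'⟩
  rintro rfl
  exact h0 (by rw [← ha', zero_smul])

theorem sPoints_smul {a : ℂ} (ha : a ≠ 0) (u : G.H2) (s : OnePoint ℝ) :
    sPoints (a • u) s = sPoints u s := by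
  ext p
  simp only [sPoints, sCondition_smul ha]

theorem sPointsTwo_smul {a : ℂ} (ha : a ≠ 0) (u : G.H2) (s : OnePoint ℝ) :
    sPointsTwo (a • u) s = sPointsTwo u s := by
  rw [sPointsTwo, sPointsTwo, sPoints_smul ha]

end RealSolutions

end MetricGraph

namespace MetricGraph

/-! ### Arbitrarily fine subdivisions. -/

section Grid

variable {V E : Type*} {G : MetricGraph V E}

theorem finite_image_pt [Finite E] {T : E → Set ℝ} (hT : ∀ e, (T e).Finite) {S : Set G.Point}
    (hS : ∀ p ∈ S, ∃ e x hx, Point.inner e x hx = p ∧ x ∈ T e) : S.Finite := by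
  refine (Set.finite_iUnion fun e => (hT e).image fun x : ℝ =>
    G.pt ⟨e, projIcc 0 (G.len e) (G.len_pos e).le x⟩).subset fun p hp => ?_
  obtain ⟨e, x, hx, rfl, hxT⟩ := hS p hp
  refine mem_iUnion.2 ⟨e, x, hxT, ?_⟩
  simp only
  rw [projIcc_of_mem _ (Ioo_subset_Icc_self hx), pt_of_mem_Ioo]

/-- There are finite sets of interior points that cut the edges into arbitrarily short pieces. -/
theorem exists_short_subdivision [Finite E] (G : MetricGraph V E) {K : ℝ} (hK : 0 ≤ K) :
    ∃ A : Finset G.Point, (∀ p ∈ A, ∃ e x hx, Point.inner e x hx = p) ∧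
      ∀ B : Finset G.Point, A ⊆ B → ∀ p, K * (subdivide B).len p < Real.pi := by
  have hδ : 0 < 1 / (K + 1) := by positivity
  have hδK : K * (1 / (K + 1)) < Real.pi := by
    have h1 : K * (1 / (K + 1)) ≤ 1 := by
      rw [mul_one_div, div_le_one (by positivity)]
      linarith
    linarith [Real.pi_gt_three]
  set δ := 1 / (K + 1)
  let S : Set G.Point := {p | ∃ e x hx, Point.inner e x hx = p ∧ ∃ j : ℕ, x = j * δ}
  have hS : S.Finite := by
    refine finite_image_pt (T := fun e => (fun j : ℕ => (j : ℝ) * δ) '' Iic ⌈G.len e / δ⌉₊)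
      (fun e => (Set.finite_Iic _).image _) ?_
    rintro _ ⟨e, x, hx, rfl, j, rfl⟩
    refine ⟨e, _, hx, rfl, j, ?_, rfl⟩
    have : (j : ℝ) ≤ G.len e / δ := (le_div_iff₀ hδ).2 hx.2.le
    exact mem_Iic.2 (Nat.cast_le.1 (this.trans (Nat.le_ceil _)))
  refine ⟨hS.toFinset, fun p hp => ?_, fun B hB p => ?_⟩
  · obtain ⟨e, x, hx, h, -⟩ := hS.mem_toFinset.1 hp
    exact ⟨e, x, hx, h⟩
  · have hle : p.hi - p.lo ≤ δ := by
      by_contra! hlt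
      -- The first grid point beyond the start of the piece; a piece longer than `δ` would contain
      -- it in its interior.
      set j := ⌊p.lo / δ⌋₊ + 1 with hj
      have h0 : 0 ≤ p.lo / δ := div_nonneg p.lo_mem.1 hδ.le
      have h1 : p.lo < j * δ := by
        rw [← div_lt_iff₀ hδ, hj]
        exact_mod_cast Nat.lt_floor_add_one (p.lo / δ)
      have h2 : j * δ ≤ p.lo + δ := by
        have := (le_div_iff₀ hδ).1 (Nat.floor_le h0)
        rw [hj]
        push_cast
        linarith
      have h3 : (j * δ : ℝ) ∈ Ioo 0 (G.len p.1) :=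
        ⟨p.lo_mem.1.trans_lt h1, by linarith [p.hi_mem.2]⟩
      refine p.not_between (mem_nodes_iff.2 (Or.inr (Or.inr ⟨h3, hB ?_⟩))) ⟨h1, by linarith⟩
      exact hS.mem_toFinset.2 ⟨_, _, h3, rfl, j, rfl⟩
    rw [Piece.len_eq]
    exact (mul_le_mul_of_nonneg_left hle hK).trans_lt hδK

end Grid

/-! ### Nodal points split the domains. -/

section Jumps

open Module

variable {V E : Type*} {G : MetricGraph V E} {B : Finset G.Point}

/-- A segment between two nodes of an edge can be left only through its two ends. So lying in the
segment is inherited through every other common vertex. -/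
theorem Piece.between_of_inc {e : E} {a b : ℝ} (ha : a ∈ nodes B e) (hb : b ∈ nodes B e)
    {p q : Piece B} {x : G.Point} (hp : (subdivide B).Inc p x) (hq : (subdivide B).Inc q x)
    (hxa : G.pt ⟨e, a, mem_Icc_of_mem_nodes ha⟩ ≠ x)
    (hxb : G.pt ⟨e, b, mem_Icc_of_mem_nodes hb⟩ ≠ x)
    (h : p.1 = e ∧ a ≤ p.lo ∧ p.hi ≤ b) : q.1 = e ∧ a ≤ q.lo ∧ q.hi ≤ b := by
  obtain ⟨rfl, h1, h2⟩ := h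
  have hlt := p.lo_lt_hi
  obtain ⟨t, ht, hta, htb, rfl⟩ : ∃ (t : ℝ) (ht : t ∈ Icc 0 (G.len p.1)), a ≤ t ∧ t ≤ b ∧
      G.pt ⟨p.1, t, ht⟩ = x := by
    rcases hp with rfl | rfl
    · exact ⟨p.lo, p.lo_mem, h1, hlt.le.trans h2, rfl⟩
    · exact ⟨p.hi, p.hi_mem, h1.trans hlt.le, h2, rfl⟩
  have hat : a < t := lt_of_le_of_ne hta (by rintro rfl; exact hxa rfl)
  have hbt : t < b := lt_of_le_of_ne htb (by rintro rfl; exact hxb rfl)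
  have h0 : t ≠ 0 := ((mem_Icc_of_mem_nodes ha).1.trans_lt hat).ne'
  have h3 : t ≠ G.len p.1 := (hbt.trans_le (mem_Icc_of_mem_nodes hb).2).ne
  have hqlt := q.lo_lt_hi
  rcases hq with hq | hq
  · have := eq_of_pt_eq (p := ⟨p.1, t, ht⟩) (q := ⟨q.1, q.lo, q.lo_mem⟩) h0 h3 hq
    have e1 : q.1 = p.1 := this.1
    have e2 : q.lo = t := this.2
    exact ⟨e1, by linarith, hi_le_of_lt (e1 ▸ hb) (by linarith)⟩
  · have := eq_of_pt_eq (p := ⟨p.1, t, ht⟩) (q := ⟨q.1, q.hi, q.hi_mem⟩) h0 h3 hq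
    have e1 : q.1 = p.1 := this.1
    have e2 : q.hi = t := this.2
    exact ⟨e1, le_lo_of_lt (e1 ▸ ha) (by linarith), by linarith⟩

/-- Admitting jumps at the points of `N` enlarges the space of locally constant functions by
the number of these points, if every edge contains a point of `S`. -/
theorem finrank_linkSpace_add_card [Finite E] {S N : Finset G.Point} (hSB : S ⊆ B)
    (htwo : (subdivide B).TwoSided N) (hSN : ∀ x ∈ N, x ∉ S)
    (hS : ∀ e, ∃ x hx, Point.inner e x hx ∈ S) :
    finrank ℂ ((subdivide B).linkSpace (S : Set G.Point)) + N.card ≤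
      finrank ℂ ((subdivide B).linkSpace ((S : Set G.Point) ∪ N)) := by
  have := Fintype.ofFinite E
  choose pin hpin using fun x (hx : x ∈ N) => (htwo x hx).1
  choose pout hpout using fun x (hx : x ∈ N) => (htwo x hx).2
  let H := subdivide B
  let J : H.linkSpace ((S : Set G.Point) ∪ N) →ₗ[ℂ] (N → ℂ) :=
    LinearMap.pi fun x => ((LinearMap.proj (pout x x.2) : (Piece B → ℂ) →ₗ[ℂ] ℂ) -
      LinearMap.proj (pin x x.2)) ∘ₗ
      (H.linkSpace ((S : Set G.Point) ∪ N)).subtype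
  have hJ : ∀ g x, J g x = g.1 (pout x x.2) - g.1 (pin x x.2) := fun _ _ => rfl
  have hsurj : LinearMap.range J = ⊤ := by
    rw [eq_top_iff, ← (Pi.basisFun ℂ N).span_eq, Submodule.span_le]
    rintro _ ⟨v, rfl⟩
    rw [Pi.basisFun_apply]
    set p := pin v v.2 with hp
    set q := pout v v.2 with hq
    have hpv : (subdivide B).tgt p = v := (hpin v v.2 p).2 rfl
    have hqv : (subdivide B).src q = v := (hpout v v.2 q).2 rfl
    -- The indicator of the segment between `v` and a point `y` of `S` on the edge that enters `v`
    -- jumps at `v` but at no other point of `N`; its other jump, at `y`, is permitted.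
    obtain ⟨y, hy, hyS⟩ := hS p.1
    have hyn : y ∈ nodes B p.1 := mem_nodes_iff.2 (Or.inr (Or.inr ⟨hy, hSB hyS⟩))
    have hty : y ≠ p.hi := by
      rintro rfl
      refine hSN v v.2 ?_
      rw [← hpv, Piece.tgt_eq, pt_of_mem_Ioo _ hy]
      exact hyS
    have hyv : G.pt ⟨p.1, y, mem_Icc_of_mem_nodes hyn⟩ ∈ S := by
      rw [pt_of_mem_Ioo _ hy]
      exact hyS
    have hcases : ∃ (a b : ℝ) (ha : a ∈ nodes B p.1) (hb : b ∈ nodes B p.1),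
        (∀ x ∉ S, x ≠ v → G.pt ⟨p.1, a, mem_Icc_of_mem_nodes ha⟩ ≠ x ∧
          G.pt ⟨p.1, b, mem_Icc_of_mem_nodes hb⟩ ≠ x) ∧
        ((p.1 = p.1 ∧ a ≤ p.lo ∧ p.hi ≤ b) ↔ ¬ (q.1 = p.1 ∧ a ≤ q.lo ∧ q.hi ≤ b)) := by
      have hqlt := q.lo_lt_hi
      have hplt := p.lo_lt_hi
      have hq1 : p.hi ≠ G.len p.1 → q.1 = p.1 ∧ q.lo = p.hi := fun hne =>
        eq_of_pt_eq (p := ⟨p.1, p.hi, p.hi_mem⟩) (q := ⟨q.1, q.lo, q.lo_mem⟩)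
          (p.lo_mem.1.trans_lt hplt).ne' hne (hqv.trans hpv.symm)
      rcases hty.lt_or_gt with hlt | hlt
      · refine ⟨y, p.hi, hyn, p.hi_mem_nodes, fun x hxS hxv => ⟨?_, ?_⟩, iff_of_true
          ⟨rfl, Piece.le_lo_of_lt hyn hlt, le_rfl⟩ ?_⟩
        · rintro rfl
          exact hxS hyv
        · rintro rfl
          exact hxv hpv
        · rintro ⟨h1, h2, h3⟩
          -- If `v` is the final vertex of the edge, the outgoing piece may still lie on the same
          -- edge, namely on a loop. It then starts at `0`, before `y`, and is outside the segment.
          by_cases hlen : p.hi = G.len p.1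
          · have h4 : (subdivide B).src q = .vertex (G.tgt p.1) := by
              rw [hqv, ← hpv, Piece.tgt_eq, pt_len _ hlen]
            rcases eq_of_pt_eq_vertex h4 with ⟨h5, -⟩ | ⟨h5, -⟩
            · have h5' : q.lo = 0 := h5
              linarith [hy.1]
            · have h5' : q.lo = G.len q.1 := h5
              linarith [q.hi_mem.2]
          · linarith [(hq1 hlen).2]
      · have hlen : p.hi ≠ G.len p.1 := (hlt.trans hy.2).ne
        obtain ⟨h1, h2⟩ := hq1 hlen
        refine ⟨p.hi, y, p.hi_mem_nodes, hyn, fun x hxS hxv => ⟨?_, ?_⟩, iff_of_false ?_ ?_⟩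
        · rintro rfl
          exact hxv hpv
        · rintro rfl
          exact hxS hyv
        · rintro ⟨-, h3, -⟩
          linarith
        · exact not_not.2 ⟨h1, h2.ge, Piece.hi_le_of_lt (h1 ▸ hyn) (by linarith)⟩
    obtain ⟨a, b, ha, hb, hx, hpq⟩ := hcases
    let P : Piece B → Prop := fun r => r.1 = p.1 ∧ a ≤ r.lo ∧ r.hi ≤ b
    let g : Piece B → ℂ := fun r => if P r then 1 else 0
    have hlink : ∀ r r' x, x ∉ S → x ≠ v → H.Inc r x → H.Inc r' x → g r = g r' := by
      intro r r' x hxS hxv hr hr'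
      obtain ⟨h1, h2⟩ := hx x hxS hxv
      have : P r ↔ P r' := ⟨Piece.between_of_inc ha hb hr hr' h1 h2,
        Piece.between_of_inc ha hb hr' hr h1 h2⟩
      simp only [g, this]
    have hg : g ∈ H.linkSpace ((S : Set G.Point) ∪ N) := by
      rintro r r' ⟨x, hxn, hr, hr'⟩
      exact hlink r r' x (fun h => hxn (Or.inl h)) (fun h => hxn (Or.inr (h ▸ v.2))) hr hr'
    have hJg : J ⟨g, hg⟩ = (g q - g p) • Pi.single v 1 := by
      funext x
      rw [hJ, Pi.smul_apply, Pi.single_apply, smul_eq_mul]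
      by_cases hxv : x = v
      · subst hxv
        rw [if_pos rfl, mul_one]
      · rw [if_neg hxv, mul_zero, sub_eq_zero]
        exact hlink _ _ x (hSN x x.2) (fun h => hxv (Subtype.ext h))
          (Or.inl ((hpout x x.2 _).2 rfl)) (Or.inr ((hpin x x.2 _).2 rfl))
    have hne : g q - g p ≠ 0 := by
      have hpq' : P p ↔ ¬ P q := hpq
      by_cases h : P q
      · simp [g, h, hpq']
      · simp [g, h, hpq']
    have hmem : (g q - g p)⁻¹ • J ⟨g, hg⟩ ∈ LinearMap.range J :=
      Submodule.smul_mem _ _ (LinearMap.mem_range_self J _)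
    rwa [hJg, smul_smul, inv_mul_cancel₀ hne, one_smul] at hmem
  -- Functions that are linked across `N` have no jumps there, so the kernel of the jump map
  -- contains the smaller space; surjectivity contributes the number of nodal points.
  have hker : finrank ℂ (H.linkSpace (S : Set G.Point)) ≤ finrank ℂ (LinearMap.ker J) := by
    have hle : H.linkSpace (S : Set G.Point) ≤ H.linkSpace ((S : Set G.Point) ∪ N) :=
      linkSpace_mono subset_union_left
    refine LinearMap.finrank_le_finrank_of_injective
      (f := (Submodule.inclusion hle).codRestrict (LinearMap.ker J) fun g => ?_) ?_
    · rw [LinearMap.mem_ker]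
      funext x
      rw [hJ, Pi.zero_apply, sub_eq_zero]
      exact g.2 _ _ ⟨x, hSN x x.2, Or.inl ((hpout x x.2 _).2 rfl), Or.inr ((hpin x x.2 _).2 rfl)⟩
    · intro g g' h
      exact Subtype.ext (congrArg (fun z : LinearMap.ker J => z.1.1) h)
  have h1 := LinearMap.finrank_range_add_finrank_ker J
  rw [hsurj, finrank_top, finrank_fintype_fun_eq_card, Fintype.card_coe] at h1
  change finrank ℂ (H.linkSpace _) + _ ≤ finrank ℂ (H.linkSpace _)
  omega

end Jumps

end MetricGraph

namespace MetricGraph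

/-! ### The set of `s`-points. -/

section SPoints

open Module

variable {V E : Type*} {G : MetricGraph V E}

theorem exists_tip_of_pt_eq {e : E} {x : Icc (0 : ℝ) (G.len e)} {v : V}
    (h : G.pt ⟨e, x⟩ = .vertex v) :
    ∃ t, G.tip t = v ∧ ∀ u : G.H2, (tipState u t).1 = val e x u := by
  rcases eq_of_pt_eq_vertex h with ⟨h0, hv⟩ | ⟨h0, hv⟩
  · obtain rfl : x = startPt e := Subtype.ext h0
    exact ⟨.inl e, hv, fun _ => rfl⟩
  · obtain rfl : x = endPt e := Subtype.ext h0
    exact ⟨.inr e, hv, fun _ => rfl⟩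

theorem exists_pt_eq_tip (t : E ⊕ E) :
    ∃ e x, G.pt ⟨e, x⟩ = .vertex (G.tip t) ∧ ∀ u : G.H2, (tipState u t).1 = val e x u := by
  rcases t with e | e
  · exact ⟨e, startPt e, pt_zero _ rfl, fun _ => rfl⟩
  · exact ⟨e, endPt e, pt_len _ rfl, fun _ => rfl⟩

theorem realSol_mem_helmholtz (k : ℝ) (d : E → ℝ × ℝ) : G.realSol k d ∈ G.helmholtz (k ^ 2) :=
  sol_mem_helmholtz k _

theorem tipState_realSol_ne_zero {k : ℝ} {d : E → ℝ × ℝ} (hd : ∀ e, d e ≠ 0) (t : E ⊕ E) :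
    tipState (G.realSol k d) t ≠ 0 := by
  have key : ∀ e, tipState (G.realSol k d) (.inl e) ≠ 0 := by
    intro e h
    rw [state_zero_eq, state_realSol k d e ⟨le_rfl, (G.len_pos e).le⟩, revolve_zero,
      Prod.mk_eq_zero, Complex.ofReal_eq_zero, Complex.ofReal_eq_zero] at h
    exact hd e (Prod.ext h.1 h.2)
  rcases t with e | e
  · exact key e
  · rw [Ne, tipState_inr_eq_zero_iff (realSol_mem_helmholtz k d)]
    exact key e

variable [Fintype E]

theorem inner_mem_sPointsTwo_iff {u : G.H2} {s : OnePoint ℝ} {e : E} {x : ℝ}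
    {hx : x ∈ Ioo 0 (G.len e)} :
    Point.inner e x hx ∈ sPointsTwo u s ↔ SCondition u e ⟨x, hx.1.le, hx.2.le⟩ s := by
  constructor
  · exact fun h => h.1.2 _ _ (pt_of_mem_Ioo e hx)
  · refine fun h => ⟨⟨Or.inr rfl, fun e' y hy => ?_⟩, rfl⟩
    obtain ⟨h1, h2⟩ := eq_of_pt_eq_inner hy
    obtain rfl : e' = e := h1
    obtain rfl : y = ⟨x, hx.1.le, hx.2.le⟩ := Subtype.ext h2
    exact h

theorem sDefect_of_mem_sPointsTwo {k : ℝ} {d : E → ℝ × ℝ} {s : OnePoint ℝ} {e : E}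
    {x : Icc (0 : ℝ) (G.len e)} (h : G.pt ⟨e, x⟩ ∈ sPointsTwo (G.realSol k d) s) :
    sDefect s (revolve k x (d e)) = 0 :=
  (sCondition_realSol k d e x s).1 (h.1.2 _ _ rfl)

theorem finite_sPointsTwo [Finite V] {k : ℝ} {d : E → ℝ × ℝ} {s : OnePoint ℝ} (hk : 0 ≤ k)
    (hs : s = ∞ ∨ 0 < k) (hd : ∀ e, d e ≠ 0) : (sPointsTwo (G.realSol k d) s).Finite := by
  have h1 : (range (Point.vertex : V → G.Point)).Finite := Set.finite_range _
  have h2 : (sPointsTwo (G.realSol k d) s \ range Point.vertex).Finite := by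
    refine finite_image_pt
      (T := fun e => {x | x ∈ Icc 0 (G.len e) ∧ sDefect s (revolve k x (d e)) = 0})
      (fun e => finite_sDefect_zeros hk hs (hd e) _) ?_
    intro p hp
    cases p with
    | vertex v => exact absurd (mem_range_self v) hp.2
    | inner e x hx =>
      have h3 := (sCondition_realSol k d e ⟨x, hx.1.le, hx.2.le⟩ s).1
        (inner_mem_sPointsTwo_iff.1 hp.1)
      exact ⟨e, x, hx, rfl, Ioo_subset_Icc_self hx, h3⟩
  exact (h1.union h2).subset fun p hp => by
    by_cases h : p ∈ range Point.vertex
    · exact Or.inl h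
    · exact Or.inr ⟨hp, h⟩

theorem exists_inner_mem_sPointsTwo {k : ℝ} {d : E → ℝ × ℝ} (hk : 0 < k) {e : E}
    (he : Real.pi < k * G.len e) (s : OnePoint ℝ) :
    ∃ x hx, Point.inner e x hx ∈ sPointsTwo (G.realSol k d) s := by
  obtain ⟨x, hx, h⟩ := exists_sDefect_zero hk s (d e) he
  exact ⟨x, hx, inner_mem_sPointsTwo_iff.2 ((sCondition_realSol k d e _ s).2 h)⟩

variable {k : ℝ} {d : E → ℝ × ℝ}

/-- Every zero has degree two. Genericity excludes higher degrees, and at a vertex of degree one the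
derivative vanishes as well, which would annihilate the solution on the edge. -/
theorem pt_mem_sPointsTwo_infty_iff (hg : G.realSol k d ∈ G.eigenspace (k ^ 2))
    (hd : ∀ e, d e ≠ 0)
    (hgen : ∀ t, 2 < G.vertexDegree (G.tip t) → (tipState (G.realSol k d) t).1 ≠ 0) (e : E)
    (x : Icc (0 : ℝ) (G.len e)) :
    G.pt ⟨e, x⟩ ∈ sPointsTwo (G.realSol k d) ∞ ↔ (revolve k x (d e)).1 = 0 := by
  refine ⟨fun h => sDefect_of_mem_sPointsTwo h, fun h0 => ?_⟩
  have hval : val e x (G.realSol k d) = 0 := by rw [val_realSol, h0, Complex.ofReal_zero]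
  rcases hp : G.pt ⟨e, x⟩ with v | ⟨e', y, hy⟩
  · obtain ⟨t, rfl, ht⟩ := exists_tip_of_pt_eq hp
    have hK := (mem_eigenspace_iff.1 hg).2 (G.tip t)
    obtain ⟨⟨a, ha⟩, -⟩ := tipState_of_mem_kirchhoff hK
    have ha0 : a = 0 := by rw [← ha t rfl, ht, hval]
    have hdeg : G.vertexDegree (G.tip t) = 2 := by
      have h1 : G.vertexDegree (G.tip t) ≤ 2 :=
        not_lt.1 fun h => hgen t h (by rw [ht, hval])
      have h2 : 0 < G.vertexDegree (G.tip t) := by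
        rw [← card_tips]
        exact Finset.card_pos.2 ⟨t, by simp⟩
      have h3 : G.vertexDegree (G.tip t) ≠ 1 := fun h =>
        tipState_realSol_ne_zero hd t
          (Prod.ext (by rw [ht, hval]; rfl) (tipState_of_degree_one hK h rfl))
      omega
    refine ⟨⟨Or.inr hdeg, fun e' y hy => ?_⟩, hdeg⟩
    obtain ⟨t', ht', hty⟩ := exists_tip_of_pt_eq hy
    change val e' y _ = 0
    rw [← hty, ha t' ht', ha0]
  · obtain ⟨h1, h2⟩ := eq_of_pt_eq_inner hp
    obtain rfl : e = e' := h1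
    obtain rfl : x = ⟨y, hy.1.le, hy.2.le⟩ := Subtype.ext h2
    exact inner_mem_sPointsTwo_iff.2 hval

theorem sPoints_infty_eq (hg : G.realSol k d ∈ G.eigenspace (k ^ 2)) (hd : ∀ e, d e ≠ 0) :
    sPoints (G.realSol k d) ∞ = sPointsTwo (G.realSol k d) ∞ := by
  refine Subset.antisymm (fun p hp => ⟨hp, hp.1.resolve_left fun h1 => ?_⟩) fun p hp => hp.1
  cases p with
  | inner e x hx => exact absurd h1 (by norm_num [degree])
  | vertex v =>
    have h2 : (Finset.univ.filter fun t => G.tip t = v).card = 1 := (card_tips v).trans h1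
    obtain ⟨t, ht⟩ := Finset.card_pos.1 (by omega :
      0 < (Finset.univ.filter fun t => G.tip t = v).card)
    obtain rfl : G.tip t = v := (Finset.mem_filter.1 ht).2
    obtain ⟨e, x, hx, hv⟩ := exists_pt_eq_tip t
    have h3 : val e x (G.realSol k d) = 0 := hp.2 e x hx
    exact tipState_realSol_ne_zero hd t (Prod.ext (by rw [hv, h3]; rfl)
      (tipState_of_degree_one ((mem_eigenspace_iff.1 hg).2 _) h1 rfl))

omit [Fintype E] in
theorem Piece.tip_of_inc {B : Finset G.Point} {p : Piece B} {v : V}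
    (h : (subdivide B).Inc p (.vertex v)) : ∃ t, G.tip t = v ∧
      ((t = .inl p.1 ∧ p.lo = 0) ∨ (t = .inr p.1 ∧ p.hi = G.len p.1)) := by
  have hlt := p.lo_lt_hi
  rcases h with h | h
  · rcases eq_of_pt_eq_vertex h with ⟨h0, hv⟩ | ⟨h0, hv⟩
    · exact ⟨.inl p.1, hv, Or.inl ⟨rfl, h0⟩⟩
    · exact absurd h0 (hlt.trans_le p.hi_mem.2).ne
  · rcases eq_of_pt_eq_vertex h with ⟨h0, hv⟩ | ⟨h0, hv⟩
    · exact absurd h0 (p.lo_mem.1.trans_lt hlt).ne'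
    · exact ⟨.inr p.1, hv, Or.inr ⟨rfl, h0⟩⟩

/-- A vertex of degree one is met by a single piece, so removing it separates nothing. This disposes
of the end vertices that are `0`-points. -/
theorem linkSpace_sPoints (B : Finset G.Point) (u : G.H2) (s : OnePoint ℝ) :
    (subdivide B).linkSpace (sPoints u s) = (subdivide B).linkSpace (sPointsTwo u s) := by
  refine le_antisymm (fun g hg => ?_) (linkSpace_mono fun p hp => hp.1)
  rintro p q ⟨x, hx, hp, hq⟩
  by_cases hxs : x ∈ sPoints u s
  · have h1 : G.degree x = 1 := hxs.1.resolve_right fun h => hx ⟨hxs, h⟩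
    cases x with
    | inner e x hx => exact absurd h1 (by norm_num [degree])
    | vertex v =>
      obtain ⟨t, ht, htp⟩ := Piece.tip_of_inc hp
      obtain ⟨t', ht', htq⟩ := Piece.tip_of_inc hq
      obtain rfl := eq_of_degree_one h1 ht ht'
      congr 1
      rcases htp with ⟨h2, h3⟩ | ⟨h2, h3⟩ <;> rcases htq with ⟨h4, h5⟩ | ⟨h4, h5⟩
      · exact Piece.eq_of_lo_eq (Sum.inl_injective (h2.symm.trans h4)) (h3.trans h5.symm)
      · exact absurd (h2.symm.trans h4) (by simp)
      · exact absurd (h2.symm.trans h4) (by simp)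
      · have h6 := Sum.inr_injective (h2.symm.trans h4)
        exact Piece.eq_of_hi_eq h6 (h3.trans ((congrArg G.len h6).trans h5.symm))
  · exact hg p q ⟨x, hxs, hp, hq⟩

/-- The `s`-domains are counted by the locally constant functions on the pieces. -/
theorem sDomainCount_eq [ConnectedSpace G.Point] [Nonempty E] {B S : Finset G.Point} {u : G.H2}
    {s : OnePoint ℝ} (hS : (S : Set G.Point) = sPointsTwo u s) (hSB : S ⊆ B) :
    sDomainCount u s = finrank ℂ ((subdivide B).linkSpace (S : Set G.Point)) := by
  rw [hS, ← linkSpace_sPoints, sDomainCount]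
  refine card_connectedComponents fun e x hx h => hSB ?_
  have h1 : Point.inner e x hx ∈ (S : Set G.Point) := hS ▸ ⟨h, rfl⟩
  exact h1

end SPoints

/-! ### The eigenfunction and the Wronskian on a fine subdivision. -/

section FineData

variable {V E : Type*} {G : MetricGraph V E} {k : ℝ} {d : E → ℝ × ℝ} {B : Finset G.Point}

theorem ends_realSol (p : Piece B) : (subdivideRefinement G B).ends (G.realSol k d) p =
    (((revolve k p.lo (d p.1)).1 : ℂ), ((revolve k p.hi (d p.1)).1 : ℂ)) := by
  have h : (subdivideRefinement G B).off p + (subdivide B).len p = p.hi :=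
    add_sub_cancel p.lo p.hi
  rw [Refinement.ends_apply, h]
  exact Prod.ext (val_realSol k d p.1 ⟨p.lo, p.lo_mem⟩) (val_realSol k d p.1 ⟨p.hi, p.hi_mem⟩)

theorem slopeStart_realSol (hk : 0 ≤ k) (hs : ∀ p, k * (subdivide B).len p < Real.pi)
    (p : Piece B) :
    (subdivide B).slopeStart k p ((subdivideRefinement G B).ends (G.realSol k d)) =
      ((revolve k p.lo (d p.1)).2 : ℂ) := by
  rw [Refinement.slopeStart_ends _ hk (realSol_mem_helmholtz k d) (hs p)]
  exact der_realSol k d p.1 ⟨p.lo, p.lo_mem⟩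

theorem slopeEnd_realSol (hk : 0 ≤ k) (hs : ∀ p, k * (subdivide B).len p < Real.pi)
    (p : Piece B) :
    (subdivide B).slopeEnd k p ((subdivideRefinement G B).ends (G.realSol k d)) =
      ((revolve k p.hi (d p.1)).2 : ℂ) := by
  have h : (subdivideRefinement G B).off p + (subdivide B).len p = p.hi :=
    add_sub_cancel p.lo p.hi
  rw [Refinement.slopeEnd_ends _ hk (realSol_mem_helmholtz k d) (hs p), h]
  exact der_realSol k d p.1 ⟨p.hi, p.hi_mem⟩

variable [Fintype E]

/-- The values of a real eigenfunction on a fine subdivision that contains its zeros. -/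
theorem signedSolution_realSol (hk : 0 ≤ k) (hs : ∀ p, k * (subdivide B).len p < Real.pi)
    (hg : G.realSol k d ∈ G.eigenspace (k ^ 2)) (hd : ∀ e, d e ≠ 0)
    (hB : ∀ p ∈ sPointsTwo (G.realSol k d) ∞, p ∈ B) :
    (subdivide B).SignedSolution k (fun p => (revolve k p.lo (d p.1)).1)
      (fun p => (revolve k p.hi (d p.1)).1) (fun p => (revolve k p.lo (d p.1)).2)
      fun p => (revolve k p.hi (d p.1)).2 := by
  have hmem := (subdivideRefinement G B).ends_mem_kirchhoffVals hk hs (B := ∅) (B' := ∅)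
    (fun v => by simp) (u := G.realSol k d) (by rwa [← eigenspace_eq_kirchhoffOff])
  rw [mem_kirchhoffVals_iff] at hmem
  constructor
  · intro p
    have h := slopeStart_realSol (d := d) hk hs p
    rw [slopeStart_apply, ends_realSol] at h
    dsimp only at h
    exact_mod_cast h
  · intro p
    have h := slopeEnd_realSol (d := d) hk hs p
    rw [slopeEnd_apply, ends_realSol] at h
    dsimp only at h
    exact_mod_cast h
  · intro p
    -- A sign change inside a piece would produce a zero there, but all zeros are nodes.
    by_contra! h
    have hc : ContinuousOn (fun x => (revolve k x (d p.1)).1) (Icc p.lo p.hi) :=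
      (continuous_fst.comp (continuous_revolve k _)).continuousOn
    obtain ⟨x, hx, hx0⟩ : ∃ x ∈ Ioo p.lo p.hi, (revolve k x (d p.1)).1 = 0 := by
      rcases mul_neg_iff.1 h with ⟨h1, h2⟩ | ⟨h1, h2⟩
      · exact intermediate_value_Ioo' p.lo_lt_hi.le hc ⟨h2, h1⟩
      · exact intermediate_value_Ioo p.lo_lt_hi.le hc ⟨h1, h2⟩
    have hx' : x ∈ Ioo 0 (G.len p.1) :=
      ⟨p.lo_mem.1.trans_lt hx.1, hx.2.trans_le p.hi_mem.2⟩
    refine p.not_between (mem_nodes_iff.2 (Or.inr (Or.inr ⟨hx', hB _ ?_⟩))) hx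
    exact inner_mem_sPointsTwo_iff.2 ((sCondition_realSol k d _ _ _).2 hx0)
  · exact fun p h1 h2 => revolve_ne_zero (hd p.1) (Prod.ext h1 h2)
  · intro x
    obtain ⟨⟨a, ha, ha'⟩, -⟩ := hmem x (by simp)
    refine ⟨a.re, fun p hp => ?_, fun p hp => ?_⟩
    · rw [← ha p hp, ends_realSol, Complex.ofReal_re]
    · rw [← ha' p hp, ends_realSol, Complex.ofReal_re]
  · intro x
    have h := (hmem x (by simp)).2
    simp only [slopeStart_realSol (d := d) hk hs, slopeEnd_realSol (d := d) hk hs] at h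
    exact_mod_cast h

/-- The Wronskian of two solutions with the same Robin conditions at a point of every edge
vanishes. -/
theorem wronskian_eq_zero (hk : 0 ≤ k) (hs : ∀ p, k * (subdivide B).len p < Real.pi)
    {S : Finset G.Point} (hSB : S ⊆ B) {σ : G.Point → ℝ} (hσ : ∀ x ∉ S, σ x = 0)
    (hS : ∀ p : Piece B, (subdivide B).src p ∈ S →
      (revolve k p.lo (d p.1)).2 = σ ((subdivide B).src p) * (revolve k p.lo (d p.1)).1)
    (hS' : ∀ p : Piece B, (subdivide B).tgt p ∈ S →
      (revolve k p.hi (d p.1)).2 = σ ((subdivide B).tgt p) * (revolve k p.hi (d p.1)).1)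
    (hin : ∀ e, ∃ x hx, Point.inner e x hx ∈ S) {w : Piece B → ℂ × ℂ}
    (hw : w ∈ formRadical ((subdivide B).edgeForm k σ) ((subdivide B).contSpace S))
    (p : Piece B) :
    (w p).1 * (revolve k p.hi (d p.1)).1 = (w p).2 * (revolve k p.lo (d p.1)).1 := by
  let H := subdivide B
  obtain ⟨hfS, hfE⟩ := flux_eq_zero_of_mem_formOrth hw.2
  have hwK := mem_kirchhoffVals_iff.1 (SignedSolution.formRadical_le_kirchhoffVals hσ hw)
  -- The Wronskian of `w` and the eigenfunction on the piece. The symmetry of the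
  -- Dirichlet-to-Neumann matrix gives it the same expression at both ends.
  let D : Piece B → ℂ := fun p => coB k (H.len p) *
    ((w p).1 * (revolve k p.hi (d p.1)).1 - (w p).2 * (revolve k p.lo (d p.1)).1)
  have hD0 : ∀ p, D p = (w p).1 * (revolve k p.lo (d p.1)).2 -
      H.slopeStart k p w * (revolve k p.lo (d p.1)).1 := by
    intro p
    have h := slopeStart_realSol (d := d) hk hs p
    rw [slopeStart_apply, ends_realSol] at h
    rw [← h, slopeStart_apply]
    simp only [D, H]
    ring
  have hD1 : ∀ p, D p = (w p).2 * (revolve k p.hi (d p.1)).2 -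
      H.slopeEnd k p w * (revolve k p.hi (d p.1)).1 := by
    intro p
    have h := slopeEnd_realSol (d := d) hk hs p
    rw [slopeEnd_apply, ends_realSol] at h
    rw [← h, slopeEnd_apply]
    simp only [D, H]
    ring
  have hz0 : ∀ p, H.src p ∈ S → D p = 0 := by
    intro p hp
    have h := hfS p hp
    rw [fluxStart_apply, sub_eq_zero] at h
    rw [hD0, hS p hp, h]
    push_cast
    ring
  have hz1 : ∀ p, H.tgt p ∈ S → D p = 0 := by
    intro p hp
    have h := hfE p hp
    rw [fluxEnd_apply, sub_eq_zero] at h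
    rw [hD1, hS' p hp, h]
    push_cast
    ring
  have hconst := (subdivideRefinement G B).const D fun p q hpq hoff => by
    have hpq : p.1 = q.1 := hpq
    have hlo : p.hi = q.lo := by
      have h : q.lo = p.lo + (p.hi - p.lo) := hoff
      linarith
    have ht : H.tgt p = H.src q := Piece.tgt_eq_src hpq hlo
    -- At a point of `S` both functions satisfy the same Robin condition, so the Wronskian is zero
    -- on both sides. At other inner nodes value and derivative of both are continuous.
    by_cases hx : H.src q ∈ S
    · rw [hz0 q hx, hz1 p (ht ▸ hx)]
    · have h0 : q.lo ≠ 0 := hlo ▸ (p.lo_mem.1.trans_lt p.lo_lt_hi).ne'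
      have h1 : p.hi ≠ G.len p.1 := by
        rw [hlo, hpq]
        exact (q.lo_lt_hi.trans_le q.hi_mem.2).ne
      have hsrc : ∀ r, H.src r = H.src q ↔ r = q :=
        fun r => ⟨Piece.eq_of_src_eq h0, fun h => by rw [h]⟩
      have htgt : ∀ r, H.tgt r = H.src q ↔ r = p := fun r => by
        rw [← ht]
        exact ⟨Piece.eq_of_tgt_eq h1, fun h => by rw [h]⟩
      obtain ⟨⟨a, ha, ha'⟩, hsum⟩ := hwK _ hx
      rw [sum_filter_eq_of_iff hsrc, sum_filter_eq_of_iff htgt] at hsum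
      rw [hD0 q, hD1 p, ha q rfl, ha' p ht, hlo, hpq, hsum]
  -- The Wronskian is constant along the edge and vanishes at a point of `S`, which exists on every
  -- edge.
  obtain ⟨x, hx, hxS⟩ := hin p.1
  obtain ⟨r, hr, hrx⟩ := Piece.exists_hi_eq (B := B)
    (mem_nodes_iff.2 (Or.inr (Or.inr ⟨hx, hSB hxS⟩))) hx.1.ne'
  have hrS : H.tgt r ∈ S := by
    have : H.tgt r = Point.inner p.1 x hx := by
      rw [← pt_of_mem_Ioo]
      exact pt_congr hr hrx
    rw [this]
    exact hxS
  have h0 : D p = 0 := (hconst p r hr.symm).trans (hz1 r hrS)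
  have hB := Complex.ofReal_ne_zero.2 (coB_pos hk (H.len_pos p) (hs p)).ne'
  exact sub_eq_zero.1 ((mul_eq_zero.1 h0).resolve_left hB)

end FineData

end MetricGraph

/-! ### Inertia of a nondegenerate complement. -/

theorem formRadical_neg {A : Type*} [AddCommGroup A] [Module ℂ A] (Q : A →ₗ⋆[ℂ] A →ₗ[ℂ] ℂ)
    (Y : Submodule ℂ A) : formRadical (-Q) Y = formRadical Q Y := by
  ext w
  refine and_congr_right fun _ => forall₂_congr fun z _ => ?_
  rw [LinearMap.neg_apply, LinearMap.neg_apply, neg_eq_zero]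

/-- Inertia of the orthogonal complement of a nondegenerate subspace. -/
theorem negIndex_formOrth_add_negIndex_neg {A : Type*} [AddCommGroup A] [Module ℂ A]
    [FiniteDimensional ℂ A] {Q : A →ₗ⋆[ℂ] A →ₗ[ℂ] ℂ} (hQ : Q.IsSymm) {Y₀ Y : Submodule ℂ A}
    (hle : Y₀ ≤ Y) (h₀ : formRadical Q Y₀ = ⊥) (h : formRadical Q Y = ⊥) :
    negIndex Q (formOrth Q Y₀ ⊓ Y) + negIndex (-Q) (formOrth Q Y₀ ⊓ Y) =
      Module.finrank ℂ (formOrth Q Y₀ ⊓ Y : Submodule ℂ A) := by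
  have hQ' : (-Q).IsSymm := ⟨fun x y => by simpa using hQ.eq x y⟩
  have ho : formOrth (-Q) Y₀ = formOrth Q Y₀ := by
    ext w
    refine forall₂_congr fun z _ => ?_
    rw [LinearMap.neg_apply, LinearMap.neg_apply, neg_eq_zero]
  have h1 := negIndex_eq_add_formOrth hQ hle h₀
  have h2 := negIndex_eq_add_formOrth hQ' hle ((formRadical_neg Q Y₀).trans h₀)
  have h3 := negIndex_add_negIndex_neg hQ Y h
  have h4 := negIndex_add_negIndex_neg hQ Y₀ h₀
  have h5 := finrank_eq_add_formOrth hle h₀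
  rw [ho] at h2
  omega

namespace MetricGraph

/-! ### The eigenvalue count on a subdivision. -/

section Counting

variable {V E : Type*} {G : MetricGraph V E} [Fintype E]

/-- At a point of `S` a continuous function contributes the same Robin term on the ingoing and on
the outgoing edge with opposite signs. So the eigenvalue count does not see `σ`. -/
theorem edgeForm_self_eq {S : Finset V} (htwo : G.TwoSided S) {k : ℝ} {σ : V → ℝ}
    (hσ : ∀ x ∉ S, σ x = 0) {w : E → ℂ × ℂ} (hw : w ∈ G.contSpace ∅) :
    G.edgeForm k σ w w = G.edgeForm k 0 w w := by
  have h := sum_ends G (fun e => (σ (G.src e) : ℂ) * ((starRingEnd ℂ) (w e).1 * (w e).1))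
    (fun e => (σ (G.tgt e) : ℂ) * ((starRingEnd ℂ) (w e).2 * (w e).2)) ∅ (by
      intro v _
      by_cases hv : v ∈ S
      · obtain ⟨⟨e₁, h₁⟩, e₀, h₀⟩ := htwo v hv
        obtain ⟨a, ha, ha'⟩ := hw v (by simp)
        have ht := (h₁ e₁).2 rfl
        have hs := (h₀ e₀).2 rfl
        rw [sum_filter_eq_of_iff h₀, sum_filter_eq_of_iff h₁, ht, hs, ha e₀ hs, ha' e₁ ht]
      · rw [Finset.sum_eq_zero, Finset.sum_eq_zero]
        · intro e he
          rw [(Finset.mem_filter.1 he).2, hσ v hv, Complex.ofReal_zero, zero_mul]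
        · intro e he
          rw [(Finset.mem_filter.1 he).2, hσ v hv, Complex.ofReal_zero, zero_mul])
  rw [Finset.sum_empty] at h
  rw [edgeForm_apply, edgeForm_apply, ← sub_eq_zero, ← Finset.sum_sub_distrib, ← neg_eq_zero, ← h,
    ← Finset.sum_neg_distrib]
  refine Finset.sum_congr rfl fun e _ => ?_
  simp only [fluxStart_apply, fluxEnd_apply, Pi.zero_apply, Complex.ofReal_zero]
  ring

theorem kirchhoffVals_empty (k : ℝ) :
    G.kirchhoffVals k ∅ = formRadical (G.edgeForm k 0) (G.contSpace ∅) := by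
  have h : G.contSpace ∅ ⊓ G.vanishOn ∅ = G.contSpace ∅ :=
    inf_eq_left.2 fun w _ => ⟨fun _ he => he.elim, fun _ he => he.elim⟩
  rw [kirchhoffVals, Finset.coe_empty, h, formRadical]

/-- The eigenvalues are counted by the index of the discretised form. -/
theorem eventually_negIndex_eq_eigenvalueCount (B : Finset G.Point) {K k₀ : ℝ}
    (hK : ∀ p, K * (subdivide B).len p < Real.pi) (hk₀ : k₀ ∈ Icc 0 K) :
    ∀ᶠ k in nhdsWithin k₀ (Ioi k₀), negIndex ((subdivide B).edgeForm k 0)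
      ((subdivide B).contSpace ∅) = G.eigenvalueCount (k₀ ^ 2) := by
  have equiv : ∀ k ∈ Icc 0 K, Nonempty (G.eigenspace (k ^ 2) ≃ₗ[ℂ]
      formRadical ((subdivide B).edgeForm k 0) ((subdivide B).contSpace ∅)) := by
    intro k hk
    have hs : ∀ p, k * (subdivide B).len p < Real.pi := fun p =>
      (mul_le_mul_of_nonneg_right hk.2 ((subdivide B).len_pos p).le).trans_lt (hK p)
    have e := (subdivideRefinement G B).endsEquiv hk.1 hs (B := ∅) (B' := ∅)
      (fun v => by simp) (by simp)
    rw [kirchhoffVals_empty, ← eigenspace_eq_kirchhoffOff] at e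
    exact ⟨e⟩
  refine negIndex_eq_finrank_iSup _ (iSupIndep_eigenspace G)
    (fun c hc => eigenspace_eq_bot_of_neg G hc) hK ?_ ?_ hk₀
  · intro k hk
    obtain ⟨e⟩ := equiv k hk
    exact e.symm.finiteDimensional
  · intro k hk
    obtain ⟨e⟩ := equiv k hk
    exact e.finrank_eq

end Counting

/-! ### The index identities for the Robin maps. -/

section Robin

open Module

variable {V E : Type*} {G : MetricGraph V E} [Fintype E] {k₀ : ℝ} {d : E → ℝ × ℝ}

/-- The grid points added to `S` are interior points of edges and have degree two, so the
subdivision remains two-sided at all its nodes while its pieces become short. -/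
theorem exists_fine_subdivision (hG : G.Coherent) (hk₀ : 0 ≤ k₀) (S : Finset G.Point)
    (hS : ∀ p ∈ S, G.degree p = 2) : ∃ B, S ⊆ B ∧ (subdivide B).TwoSided B ∧
      (∀ p : Piece B, k₀ * (subdivide B).len p < Real.pi) ∧
      ∀ᶠ k in nhdsWithin k₀ (Ioi k₀), negIndex ((subdivide B).edgeForm k 0)
        ((subdivide B).contSpace ∅) = G.eigenvalueCount (k₀ ^ 2) := by
  obtain ⟨A, hA, hAB⟩ := exists_short_subdivision G (K := k₀ + 1) (by linarith)
  refine ⟨A ∪ S, Finset.subset_union_right, ?_, fun p => ?_, ?_⟩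
  · refine subdivide_twoSided hG fun p hp => ?_
    rcases Finset.mem_union.1 hp with h | h
    · obtain ⟨e, x, hx, rfl⟩ := hA p h
      rfl
    · exact hS p h
  · have h1 := hAB _ Finset.subset_union_left p
    have h2 := (subdivide (A ∪ S)).len_pos p
    nlinarith
  · exact eventually_negIndex_eq_eigenvalueCount _ (hAB _ Finset.subset_union_left)
      ⟨hk₀, by linarith⟩

theorem eventually_nonneg_short {B : Finset G.Point} (hk₀ : 0 ≤ k₀)
    (hs : ∀ p : Piece B, k₀ * (subdivide B).len p < Real.pi) :
    ∀ᶠ k in nhdsWithin k₀ (Ioi k₀), 0 ≤ k ∧ ∀ p : Piece B, k * (subdivide B).len p < Real.pi := by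
  filter_upwards [nhdsWithin_le_nhds (eventually_short hs), self_mem_nhdsWithin] with k h1 h2
  exact ⟨hk₀.trans (le_of_lt h2), h1⟩

variable [ConnectedSpace G.Point] [Nonempty E]

/-- The continuous functions have index `n`; those vanishing on `S` have index `ν`, which arises
from the radical at `k₀`. The Schur complement carries the Morse index. -/
theorem eventually_robinMap_infty (hG : G.Coherent) (hk₀ : 0 ≤ k₀)
    (hg : G.realSol k₀ d ∈ G.eigenspace (k₀ ^ 2)) (hd : ∀ e, d e ≠ 0)
    (hgen : ∀ t, 2 < G.vertexDegree (G.tip t) → (tipState (G.realSol k₀ d) t).1 ≠ 0)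
    {S : Finset G.Point} (hS : (S : Set G.Point) = sPointsTwo (G.realSol k₀ d) ∞) :
    ∀ᶠ k in nhdsWithin k₀ (Ioi k₀), (subdivide S).RobinWellPosed ∞ (k ^ 2) S ∧
      G.eigenvalueCount (k₀ ^ 2) = sDomainCount (G.realSol k₀ d) ∞ +
        morseIndex ((subdivide S).robinMap ∞ (k ^ 2) S) ∧
      morseIndex ((subdivide S).robinMap ∞ (k ^ 2) S) +
        posIndex ((subdivide S).robinMap ∞ (k ^ 2) S) = S.card := by
  have hmem : ∀ p, p ∈ S ↔ p ∈ sPointsTwo (G.realSol k₀ d) ∞ := fun p => by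
    rw [← hS, Finset.mem_coe]
  have hdeg : ∀ p ∈ S, G.degree p = 2 := fun p hp => ((hmem p).1 hp).2
  obtain ⟨B, hSB, -, hs, hcount⟩ := exists_fine_subdivision hG hk₀ S hdeg
  have hsol := signedSolution_realSol hk₀ hs hg hd fun p hp => hSB ((hmem p).2 hp)
  have hN : ∀ p : Piece B, (subdivide B).src p ∈ S ↔ (revolve k₀ p.lo (d p.1)).1 = 0 :=
    fun p => (hmem _).trans (pt_mem_sPointsTwo_infty_iff hg hd hgen p.1 ⟨p.lo, p.lo_mem⟩)
  have hN' : ∀ p : Piece B, (subdivide B).tgt p ∈ S ↔ (revolve k₀ p.hi (d p.1)).1 = 0 :=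
    fun p => (hmem _).trans (pt_mem_sPointsTwo_infty_iff hg hd hgen p.1 ⟨p.hi, p.hi_mem⟩)
  have h0 : negIndex ((subdivide B).edgeForm k₀ 0)
      ((subdivide B).contSpace ∅ ⊓ (subdivide B).vanishOn S) = 0 := by
    simpa using hsol.negIndex_vanishOn_eq_zero (σ := 0) (B := ∅) (fun _ _ => rfl) (by simp)
      (by simp) hN hN' hk₀ hs
  have hR := edgeForm_negIndex_eventually_right 0 hk₀ hs
    ((subdivide B).contSpace ∅ ⊓ (subdivide B).vanishOn S)
  have hR' := edgeForm_negIndex_eventually_right 0 hk₀ hs ((subdivide B).contSpace ∅)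
  rw [h0, hsol.finrank_formRadical_vanishOn hN hN' hk₀ hs, ← sDomainCount_eq hS hSB] at hR
  filter_upwards [hR, hR', hcount, eventually_nonneg_short hk₀ hs] with k hk1 hk2 hk3 hk4
  have hQ := (subdivide B).edgeForm_isSymm k 0
  obtain ⟨hw, hM⟩ := (fineRefinement hSB).robinMap_infty hk4.1 hk4.2
    (fineRefinement_not_isNew hSB) (subdivide_twoSided hG hdeg)
    (by rw [fineRefinement_mapVert]; exact hk1.2)
  obtain ⟨hm, hp, hf⟩ := hM _ rfl
  rw [fineRefinement_mapVert] at hm hp hf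
  have h1 := negIndex_eq_add_formOrth hQ inf_le_left hk1.2
  have h2 := negIndex_formOrth_add_negIndex_neg hQ inf_le_left hk1.2 hk2.2
  exact ⟨hw, by omega, by omega⟩

/-- The functions with jumps on `S` have index `ν + φ`, and the continuous ones have index `n`. The
complement carries the positive index of the Robin map. -/
theorem eventually_robinMap_coe (hG : G.Coherent) (hk₀ : 0 < k₀)
    (hlen : ∀ e, Real.pi < k₀ * G.len e)
    (hg : G.realSol k₀ d ∈ G.eigenspace (k₀ ^ 2)) (hd : ∀ e, d e ≠ 0)
    (hgen : ∀ t, 2 < G.vertexDegree (G.tip t) → (tipState (G.realSol k₀ d) t).1 ≠ 0) (s : ℝ)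
    {S N : Finset G.Point} (hS : (S : Set G.Point) = sPointsTwo (G.realSol k₀ d) s)
    (hN : (N : Set G.Point) = sPointsTwo (G.realSol k₀ d) ∞) :
    ∀ᶠ k in nhdsWithin k₀ (Ioi k₀), (subdivide S).RobinWellPosed s (k ^ 2) S ∧
      sDomainCount (G.realSol k₀ d) s + N.card = G.eigenvalueCount (k₀ ^ 2) +
        posIndex ((subdivide S).robinMap s (k ^ 2) S) := by
  have hmem : ∀ p, p ∈ S ↔ p ∈ sPointsTwo (G.realSol k₀ d) s := fun p => by
    rw [← hS, Finset.mem_coe]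
  have hmemN : ∀ p, p ∈ N ↔ p ∈ sPointsTwo (G.realSol k₀ d) ∞ := fun p => by
    rw [← hN, Finset.mem_coe]
  have hdegS : ∀ p ∈ S, G.degree p = 2 := fun p hp => ((hmem p).1 hp).2
  have hdeg : ∀ p ∈ S ∪ N, G.degree p = 2 := fun p hp =>
    (Finset.mem_union.1 hp).elim (hdegS p) fun h => ((hmemN p).1 h).2
  obtain ⟨B, hSNB, htwo, hs, hcount⟩ := exists_fine_subdivision hG hk₀.le (S ∪ N) hdeg
  have hSB := Finset.subset_union_left.trans hSNB
  have hNB := Finset.subset_union_right.trans hSNB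
  let σ : G.Point → ℝ := fun x => if x ∈ S then s else 0
  have hσ : ∀ x ∉ S, σ x = 0 := fun x hx => if_neg hx
  have hslope : ∀ e (x : Icc (0 : ℝ) (G.len e)), G.pt ⟨e, x⟩ ∈ S →
      (revolve k₀ x (d e)).2 = σ (G.pt ⟨e, x⟩) * (revolve k₀ x (d e)).1 := by
    intro e x hx
    have h := sDefect_of_mem_sPointsTwo ((hmem _).1 hx)
    rw [sDefect_coe, sub_eq_zero] at h
    simp only [σ, if_pos hx, h]
  have hzero : ∀ e (x : Icc (0 : ℝ) (G.len e)), G.pt ⟨e, x⟩ ∈ N ↔ (revolve k₀ x (d e)).1 = 0 :=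
    fun e x => (hmemN _).trans (pt_mem_sPointsTwo_infty_iff hg hd hgen e x)
  -- At a common point value and derivative would both vanish, and so would the solution on that
  -- edge. Degree two guarantees that the point lies on an edge.
  have hdisj : ∀ x ∈ N, x ∉ S := by
    intro x hx hxS
    obtain ⟨e, y, rfl⟩ : ∃ e y, G.pt ⟨e, y⟩ = x := by
      rcases x with v | ⟨e, y, hy⟩
      · have h : 0 < G.vertexDegree v := by
          have := hdegS _ hxS
          change G.vertexDegree v = 2 at this
          omega
        rw [← card_tips] at h
        obtain ⟨t, ht⟩ := Finset.card_pos.1 h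
        obtain ⟨e, y, hy, -⟩ := exists_pt_eq_tip t
        exact ⟨e, y, hy.trans (congrArg _ (Finset.mem_filter.1 ht).2)⟩
      · exact ⟨e, _, pt_of_mem_Ioo e hy⟩
    have h1 := (hzero e y).1 hx
    have h2 := hslope e y hxS
    rw [h1, mul_zero] at h2
    exact revolve_ne_zero (hd e) (Prod.ext h1 h2)
  have hin : ∀ e, ∃ x hx, Point.inner e x hx ∈ S := fun e => by
    obtain ⟨x, hx, h⟩ := exists_inner_mem_sPointsTwo (d := d) hk₀ (hlen e) s
    exact ⟨x, hx, (hmem _).2 h⟩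
  have hsol := signedSolution_realSol hk₀.le hs hg hd fun p hp => hNB ((hmemN p).2 hp)
  have hB0 : ∀ p : Piece B, (subdivide B).src p ∈ S →
      (revolve k₀ p.lo (d p.1)).2 = σ ((subdivide B).src p) * (revolve k₀ p.lo (d p.1)).1 :=
    fun p hp => hslope p.1 ⟨p.lo, p.lo_mem⟩ hp
  have hB1 : ∀ p : Piece B, (subdivide B).tgt p ∈ S →
      (revolve k₀ p.hi (d p.1)).2 = σ ((subdivide B).tgt p) * (revolve k₀ p.hi (d p.1)).1 :=
    fun p hp => hslope p.1 ⟨p.hi, p.hi_mem⟩ hp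
  have htwoN : (subdivide B).TwoSided N := fun v hv => htwo v (hNB hv)
  have htwoS : (subdivide B).TwoSided S := fun v hv => htwo v (hSB hv)
  have hindex := hsol.eventually_negIndex_contSpace hσ hB0 hB1
    (fun p => hzero p.1 ⟨p.lo, p.lo_mem⟩) (fun p => hzero p.1 ⟨p.hi, p.hi_mem⟩) hk₀.le hs hdisj
    htwoN (fun w hw p => wronskian_eq_zero hk₀.le hs hSB hσ hB0 hB1 hin hw p)
    (finrank_linkSpace_add_card hSB htwoN hdisj hin)
  have hR := edgeForm_negIndex_eventually_right σ hk₀.le hs ((subdivide B).contSpace ∅)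
  rw [← sDomainCount_eq hS hSB] at hindex
  filter_upwards [hindex, hR, hcount, eventually_nonneg_short hk₀.le hs] with k hk1 hk2 hk3 hk4
  have hQ := (subdivide B).edgeForm_isSymm k σ
  obtain ⟨hw, hp⟩ := (fineRefinement hSB).robinMap_coe hk4.1 hk4.2
    (fineRefinement_not_isNew hSB) (subdivide_twoSided hG hdegS) s (σ := σ)
    (by rw [fineRefinement_mapVert]) (by rw [fineRefinement_mapVert]; exact hk1.2)
  rw [fineRefinement_mapVert] at hp
  have h1 := negIndex_eq_add_formOrth hQ (contSpace_mono (empty_subset _)) hk2.2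
    (Y := (subdivide B).contSpace S)
  have h2 : negIndex ((subdivide B).edgeForm k σ) ((subdivide B).contSpace ∅) =
      negIndex ((subdivide B).edgeForm k 0) ((subdivide B).contSpace ∅) :=
    negIndex_congr fun w hw => edgeForm_self_eq htwoS hσ hw
  exact ⟨hw, by omega⟩

end Robin

end MetricGraph

/-! ### Passage to the spectral parameter and the final assembly. -/

/-- The substitution `k = √(k₀² + ε)` maps a right neighbourhood of `0` to one of `k₀`; this
includes `k₀ = 0`. -/
theorem exists_pos_of_eventually_sq {P : ℝ → Prop} {k₀ : ℝ} (hk₀ : 0 ≤ k₀)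
    (h : ∀ᶠ k in nhdsWithin k₀ (Ioi k₀), P (k ^ 2)) :
    ∃ ε₀ > 0, ∀ ε ∈ Ioo 0 ε₀, P (k₀ ^ 2 + ε) := by
  obtain ⟨b, hb, h⟩ := mem_nhdsGT_iff_exists_Ioo_subset.1 h
  have hb : k₀ < b := hb
  refine ⟨b ^ 2 - k₀ ^ 2, by nlinarith, fun ε hε => ?_⟩
  have h1 : 0 ≤ k₀ ^ 2 + ε := by nlinarith [hε.1, sq_nonneg k₀]
  have h2 : √(k₀ ^ 2 + ε) ∈ Ioo k₀ b :=
    ⟨Real.lt_sqrt_of_sq_lt (by linarith [hε.1]),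
      (Real.sqrt_lt' (hk₀.trans_lt hb)).2 (by linarith [hε.2])⟩
  have h3 : P (√(k₀ ^ 2 + ε) ^ 2) := h h2
  rwa [Real.sq_sqrt h1] at h3

namespace MetricGraph

section Generic

variable {V E : Type*} {G : MetricGraph V E} [Fintype E] {n : ℕ} {lam : ℝ} {f : G.H2}

theorem IsGenericEigenpair.nonneg (hf : G.IsGenericEigenpair n lam f) : 0 ≤ lam := by
  by_contra! h
  have h1 := hf.mem_eigenspace
  rw [eigenspace_eq_bot_of_neg G h, Submodule.mem_bot] at h1
  exact hf.ne_zero h1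

theorem IsGenericEigenpair.nonempty (hf : G.IsGenericEigenpair n lam f) : Nonempty E := by
  by_contra h
  rw [not_nonempty_iff] at h
  exact hf.ne_zero (Subtype.ext (Subsingleton.elim _ _))

/-- A generic eigenfunction is a multiple of a real one. -/
theorem IsGenericEigenpair.exists_realSol [ConnectedSpace G.Point] {k : ℝ}
    (hf : G.IsGenericEigenpair n (k ^ 2) f) : ∃ (d : E → ℝ × ℝ) (a : ℂ), a ≠ 0 ∧ a • G.realSol k d = f ∧
      G.realSol k d ∈ G.eigenspace (k ^ 2) ∧ (∀ e, d e ≠ 0) ∧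
      ∀ t, 2 < G.vertexDegree (G.tip t) → (tipState (G.realSol k d) t).1 ≠ 0 := by
  obtain ⟨d, a, ha, hg, hfa⟩ := MetricGraph.exists_realSol hf.mem_eigenspace hf.ne_zero hf.simple
  refine ⟨d, a, ha, hfa, hg, fun e he => ?_, ?_⟩
  · have h1 : state (G.realSol k d) e 0 = 0 := by
      rw [state_realSol k d e ⟨le_rfl, (G.len_pos e).le⟩, revolve_zero, he]
      simp
    refine hf.state_ne_zero e ?_
    rw [← state_zero_eq] at h1 ⊢
    have h2 := congrArg Prod.fst h1
    have h3 := congrArg Prod.snd h1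
    change val e (startPt e) _ = 0 at h2
    change der e (startPt e) _ = 0 at h3
    rw [← hfa]
    change (val e (startPt e) _, der e (startPt e) _) = ((0 : ℂ), (0 : ℂ))
    rw [map_smul, map_smul, h2, h3, smul_zero]
  · rintro (e | e) h h0
    · change val e (startPt e) _ = 0 at h0
      refine (hf.generic_src e h).1 ?_
      rw [← hfa, map_smul, h0, smul_zero]
    · change val e (endPt e) _ = 0 at h0
      refine (hf.generic_tgt e h).1 ?_
      rw [← hfa, map_smul, h0, smul_zero]

theorem pi_lt_mul_len [Nonempty E] {k : ℝ} (h : Real.pi / G.minLength < k) :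
    0 < k ∧ ∀ e, Real.pi < k * G.len e := by
  have hle : ∀ e, G.minLength ≤ G.len e := fun e => ciInf_le (Set.finite_range _).bddBelow e
  have hpos : 0 < G.minLength := by
    obtain ⟨e, he⟩ := exists_eq_ciInf_of_finite (f := G.len)
    rw [minLength, ← he]
    exact G.len_pos e
  have hk : 0 < k := (div_pos Real.pi_pos hpos).trans h
  exact ⟨hk, fun e => ((div_lt_iff₀ hpos).1 h).trans_le (mul_le_mul_of_nonneg_left (hle e) hk.le)⟩

end Generic

end MetricGraph

open MetricGraph in
theorem theorem3p4 {V E : Type*} [Finite V] [Fintype E] (G : MetricGraph V E)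
    [ConnectedSpace G.Point] (hG : G.Coherent) (n : ℕ) (lam : ℝ) (f : G.H2)
    (hf : G.IsGenericEigenpair n lam f) :
    (Real.pi / G.minLength < √lam → ∀ s : OnePoint ℝ,
      ∃ hB : (MetricGraph.sPointsTwo f s).Finite, ∃ ε₀ > 0, ∀ ε ∈ Ioo 0 ε₀,
        (MetricGraph.subdivide hB.toFinset).RobinWellPosed s (lam + ε) hB.toFinset ∧
        (n : ℤ) - MetricGraph.sDomainCount f s = MetricGraph.nodalCount f -
          posIndex ((MetricGraph.subdivide hB.toFinset).robinMap s (lam + ε) hB.toFinset)) ∧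
    ∃ hB : (MetricGraph.sPointsTwo f ∞).Finite, ∃ ε₀ > 0, ∀ ε ∈ Ioo 0 ε₀,
      (MetricGraph.subdivide hB.toFinset).RobinWellPosed ∞ (lam + ε) hB.toFinset ∧
      (n : ℤ) - MetricGraph.sDomainCount f ∞ =
        morseIndex ((MetricGraph.subdivide hB.toFinset).robinMap ∞ (lam + ε) hB.toFinset) := by
  have : Nonempty E := hf.nonempty
  obtain ⟨k, hk, rfl⟩ : ∃ k, 0 ≤ k ∧ k ^ 2 = lam :=
    ⟨√lam, Real.sqrt_nonneg _, Real.sq_sqrt hf.nonneg⟩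
  obtain ⟨d, a, ha, hfa, hg, hd, hgen⟩ := hf.exists_realSol
  have hpts : ∀ s, sPoints f s = sPoints (G.realSol k d) s := fun s => by
    rw [← hfa, sPoints_smul ha]
  have htwo : ∀ s, sPointsTwo f s = sPointsTwo (G.realSol k d) s := fun s => by
    rw [← hfa, sPointsTwo_smul ha]
  have hdom : ∀ s, sDomainCount f s = sDomainCount (G.realSol k d) s := fun s => by
    rw [sDomainCount, hpts, sDomainCount]
  have hBinf : (sPointsTwo f ∞).Finite := by
    rw [htwo]
    exact finite_sPointsTwo hk (Or.inl rfl) hd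
  have hcoe : (hBinf.toFinset : Set G.Point) = sPointsTwo (G.realSol k d) ∞ := by
    rw [Set.Finite.coe_toFinset, htwo]
  have hnodal : nodalCount f = hBinf.toFinset.card := by
    rw [nodalCount, hpts, sPoints_infty_eq hg hd, ← hcoe, Set.ncard_coe_finset]
  obtain ⟨ε₀, hε₀, hinf⟩ := exists_pos_of_eventually_sq hk
    (P := fun c => (subdivide hBinf.toFinset).RobinWellPosed ∞ c hBinf.toFinset ∧
      G.eigenvalueCount (k ^ 2) = sDomainCount (G.realSol k d) ∞ +
        morseIndex ((subdivide hBinf.toFinset).robinMap ∞ c hBinf.toFinset) ∧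
      morseIndex ((subdivide hBinf.toFinset).robinMap ∞ c hBinf.toFinset) +
        posIndex ((subdivide hBinf.toFinset).robinMap ∞ c hBinf.toFinset) = hBinf.toFinset.card)
    (eventually_robinMap_infty hG hk hg hd hgen hcoe)
  rw [hf.index, ← hdom, ← hnodal] at hinf
  refine ⟨fun hlen s => ?_, hBinf, ε₀, hε₀, fun ε hε => ?_⟩
  · rw [Real.sqrt_sq hk] at hlen
    obtain ⟨hk0, hlen⟩ := pi_lt_mul_len hlen
    induction s using OnePoint.rec with
    | infty =>
      refine ⟨hBinf, ε₀, hε₀, fun ε hε => ?_⟩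
      obtain ⟨h1, h2, h3⟩ := hinf ε hε
      -- For `s = ∞` the first part follows from `n = ν + Mor` and `Mor + Pos = φ`.
      exact ⟨h1, by omega⟩
    | coe s =>
      have hB : (sPointsTwo f s).Finite := by
        rw [htwo]
        exact finite_sPointsTwo hk (Or.inr hk0) hd
      have hcoe' : (hB.toFinset : Set G.Point) = sPointsTwo (G.realSol k d) s := by
        rw [Set.Finite.coe_toFinset, htwo]
      obtain ⟨ε₁, hε₁, hs⟩ := exists_pos_of_eventually_sq hk
        (P := fun c => (subdivide hB.toFinset).RobinWellPosed s c hB.toFinset ∧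
          sDomainCount (G.realSol k d) s + hBinf.toFinset.card = G.eigenvalueCount (k ^ 2) +
            posIndex ((subdivide hB.toFinset).robinMap s c hB.toFinset))
        (eventually_robinMap_coe hG hk0 hlen hg hd hgen s hcoe' hcoe)
      rw [hf.index, ← hdom, ← hnodal] at hs
      refine ⟨hB, ε₁, hε₁, fun ε hε => ?_⟩
      obtain ⟨h1, h2⟩ := hs ε hε
      exact ⟨h1, by omega⟩
  · obtain ⟨h1, h2, -⟩ := hinf ε hε
    exact ⟨h1, by omega⟩
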